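/- Let $n\ge 4$. For $f\in\mathbb{Z}[x]$ of degree $n$, an integer $m\ge 1$ and $l\in\mathbb{Z}$, say that $f$ is weakly divisible by $m$ at $l$ if $m^2\mid f(l)$ and $m\mid f'(l)$. Write $f_l(x)=f(x+l)=\sum_{j=0}^n c_jx^j$, let $\delta$ be the image of $x$ in $\mathbb{Q}[x]/(f_l)$, and put $B_0=1$ and $B_k=c_n\delta^k+c_{n-1}\delta^{k-1}+\cdots+c_{n-k}$ for $1\le k\le n-1$. When $f$ is weakly divisible by $m$ at $l$, the lattice $$R'_{(f_l,m)}=\mathbb{Z}\langle B_0,B_1,\dots,B_{n-2},B_{n-1}/m\rangle$$ is a ring. We say that $f$ is a Reduced-$m$-polynomial at $l$ if the vectors $B_0,\dots,B_{n-2},B_{n-1}/m$ form a basis of $R'_{(f_l,m)}\otimes\mathbb{R}\simeq\mathbb{R}^{r_1}\oplus\mathbb{C}^{r_2}$ with $r_1+2r_2=n$ (in particular $f$ has no multiple roots) and the lengths $t_1,\dots,t_n$ of their Gram–Schmidt orthogonalizations for the norm $\|x\|^2=\sum_{\sigma}|\sigma(x)|^2$ ($\sigma$ running over all homomorphisms to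 $\mathbb{C}$) satisfy $t_2/t_1\ge 2$ and $t_i/t_2\ge 2$ for $3\le i\le n$. For real $s,t>0$ let $W(s:t)$ be the set of polynomials $\sum_{i=0}^n a_ix^{n-i}\in\mathbb{Z}[x]$ with $0\le a_1\le \frac s2\le a_0\le s$ and $|a_i|\le st^i$ for $2\le i\le n$, let $W(s:t:m)$ be the set of pairs $(f,l)$ with $f\in W(s:t)$, $0\le l<m$ and $f$ weakly divisible by $m$ at $l$, and let $W(s:t:m)^{Red}$ be the set of those $(f,l)\in W(s:t:m)$ for which $f$ is a Reduced-$m$-polynomial at $l$. Given $X,s>0$ and $m\ge1$, set $$t=\left(\frac{m^2X}{s^{2n-2}}\right)^{\frac{1}{n(n-1)}},$$ and for $A>0$ let $S_A(X,s,m)$ be the number of isomorphism classes of rings $R'_{(f_l,m)}$ with $(f,l)\in W(s:t:m)^{Red}$ and $|\mathrm{disc}(R'_{(f_l,m)})|\le AX$. Theorem. For every $n\ge 4$ there are constants $A>0$ and $c>0$ depending only on $n$ such that for every $\epsilon>0$ there is a constant $K>0$ depending only on $n$ and $\epsilon$ with $$S_A(X,s,m)\ \ge\ c\,(1-\epsilon)\,\frac{X^{\frac12+\frac1n}\,s^{\frac2n}}{m^{1-\frac2n}}$$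 for all integers $m\ge 1$ and real $s,X$ satisfying 1. $s\ge K$, 2. $X\ge K\,s^{2n-2}\,m^{\,n-1+\frac{2}{n-2}}$, 3. $X\ge K\,s^{n-1}\,m^{2n-4}$. -/

import Mathlib

open Polynomial

/-!
An integral binary form `f(x, y) = ∑ a_j x^j y^(n-j)` of degree `n` with `a_n ≠ 0` is represented by
the polynomial `f(x, 1) : ℤ[X]`, whose `natDegree` is `n`; `h.coeff j` is the coefficient of `x^j`.
-/

namespace WeaklyDivisible

/-! ### The lattices `R_h` and `R'_(h,m)` -/

/-- The `ℚ`-algebra `ℚ[X] / (h(X))`. -/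
abbrev FormAlgebra (h : ℤ[X]) : Type := AdjoinRoot (h.map (Int.castRingHom ℚ))

/-- The image `δ` of `X` in `ℚ[X] / (h(X))`. -/
noncomputable def delta (h : ℤ[X]) : FormAlgebra h := AdjoinRoot.root _

/-- `a_n δ^k + a_(n-1) δ^(k-1) + ⋯ + a_(n-k)`, where `n = deg h`. -/
noncomputable def horner (h : ℤ[X]) (k : ℕ) : FormAlgebra h :=
  ∑ j ∈ Finset.range (k + 1), (h.coeff (h.natDegree - j) : FormAlgebra h) * delta h ^ (k - j)

/-- The canonical basis `B_0, …, B_(n-1)` of the binary ring `R_h`: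
`B_0 = 1` and `B_k = a_n δ^k + a_(n-1) δ^(k-1) + ⋯ + a_(n-k)` for `1 ≤ k ≤ n - 1`. -/
noncomputable def binaryBasis (h : ℤ[X]) (k : ℕ) : FormAlgebra h :=
  if k = 0 then 1 else horner h k

/-- The canonical basis `B_0, …, B_(n-2), B_(n-1) / m` of `R'_(h,m)`. -/
noncomputable def weakBasis (h : ℤ[X]) (m : ℕ) (k : ℕ) : FormAlgebra h :=
  if k + 1 = h.natDegree then (m : ℚ)⁻¹ • binaryBasis h k else binaryBasis h k

/-- The lattice `R'_(h,m) = ℤ⟨B_0, …, B_(n-2), B_(n-1) / m⟩`. -/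
noncomputable def weakLattice (h : ℤ[X]) (m : ℕ) : Submodule ℤ (FormAlgebra h) :=
  Submodule.span ℤ (Set.range fun i : Fin h.natDegree => weakBasis h m i)

/-! ### `R'_(h,m)` is a ring when `m ∣ h.coeff 1` and `m ^ 2 ∣ h.coeff 0` -/

lemma horner_zero (h : ℤ[X]) : horner h 0 = (h.coeff h.natDegree : FormAlgebra h) := by
  simp [horner]

lemma horner_succ (h : ℤ[X]) (k : ℕ) :
    horner h (k + 1) = delta h * horner h k + (h.coeff (h.natDegree - (k + 1)) : FormAlgebra h) := by
  rw [horner, Finset.sum_range_succ, horner, Finset.mul_sum]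
  congr 1
  · refine Finset.sum_congr rfl fun j hj => ?_
    have hj' : k + 1 - j = (k - j) + 1 := by
      have := Finset.mem_range.1 hj
      omega
    rw [hj', pow_succ]
    ring
  · simp

lemma horner_natDegree (h : ℤ[X]) : horner h h.natDegree = 0 := by
  have h1 : (h.map (Int.castRingHom ℚ)).eval₂ (AdjoinRoot.of _) (delta h) = 0 :=
    AdjoinRoot.eval₂_root _
  rw [eval₂_map, eval₂_eq_sum_range, ← Finset.sum_range_reflect] at h1
  rw [← h1, horner]
  refine Finset.sum_congr rfl fun j hj => ?_
  have hj' : h.natDegree + 1 - 1 - j = h.natDegree - j := by omega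
  rw [hj']
  simp

lemma horner_mul_succ (h : ℤ[X]) (i j : ℕ) :
    horner h i * horner h (j + 1) = horner h (i + 1) * horner h j
      - (h.coeff (h.natDegree - (i + 1)) : FormAlgebra h) * horner h j
      + (h.coeff (h.natDegree - (j + 1)) : FormAlgebra h) * horner h i := by
  rw [horner_succ h i, horner_succ h j]
  ring

section ring

variable {h : ℤ[X]} {m : ℕ}

lemma intCast_mul_mem (c : ℤ) {x : FormAlgebra h} (hx : x ∈ weakLattice h m) :
    (c : FormAlgebra h) * x ∈ weakLattice h m := by
  rw [← zsmul_eq_mul]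
  exact (weakLattice h m).smul_mem c hx

lemma weakBasis_mem {k : ℕ} (hk : k < h.natDegree) : weakBasis h m k ∈ weakLattice h m :=
  Submodule.subset_span ⟨⟨k, hk⟩, rfl⟩

lemma one_mem_weakLattice (hd : 2 ≤ h.natDegree) : (1 : FormAlgebra h) ∈ weakLattice h m := by
  have h1 := weakBasis_mem (h := h) (m := m) (k := 0) (by omega)
  rwa [weakBasis, if_neg (by omega), binaryBasis, if_pos rfl] at h1

/-- `B_(n-1) / m`. -/
lemma last_mem (hd : 2 ≤ h.natDegree) :
    (m : ℚ)⁻¹ • horner h (h.natDegree - 1) ∈ weakLattice h m := by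
  have h1 := weakBasis_mem (h := h) (m := m) (k := h.natDegree - 1) (by omega)
  rwa [weakBasis, if_pos (by omega), binaryBasis, if_neg (by omega)] at h1

lemma cast_mul_smul (hm : 0 < m) (x : FormAlgebra h) :
    ((m : ℤ) : FormAlgebra h) * ((m : ℚ)⁻¹ • x) = x := by
  have hm' : (m : ℚ) ≠ 0 := by exact_mod_cast hm.ne'
  have h2 : ((m : ℤ) : FormAlgebra h) = algebraMap ℚ (FormAlgebra h) (m : ℚ) := by simp
  rw [h2, ← Algebra.smul_def, smul_smul, mul_inv_cancel₀ hm', one_smul]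

lemma horner_mem (hd : 2 ≤ h.natDegree) (hm : 0 < m) {k : ℕ} (hk : k ≤ h.natDegree) :
    horner h k ∈ weakLattice h m := by
  rcases Nat.eq_zero_or_pos k with rfl | hk0
  · rw [horner_zero, ← mul_one (Int.cast _)]
    exact intCast_mul_mem _ (one_mem_weakLattice hd)
  rcases hk.eq_or_lt with rfl | hk1
  · rw [horner_natDegree]
    exact Submodule.zero_mem _
  rcases eq_or_ne (k + 1) h.natDegree with hk2 | hk2
  · have hk3 : k = h.natDegree - 1 := by omega
    rw [hk3, ← cast_mul_smul hm (horner h _)]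
    exact intCast_mul_mem _ (last_mem hd)
  · have h1 := weakBasis_mem (h := h) (m := m) hk1
    rwa [weakBasis, if_neg hk2, binaryBasis, if_neg (by omega)] at h1

lemma horner_mul_mem (hd : 2 ≤ h.natDegree) (hm : 0 < m) (j : ℕ) :
    ∀ i, i ≤ h.natDegree → j ≤ h.natDegree → horner h i * horner h j ∈ weakLattice h m := by
  induction j with
  | zero =>
    intro i hi _
    rw [horner_zero, mul_comm]
    exact intCast_mul_mem _ (horner_mem hd hm hi)
  | succ j ih =>
    intro i hi hj
    rcases hi.eq_or_lt with rfl | hi'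
    · rw [horner_natDegree, zero_mul]
      exact Submodule.zero_mem _
    · rw [horner_mul_succ]
      exact Submodule.add_mem _ (Submodule.sub_mem _ (ih _ hi' (by omega))
        (intCast_mul_mem _ (horner_mem hd hm (by omega))))
        (intCast_mul_mem _ (horner_mem hd hm hi))

lemma inv_smul_cast_mul (hm : 0 < m) (c : ℤ) (x : FormAlgebra h) :
    (m : ℚ)⁻¹ • ((((m : ℤ) * c : ℤ) : FormAlgebra h) * x) = (c : FormAlgebra h) * x := by
  rw [Int.cast_mul, mul_assoc, ← mul_smul_comm, cast_mul_smul hm]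

lemma last_mul_succ (hd : 2 ≤ h.natDegree) (j : ℕ) :
    horner h (h.natDegree - 1) * horner h (j + 1) =
      - ((h.coeff 0 : FormAlgebra h) * horner h j)
      + (h.coeff (h.natDegree - (j + 1)) : FormAlgebra h) * horner h (h.natDegree - 1) := by
  have h1 : h.natDegree - 1 + 1 = h.natDegree := by omega
  rw [horner_mul_succ, h1, horner_natDegree, Nat.sub_self]
  ring

lemma last_mul_mem (hd : 2 ≤ h.natDegree) (hm : 0 < m) (h0 : (m : ℤ) ^ 2 ∣ h.coeff 0) {j : ℕ}
    (hj : j < h.natDegree) :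
    ((m : ℚ)⁻¹ • horner h (h.natDegree - 1)) * horner h j ∈ weakLattice h m := by
  rcases j with _ | j
  · rw [horner_zero, mul_comm]
    exact intCast_mul_mem _ (last_mem hd)
  · obtain ⟨c, hc⟩ := h0
    have hc' : h.coeff 0 = (m : ℤ) * ((m : ℤ) * c) := by rw [hc]; ring
    rw [smul_mul_assoc, last_mul_succ hd, smul_add, smul_neg, hc', inv_smul_cast_mul hm,
      ← mul_smul_comm]
    exact Submodule.add_mem _
      (Submodule.neg_mem _ (intCast_mul_mem _ (horner_mem hd hm (by omega))))
      (intCast_mul_mem _ (last_mem hd))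

lemma last_mul_last_mem (hd : 2 ≤ h.natDegree) (hm : 0 < m) (h0 : (m : ℤ) ^ 2 ∣ h.coeff 0)
    (h1 : (m : ℤ) ∣ h.coeff 1) :
    ((m : ℚ)⁻¹ • horner h (h.natDegree - 1)) * ((m : ℚ)⁻¹ • horner h (h.natDegree - 1))
      ∈ weakLattice h m := by
  obtain ⟨c, hc⟩ := h0
  obtain ⟨d, hd'⟩ := h1
  have hc' : h.coeff 0 = (m : ℤ) * ((m : ℤ) * c) := by rw [hc]; ring
  obtain ⟨j, hj⟩ : ∃ j, h.natDegree = j + 2 := ⟨h.natDegree - 2, by omega⟩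
  have e1 : h.natDegree - 1 = j + 1 := by omega
  have e2 : h.natDegree - (j + 1) = 1 := by omega
  have key := last_mul_succ hd j
  rw [e2, hc', hd', e1] at key
  rw [e1, smul_mul_assoc, mul_smul_comm, key, smul_add, smul_neg, inv_smul_cast_mul hm,
    inv_smul_cast_mul hm, smul_add, smul_neg, inv_smul_cast_mul hm, ← mul_smul_comm]
  have hl := last_mem (h := h) (m := m) hd
  rw [e1] at hl
  exact Submodule.add_mem _
    (Submodule.neg_mem _ (intCast_mul_mem _ (horner_mem hd hm (by omega))))
    (intCast_mul_mem _ hl)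

lemma weakBasis_mul_mem (hd : 2 ≤ h.natDegree) (hm : 0 < m) (h0 : (m : ℤ) ^ 2 ∣ h.coeff 0)
    (h1 : (m : ℤ) ∣ h.coeff 1) {i j : ℕ} (hi : i < h.natDegree) (hj : j < h.natDegree) :
    weakBasis h m i * weakBasis h m j ∈ weakLattice h m := by
  rcases Nat.eq_zero_or_pos i with rfl | hi0
  · have e : weakBasis h m 0 = 1 := by
      rw [weakBasis, if_neg (by omega), binaryBasis, if_pos rfl]
    rw [e, one_mul]
    exact weakBasis_mem hj
  rcases Nat.eq_zero_or_pos j with rfl | hj0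
  · have e : weakBasis h m 0 = 1 := by
      rw [weakBasis, if_neg (by omega), binaryBasis, if_pos rfl]
    rw [e, mul_one]
    exact weakBasis_mem hi
  have ei : binaryBasis h i = horner h i := if_neg (by omega)
  have ej : binaryBasis h j = horner h j := if_neg (by omega)
  rw [weakBasis, weakBasis, ei, ej]
  split_ifs with hi1 hj1 hj1
  · obtain rfl : i = h.natDegree - 1 := by omega
    obtain rfl : j = h.natDegree - 1 := by omega
    exact last_mul_last_mem hd hm h0 h1
  · obtain rfl : i = h.natDegree - 1 := by omega
    exact last_mul_mem hd hm h0 hj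
  · obtain rfl : j = h.natDegree - 1 := by omega
    rw [mul_comm]
    exact last_mul_mem hd hm h0 hi
  · exact horner_mul_mem hd hm j i hi.le hj.le

lemma weakLattice_mul_mem (hd : 2 ≤ h.natDegree) (hm : 0 < m) (h0 : (m : ℤ) ^ 2 ∣ h.coeff 0)
    (h1 : (m : ℤ) ∣ h.coeff 1) {x y : FormAlgebra h} (hx : x ∈ weakLattice h m)
    (hy : y ∈ weakLattice h m) : x * y ∈ weakLattice h m := by
  refine Submodule.span_induction (p := fun x _ => x * y ∈ weakLattice h m) ?_ ?_ ?_ ?_ hx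
  · rintro _ ⟨i, rfl⟩
    refine Submodule.span_induction
      (p := fun y _ => weakBasis h m i * y ∈ weakLattice h m) ?_ ?_ ?_ ?_ hy
    · rintro _ ⟨j, rfl⟩
      exact weakBasis_mul_mem hd hm h0 h1 i.2 j.2
    · rw [mul_zero]
      exact Submodule.zero_mem _
    · intro a b _ _ ha hb
      rw [mul_add]
      exact Submodule.add_mem _ ha hb
    · intro c a _ ha
      rw [mul_smul_comm]
      exact Submodule.smul_mem _ _ ha
  · rw [zero_mul]
    exact Submodule.zero_mem _
  · intro a b _ _ ha hb
    rw [add_mul]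
    exact Submodule.add_mem _ ha hb
  · intro c a _ ha
    rw [smul_mul_assoc]
    exact Submodule.smul_mem _ _ ha

end ring

/-! ### Weakly divisible polynomials and their rings -/

/-- `f` is weakly divisible by `m` at `l`: `f(l) ≡ 0 mod m²` and `f'(l) ≡ 0 mod m`. -/
def WeaklyDivisibleAt (f : ℤ[X]) (m : ℕ) (l : ℤ) : Prop :=
  (m : ℤ) ^ 2 ∣ f.eval l ∧ (m : ℤ) ∣ f.derivative.eval l

/-- The translate `f_l(x) = f(x + l)`. -/
noncomputable def translate (f : ℤ[X]) (l : ℤ) : ℤ[X] := f.comp (X + C l)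

lemma natDegree_translate (f : ℤ[X]) (l : ℤ) : (translate f l).natDegree = f.natDegree :=
  natDegree_taylor f l

/-- The weakly divisible ring `R'_(f_l,m)`, with underlying set the lattice `R'_(f_l,m)`. -/
noncomputable def weakRing (f : ℤ[X]) (m : ℕ) (l : ℤ) (hd : 2 ≤ f.natDegree) (hm : 0 < m)
    (hw : WeaklyDivisibleAt f m l) : Subring (FormAlgebra (translate f l)) where
  carrier := weakLattice (translate f l) m
  zero_mem' := Submodule.zero_mem _
  one_mem' := one_mem_weakLattice (by rwa [natDegree_translate])
  add_mem' := Submodule.add_mem _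
  neg_mem' := Submodule.neg_mem _
  mul_mem' := weakLattice_mul_mem (by rwa [natDegree_translate]) hm
    (by rw [show translate f l = taylor l f from rfl, taylor_coeff_zero]; exact hw.1)
    (by rw [show translate f l = taylor l f from rfl, taylor_coeff_one]; exact hw.2)

instance weakRing_finite (f : ℤ[X]) (m : ℕ) (l : ℤ) (hd : 2 ≤ f.natDegree) (hm : 0 < m)
    (hw : WeaklyDivisibleAt f m l) : Module.Finite ℤ (weakRing f m l hd hm hw) := by
  have : Module.Finite ℤ (weakLattice (translate f l) m) :=
    Module.Finite.span_of_finite ℤ (Set.finite_range _)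
  exact Module.Finite.of_surjective
    (AddMonoidHom.toIntLinearMap
      ({ toFun := fun x => ⟨x.1, x.2⟩, map_zero' := rfl, map_add' := fun _ _ => rfl } :
        weakLattice (translate f l) m →+ weakRing f m l hd hm hw))
    (fun x => ⟨⟨x.1, x.2⟩, rfl⟩)

instance weakRing_free (f : ℤ[X]) (m : ℕ) (l : ℤ) (hd : 2 ≤ f.natDegree) (hm : 0 < m)
    (hw : WeaklyDivisibleAt f m l) : Module.Free ℤ (weakRing f m l hd hm hw) := by
  have : IsAddTorsionFree (FormAlgebra (translate f l)) := IsAddTorsionFree.of_module_rat _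
  have : Module.IsTorsionFree ℤ (weakRing f m l hd hm hw) :=
    Function.Injective.moduleIsTorsionFree
      (fun x : weakRing f m l hd hm hw => (x : FormAlgebra (translate f l)))
      Subtype.val_injective (fun c x => by simp)
  exact Module.free_of_finite_type_torsion_free'

/-- The discriminant of a ring `R` that is free of finite rank over `ℤ`: the determinant of the
trace form `(x, y) ↦ Tr_{R/ℤ}(x y)` with respect to a `ℤ`-basis (it does not depend on the basis). -/
noncomputable def ringDisc (R : Type) [CommRing R] [Module.Free ℤ R] [Module.Finite ℤ R] : ℤ :=
  Algebra.discr ℤ (Module.Free.chooseBasis ℤ R)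

/-! ### Reduced polynomials -/

/-- `v 0, …, v (n-1)` is linearly independent over `ℝ` and, with `t_(i+1)` the length of the
projection of `v i` to the orthogonal complement of the span of `v 0, …, v (i-1)`, one has
`t_2 / t_1 ≥ 2` and `t_i / t_2 ≥ 2` for `3 ≤ i ≤ n`. -/
def NormallyMinkowskiReduced {E : Type*} [NormedAddCommGroup E] [InnerProductSpace ℝ E]
    (n : ℕ) (v : ℕ → E) : Prop :=
  LinearIndependent ℝ (fun i : Fin n => v i) ∧
  2 * ‖InnerProductSpace.gramSchmidt ℝ v 0‖ ≤ ‖InnerProductSpace.gramSchmidt ℝ v 1‖ ∧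
  ∀ i, 2 ≤ i → i < n →
    2 * ‖InnerProductSpace.gramSchmidt ℝ v 1‖ ≤ ‖InnerProductSpace.gramSchmidt ℝ v i‖

/-- The complex roots of `h`; they correspond to the ring homomorphisms `ℚ[X] / (h) → ℂ`. -/
abbrev Roots (h : ℤ[X]) : Type := (h.map (Int.castRingHom ℚ)).rootSet ℂ

/-- The canonical embedding of `ℚ[X] / (h)`: `x` is sent to the vector of its images under all ring
homomorphisms to `ℂ`, and the canonical norm is `‖x‖² = ∑_σ |σ x|²`. If `h` has degree `n` and no
multiple roots, the real span of the image is `(ℚ[X] / (h)) ⊗ ℝ ≃ ℝ^r ⊕ ℂ^s`, `r + 2 s = n`. -/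
noncomputable def canonicalEmbedding (h : ℤ[X]) (x : FormAlgebra h) :
    EuclideanSpace ℂ (Roots h) :=
  WithLp.toLp 2 fun z =>
    AdjoinRoot.lift (algebraMap ℚ ℂ) (z : ℂ) (aeval_eq_zero_of_mem_rootSet z.2) x

/-- `(f, m, l)` is a reduced-`m`-polynomial (at `l`): the canonical basis of `R'_(f_l,m)` is normally
Minkowski reduced in `R'_(f_l,m) ⊗ ℝ ≃ ℝ^r ⊕ ℂ^s`. The linear independence that is part of this
forces `f` to have no multiple roots. -/
def IsReducedPoly (f : ℤ[X]) (m : ℕ) (l : ℤ) : Prop :=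
  NormallyMinkowskiReduced f.natDegree
    (fun k => canonicalEmbedding (translate f l) (weakBasis (translate f l) m k))

/-! ### The sets `W(s:t)`, `W(s:t:m)`, `W(s:t:m)^Red` and the count -/

/-- `W(s:t)`: the polynomials `∑ a_i x^(n-i)` of degree `n` in `ℤ[x]` with
`0 ≤ a_1 ≤ s/2 ≤ a_0 ≤ s` and `|a_i| ≤ s t^i` for `2 ≤ i ≤ n`. -/
def W (n : ℕ) (s t : ℝ) : Set ℤ[X] :=
  {f | f.natDegree = n ∧
    0 ≤ (f.coeff (n - 1) : ℝ) ∧ (f.coeff (n - 1) : ℝ) ≤ s / 2 ∧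
    s / 2 ≤ (f.coeff n : ℝ) ∧ (f.coeff n : ℝ) ≤ s ∧
    ∀ i, 2 ≤ i → i ≤ n → |(f.coeff (n - i) : ℝ)| ≤ s * t ^ i}

/-- `W(s:t:m)`. -/
def Wm (n : ℕ) (s t : ℝ) (m : ℕ) : Set (ℤ[X] × ℤ) :=
  {p | p.1 ∈ W n s t ∧ 0 ≤ p.2 ∧ p.2 < m ∧ WeaklyDivisibleAt p.1 m p.2}

/-- `W(s:t:m)^Red`. -/
def WmRed (n : ℕ) (s t : ℝ) (m : ℕ) : Set (ℤ[X] × ℤ) :=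
  {p | p ∈ Wm n s t m ∧ IsReducedPoly p.1 m p.2}

/-- The ring `R'_(f_l,m)` of a pair `(f, l)` in `W(s:t:m)^Red`. -/
noncomputable abbrev ringOf {n : ℕ} (hn : 2 ≤ n) {s t : ℝ} {m : ℕ} (p : WmRed n s t m) :
    Subring (FormAlgebra (translate p.1.1 p.1.2)) :=
  weakRing p.1.1 m p.1.2 (hn.trans_eq p.2.1.1.1.symm)
    (by exact_mod_cast p.2.1.2.1.trans_lt p.2.1.2.2.1) p.2.1.2.2.2

/-- Two pairs are equivalent when their rings are isomorphic. -/
def isoSetoid {n : ℕ} (hn : 2 ≤ n) (s t : ℝ) (m : ℕ) (D : ℝ) :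
    Setoid {p : WmRed n s t m // |(ringDisc (ringOf hn p) : ℝ)| ≤ D} where
  r p q := Nonempty (ringOf hn p.1 ≃+* ringOf hn q.1)
  iseqv :=
    { refl := fun _ => ⟨RingEquiv.refl _⟩
      symm := fun ⟨e⟩ => ⟨e.symm⟩
      trans := fun ⟨e⟩ ⟨e'⟩ => ⟨e.trans e'⟩ }

/-- The number of isomorphism classes of rings `R'_(f_l,m)` with `(f, l)` in `W(s:t:m)^Red` and
absolute discriminant at most `D`. -/
noncomputable def ringCount {n : ℕ} (hn : 2 ≤ n) (s t : ℝ) (m : ℕ) (D : ℝ) : ℕ :=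
  Nat.card (Quotient (isoSetoid hn s t m D))

/-- The `t` with `X = s^(2n-2) t^(n(n-1)) / m²`. -/
noncomputable def tParam (n : ℕ) (X s : ℝ) (m : ℕ) : ℝ :=
  ((m : ℝ) ^ 2 * X / s ^ (2 * n - 2)) ^ (1 / ((n : ℝ) * ((n : ℝ) - 1)))

/-- `S(X,s,m)`, where "discriminant `≪ X`" is made precise as absolute discriminant `≤ A X`. -/
noncomputable def S {n : ℕ} (hn : 2 ≤ n) (A X s : ℝ) (m : ℕ) : ℕ :=
  ringCount hn s (tParam n X s m) m (A * X)

end WeaklyDivisible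

namespace WeaklyDivisible

/-! ### Separated roots -/

/-! It suffices to exhibit enough pairs `(f, l)` whose rings are pairwise non-isomorphic. Take `f`
in a box where the constant term has size `s t^n`, the leading coefficient has size `s`, and the
remaining coefficients are a small multiple `η` of what the weights allow (`InBox`). Such an `f` is
a perturbation of `a_0 x^n + a_n`: its roots have absolute value at most `2nt` and are separated by
`ρ t`, with `η` and `ρ` depending only on `n` (`InBox.norm_root_le`, `InBox.separatedRoots`).

Separation is the main tool. By Lagrange interpolation, a polynomial of degree `k < n` with leading
coefficient `b` takes a value of size at least `|b| σ^k / (k + 1)` at some root. The element `B_k`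
is the value at `δ` of a polynomial of degree `k`, so this bounds the Gram–Schmidt lengths from
below (`WellShaped.isReducedPoly`) and shows that elements with small conjugates lie in `ℤ⟨B_0,
B_1⟩` (`WellShaped.coord_eq_zero`). The upper bound on the roots bounds the discriminant.

Non-isomorphism is `eq_of_ringEquiv`. Let `θ = δ + l`, a root of `f`. Since `a_0 θ` has small
conjugates, an isomorphism sends it to `c + k a_0' θ'`; applying this to the inverse as well gives
`k = ±1`. The coordinate of `(a_0 θ)²` at `B_2`, modulo `ℤ⟨B_0, B_1⟩`, recovers `a_0`. Hence `f(k x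
+ c / a_0) = k^n g(x)`. Coprimality of `a_0` and `a_1` makes `c / a_0` an integer, and `0 < a_1 ≤
a_0` on both sides then forces `c = 0` and `k = 1`. Finally `B_(n-1) / m` remembers `l` modulo `m`.

For the count, choose `a_0`, `a_1` coprime, the middle coefficients and `l` freely. Weak
divisibility fixes the linear coefficient modulo `m` and the constant one modulo `m²`, so of order
`s^(n+1) t^((n-1)(n+2)/2) · m / m³` polynomials arise, which is the main term (`main_term_eq`).
Conditions 2 and 3 say that `t`, `t^(n-2) / m` and `s t^n / m²` are large (`largeParams_tParam`). -/

/-- `h` has `deg h` distinct complex roots, any two of them at distance at least `σ`. -/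
structure SeparatedRoots (h : ℤ[X]) (σ : ℝ) : Prop where
  card_eq : (h.aroots ℂ).toFinset.card = h.natDegree
  sep : ∀ z w : ℂ, aeval z h = 0 → aeval w h = 0 → z ≠ w → σ ≤ ‖z - w‖

/-- Lagrange interpolation bounds the coefficients of a polynomial that is small at sufficiently
many separated points. -/
lemma norm_coeff_mul_pow_le {Z : Finset ℂ} {σ M : ℝ} (hσ : 0 < σ)
    (hZ : ∀ z ∈ Z, ∀ w ∈ Z, z ≠ w → σ ≤ ‖z - w‖) {p : ℂ[X]} {k : ℕ} (hp : p.natDegree ≤ k)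
    (hk : k < Z.card) (hM : ∀ z ∈ Z, ‖p.eval z‖ ≤ M) :
    ‖p.coeff k‖ * σ ^ k ≤ (k + 1) * M := by
  obtain ⟨s, hs, hcard⟩ := Finset.exists_subset_card_eq (Nat.succ_le_of_lt hk)
  have hdeg : p.degree < (s.card : WithBot ℕ) := by
    rw [hcard]
    exact (degree_le_of_natDegree_le hp).trans_lt (by exact_mod_cast Nat.lt_succ_self k)
  -- On `k + 1` nodes the coefficient of `X ^ k` is the sum of `p(z) / ∏ (z - w)`, and each product
  -- has `k` factors of size at least `σ`.
  have h1 := Lagrange.coeff_eq_sum (s := s) (v := id) (Set.injOn_id _) hdeg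
  rw [hcard, Nat.succ_sub_one] at h1
  have h2 : ∀ z ∈ s, ‖p.eval z / ∏ w ∈ s.erase z, (z - w)‖ ≤ M / σ ^ k := by
    intro z hz
    have hprod : σ ^ k ≤ ∏ w ∈ s.erase z, ‖z - w‖ := by
      have hc : (s.erase z).card = k := by rw [Finset.card_erase_of_mem hz, hcard]; rfl
      rw [← hc, ← Finset.prod_const]
      refine Finset.prod_le_prod (fun _ _ => hσ.le) fun w hw => ?_
      exact hZ z (hs hz) w (hs (Finset.mem_of_mem_erase hw)) (Finset.ne_of_mem_erase hw).symm
    rw [norm_div, norm_prod]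
    have hM0 : 0 ≤ M := (norm_nonneg _).trans (hM z (hs hz))
    gcongr
    exact hM z (hs hz)
  have h3 : ‖p.coeff k‖ ≤ (k + 1) * (M / σ ^ k) := by
    rw [h1]
    refine (norm_sum_le _ _).trans ((Finset.sum_le_sum h2).trans ?_)
    rw [Finset.sum_const, hcard, nsmul_eq_mul]
    push_cast
    exact le_rfl
  calc ‖p.coeff k‖ * σ ^ k ≤ (k + 1) * (M / σ ^ k) * σ ^ k := by gcongr
    _ = (k + 1) * M := by field_simp

lemma mem_toFinset_aroots {h : ℤ[X]} (h0 : h ≠ 0) {z : ℂ} :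
    z ∈ (h.aroots ℂ).toFinset ↔ aeval z h = 0 := by
  rw [Multiset.mem_toFinset, mem_aroots]
  exact ⟨fun H => H.2, fun H => ⟨h0, H⟩⟩

lemma SeparatedRoots.norm_coeff_mul_pow_le {h : ℤ[X]} {σ M : ℝ} (hs : SeparatedRoots h σ)
    (h0 : h ≠ 0) (hσ : 0 < σ) {p : ℂ[X]} {k : ℕ} (hp : p.natDegree ≤ k) (hk : k < h.natDegree)
    (hM : ∀ z, aeval z h = 0 → ‖p.eval z‖ ≤ M) : ‖p.coeff k‖ * σ ^ k ≤ (k + 1) * M :=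
  WeaklyDivisible.norm_coeff_mul_pow_le hσ
    (fun z hz w hw => hs.sep z w ((mem_toFinset_aroots h0).1 hz) ((mem_toFinset_aroots h0).1 hw))
    hp (by rwa [hs.card_eq]) (fun z hz => hM z ((mem_toFinset_aroots h0).1 hz))

/-- A polynomial of degree less than `deg h` is determined by its values at the roots of `h`. -/
lemma SeparatedRoots.eq_of_eval_eq {h : ℤ[X]} {σ : ℝ} (hs : SeparatedRoots h σ) (h0 : h ≠ 0)
    {p q : ℂ[X]} (hpq : (p - q).natDegree < h.natDegree)
    (H : ∀ z, aeval z h = 0 → p.eval z = q.eval z) : p = q := by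
  refine sub_eq_zero.1 (eq_zero_of_natDegree_lt_card_of_eval_eq_zero' (p - q)
    (h.aroots ℂ).toFinset (fun z hz => ?_) (by rwa [hs.card_eq]))
  rw [eval_sub, H z ((mem_toFinset_aroots h0).1 hz), sub_self]

/-! ### Translates -/

lemma translate_eq_taylor (f : ℤ[X]) (l : ℤ) : translate f l = taylor l f := rfl

lemma aeval_translate (f : ℤ[X]) (l : ℤ) (z : ℂ) : aeval z (translate f l) = aeval (z + l) f := by
  rw [translate, aeval_comp]
  simp

lemma SeparatedRoots.translate {f : ℤ[X]} {σ : ℝ} (hs : SeparatedRoots f σ) (h0 : f ≠ 0) (l : ℤ) :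
    SeparatedRoots (translate f l) σ where
  card_eq := by
    have h1 : WeaklyDivisible.translate f l ≠ 0 := by
      rw [translate_eq_taylor]
      exact (taylor_eq_zero l f).not.2 h0
    rw [natDegree_translate, ← hs.card_eq]
    refine Finset.card_nbij' (fun z => z + l) (fun z => z - l) ?_ ?_ ?_ ?_
    · intro z hz
      rw [Finset.mem_coe, mem_toFinset_aroots h1, aeval_translate] at hz
      exact (mem_toFinset_aroots h0).2 hz
    · intro z hz
      rw [Finset.mem_coe, mem_toFinset_aroots h0] at hz
      refine (mem_toFinset_aroots h1).2 ?_
      rwa [aeval_translate, sub_add_cancel]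
    · intro z _; simp
    · intro z _; simp
  sep z w hz hw hzw := by
    rw [aeval_translate] at hz hw
    have := hs.sep _ _ hz hw (fun H => hzw (add_right_cancel H))
    rwa [add_sub_add_right_eq_sub] at this

lemma coeff_taylor_of_natDegree_le {R : Type*} [CommRing R] {p : R[X]} {d : ℕ}
    (hp : p.natDegree ≤ d + 1) (u : R) :
    (taylor u p).coeff d = p.coeff d + (d + 1) * u * p.coeff (d + 1) := by
  rw [taylor_coeff, hasseDeriv_apply, sum_over_range' _ _ (d + 2) (by omega)]
  · rw [Finset.sum_range_succ, Finset.sum_range_succ, Finset.sum_eq_zero]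
    · simp [eval_add]
      ring
    · intro i hi
      rw [Nat.choose_eq_zero_of_lt (Finset.mem_range.1 hi)]
      simp
  · simp

lemma coeff_taylor_top {R : Type*} [CommRing R] {p : R[X]} {d : ℕ}
    (hp : p.natDegree ≤ d) (u : R) : (taylor u p).coeff d = p.coeff d := by
  rcases hp.eq_or_lt with rfl | hlt
  · exact coeff_taylor_natDegree ..
  · rw [coeff_eq_zero_of_natDegree_lt hlt, coeff_eq_zero_of_natDegree_lt (by rwa [natDegree_taylor])]

/-! ### The polynomials representing the canonical bases -/

/-- The polynomial whose value at `δ` is `horner h k`. -/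
noncomputable def hornerPoly (h : ℤ[X]) : ℕ → ℂ[X]
  | 0 => C (h.coeff h.natDegree : ℂ)
  | k + 1 => X * hornerPoly h k + C (h.coeff (h.natDegree - (k + 1)) : ℂ)

lemma coeff_hornerPoly (h : ℤ[X]) {k : ℕ} (hk : k ≤ h.natDegree) (i : ℕ) :
    (hornerPoly h k).coeff i = h.coeff (h.natDegree - k + i) := by
  induction k generalizing i with
  | zero =>
    rw [hornerPoly, coeff_C]
    split_ifs with hi
    · simp [hi]
    · rw [coeff_eq_zero_of_natDegree_lt (p := h) (by omega)]
      simp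
  | succ k ih =>
    rw [hornerPoly, coeff_add, coeff_C]
    cases i with
    | zero => simp
    | succ i =>
      rw [coeff_X_mul, ih (by omega), if_neg (by omega), add_zero]
      congr 2
      omega

lemma natDegree_hornerPoly_le (h : ℤ[X]) {k : ℕ} (hk : k ≤ h.natDegree) :
    (hornerPoly h k).natDegree ≤ k := by
  refine natDegree_le_iff_coeff_eq_zero.2 fun i hi => ?_
  rw [coeff_hornerPoly h hk, coeff_eq_zero_of_natDegree_lt (p := h) (by omega)]
  simp

/-- The last step of Horner's scheme returns the polynomial itself; this is how the relation `horner
h n = 0` will force a number to be a root. -/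
lemma hornerPoly_natDegree (h : ℤ[X]) :
    hornerPoly h h.natDegree = h.map (algebraMap ℤ ℂ) := by
  ext i
  rw [coeff_hornerPoly h le_rfl, coeff_map]
  simp

/-- The polynomial whose value at `δ` is `weakBasis h m k`. -/
noncomputable def weakPoly (h : ℤ[X]) (m k : ℕ) : ℂ[X] :=
  if k + 1 = h.natDegree then C ((m : ℂ)⁻¹) * (if k = 0 then 1 else hornerPoly h k)
  else if k = 0 then 1 else hornerPoly h k

/-- The coefficient of `X ^ k` in `weakPoly h m k`. -/
noncomputable def weakLead (h : ℤ[X]) (m k : ℕ) : ℝ :=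
  if k = 0 then 1 else h.coeff h.natDegree / (if k + 1 = h.natDegree then (m : ℝ) else 1)

lemma natDegree_weakPoly_le (h : ℤ[X]) (m : ℕ) {k : ℕ} (hk : k < h.natDegree) :
    (weakPoly h m k).natDegree ≤ k := by
  have h1 : (if k = 0 then 1 else hornerPoly h k : ℂ[X]).natDegree ≤ k := by
    split_ifs
    · simp
    · exact natDegree_hornerPoly_le h hk.le
  rw [weakPoly]
  split_ifs at h1 ⊢ <;> first | exact h1 | exact (natDegree_C_mul_le _ _).trans h1

lemma coeff_weakPoly_self {h : ℤ[X]} (hd : 2 ≤ h.natDegree) (m : ℕ) {k : ℕ}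
    (hk : k < h.natDegree) : (weakPoly h m k).coeff k = weakLead h m k := by
  have e : k ≠ 0 → (hornerPoly h k).coeff k = h.coeff h.natDegree := by
    intro _
    rw [coeff_hornerPoly h hk.le]
    congr 2
    omega
  rw [weakPoly, weakLead]
  split_ifs with h1 h2 h2
  · omega
  · rw [coeff_C_mul, e h2]
    push_cast
    rw [div_eq_inv_mul]
  · simp [h2]
  · rw [e h2]
    simp

/-- Triangularity: the `i`-th basis polynomial has degree at most `i`, so the last nonzero
coordinate can be read off a single coefficient. -/
lemma coeff_sum_weakPoly {h : ℤ[X]} (hd : 2 ≤ h.natDegree) (m : ℕ) (y : Fin h.natDegree → ℂ)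
    (j : Fin h.natDegree) (hy : ∀ i, j < i → y i = 0) :
    (∑ i, C (y i) * weakPoly h m i).coeff j = y j * weakLead h m j := by
  rw [finsetSum_coeff, Finset.sum_eq_single j]
  · rw [coeff_C_mul, coeff_weakPoly_self hd m j.2]
  · intro i _ hij
    rcases lt_or_gt_of_ne hij with hlt | hgt
    · rw [coeff_C_mul, coeff_eq_zero_of_natDegree_lt
        ((natDegree_weakPoly_le h m i.2).trans_lt hlt), mul_zero]
    · rw [hy i hgt, C_0, zero_mul, coeff_zero]
  · simp

lemma natDegree_sum_weakPoly_le {h : ℤ[X]} (m : ℕ) (y : Fin h.natDegree → ℂ)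
    (j : Fin h.natDegree) (hy : ∀ i, j < i → y i = 0) :
    (∑ i, C (y i) * weakPoly h m i).natDegree ≤ j := by
  refine natDegree_sum_le_of_forall_le _ _ fun i _ => ?_
  rcases le_or_gt i j with hle | hgt
  · exact (natDegree_C_mul_le _ _).trans ((natDegree_weakPoly_le h m i.2).trans hle)
  · rw [hy i hgt]
    simp

/-! ### Evaluation at the roots -/

/-- The homomorphism `ℚ[X] / (h) → ℂ` with `δ ↦ z`. -/
noncomputable def evalRoot (h : ℤ[X]) (z : Roots h) : FormAlgebra h →+* ℂ :=
  AdjoinRoot.lift (algebraMap ℚ ℂ) (z : ℂ) (aeval_eq_zero_of_mem_rootSet z.2)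

lemma evalRoot_delta (h : ℤ[X]) (z : Roots h) : evalRoot h z (delta h) = z := by
  exact AdjoinRoot.lift_root _

lemma evalRoot_smul (h : ℤ[X]) (z : Roots h) (q : ℚ) (x : FormAlgebra h) :
    evalRoot h z (q • x) = q * evalRoot h z x := by
  rw [Algebra.smul_def, map_mul]
  congr 1
  exact AdjoinRoot.lift_of _

lemma evalRoot_horner (h : ℤ[X]) (z : Roots h) (k : ℕ) :
    evalRoot h z (horner h k) = (hornerPoly h k).eval (z : ℂ) := by
  induction k with
  | zero => rw [horner_zero, hornerPoly, map_intCast, eval_C]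
  | succ k ih =>
    rw [horner_succ, hornerPoly, map_add, map_mul, evalRoot_delta, ih, map_intCast, eval_add,
      eval_mul, eval_X, eval_C]

lemma evalRoot_weakBasis (h : ℤ[X]) (m : ℕ) (z : Roots h) (k : ℕ) :
    evalRoot h z (weakBasis h m k) = (weakPoly h m k).eval (z : ℂ) := by
  rw [weakBasis, weakPoly, binaryBasis]
  split_ifs <;> simp [evalRoot_smul, evalRoot_horner]

lemma mem_roots_iff {h : ℤ[X]} (h0 : h ≠ 0) {z : ℂ} :
    z ∈ (h.map (Int.castRingHom ℚ)).rootSet ℂ ↔ aeval z h = 0 := by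
  have e : aeval z (h.map (Int.castRingHom ℚ)) = aeval z h := aeval_map_algebraMap ℚ z h
  rw [mem_rootSet, e]
  refine ⟨fun H => H.2, fun H => ⟨?_, H⟩⟩
  exact (Polynomial.map_ne_zero_iff (Int.cast_injective)).2 h0

lemma Roots.aeval_eq_zero {h : ℤ[X]} (h0 : h ≠ 0) (z : Roots h) : aeval (z : ℂ) h = 0 :=
  (mem_roots_iff h0).1 z.2

lemma mem_weakLattice_iff {h : ℤ[X]} {m : ℕ} {x : FormAlgebra h} :
    x ∈ weakLattice h m ↔ ∃ y : Fin h.natDegree → ℤ, ∑ i, y i • weakBasis h m i = x :=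
  Submodule.mem_span_range_iff_exists_fun ℤ

lemma evalRoot_sum (h : ℤ[X]) (m : ℕ) (z : Roots h) (y : Fin h.natDegree → ℤ) :
    evalRoot h z (∑ i, y i • weakBasis h m i) =
      (∑ i, C (y i : ℂ) * weakPoly h m i).eval (z : ℂ) := by
  rw [map_sum, eval_finsetSum]
  refine Finset.sum_congr rfl fun i _ => ?_
  rw [zsmul_eq_mul, map_mul, map_intCast, evalRoot_weakBasis, eval_mul, eval_C]

/-! ### Well-shaped polynomials -/

/-- The polynomial `f` has roots of absolute value at most `B`, pairwise `σ`-separated, where `σ` is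
so large that the canonical basis of `R'_(f_l,m)` is normally Minkowski reduced. -/
structure WellShaped (f : ℤ[X]) (m : ℕ) (B σ : ℝ) : Prop where
  four_le : 4 ≤ f.natDegree
  lead_pos : 0 < f.coeff f.natDegree
  m_pos : 0 < m
  B_pos : 0 < B
  σ_pos : 0 < σ
  separated : SeparatedRoots f σ
  bound : ∀ z : ℂ, aeval z f = 0 → ‖z‖ ≤ B
  gap : ∀ k, 2 ≤ k → k < f.natDegree →
    2 * (f.natDegree : ℝ) ^ 2 * B * (if k + 1 = f.natDegree then (m : ℝ) else 1) ≤ σ ^ k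
  gap_one : 4 * √(f.natDegree : ℝ) ≤ f.coeff f.natDegree * σ

lemma coeff_translate_natDegree (f : ℤ[X]) (l : ℤ) :
    (translate f l).coeff f.natDegree = f.coeff f.natDegree :=
  coeff_taylor_top le_rfl l

lemma translate_ne_zero {f : ℤ[X]} (h0 : f ≠ 0) (l : ℤ) : translate f l ≠ 0 := by
  rw [translate_eq_taylor]
  exact (taylor_eq_zero l f).not.2 h0

section

variable {f : ℤ[X]} {m : ℕ} {B σ : ℝ}

lemma WellShaped.ne_zero (hf : WellShaped f m B σ) : f ≠ 0 := by
  rintro rfl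
  simpa using hf.four_le

lemma WellShaped.separated_translate (hf : WellShaped f m B σ) (l : ℤ) :
    SeparatedRoots (translate f l) σ :=
  hf.separated.translate hf.ne_zero l

lemma WellShaped.weakLead_pos (hf : WellShaped f m B σ) (l : ℤ) (k : ℕ) :
    0 < weakLead (translate f l) m k := by
  have h1 : (0 : ℝ) < f.coeff f.natDegree := by exact_mod_cast hf.lead_pos
  have h2 : (0 : ℝ) < m := by exact_mod_cast hf.m_pos
  rw [weakLead, natDegree_translate, coeff_translate_natDegree]
  split_ifs <;> positivity

/-- The factor `m` built into `gap` at the last index pays for the division of `B_(n-1)` by `m`, so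
one bound serves all `k ≥ 2`. -/
lemma WellShaped.lead_mul_le (hf : WellShaped f m B σ) (l : ℤ) {k : ℕ} (hk : 2 ≤ k)
    (hkn : k < f.natDegree) :
    f.coeff f.natDegree * (2 * (f.natDegree : ℝ) ^ 2 * B) ≤
      weakLead (translate f l) m k * σ ^ k := by
  have h1 : (0 : ℝ) < f.coeff f.natDegree := by exact_mod_cast hf.lead_pos
  have h2 : (0 : ℝ) < (if k + 1 = f.natDegree then (m : ℝ) else 1) := by
    have h2 : (0 : ℝ) < m := by exact_mod_cast hf.m_pos
    split_ifs <;> positivity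
  rw [weakLead, natDegree_translate, coeff_translate_natDegree, if_neg (by omega), div_mul_eq_mul_div,
    le_div_iff₀ h2, mul_assoc]
  exact mul_le_mul_of_nonneg_left (hf.gap k hk hkn) h1.le

/-- An element of `R'_(f_l,m)` all of whose conjugates are small lies in `ℤ⟨B_0, B_1⟩`. -/
lemma WellShaped.coord_eq_zero (hf : WellShaped f m B σ) {l : ℤ}
    {y : Fin (translate f l).natDegree → ℤ}
    (hy : ∀ z, aeval z (translate f l) = 0 →
      ‖(∑ i, C (y i : ℂ) * weakPoly (translate f l) m i).eval z‖ ≤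
        2 * f.coeff f.natDegree * B) (i : Fin (translate f l).natDegree) (hi : 2 ≤ (i : ℕ)) :
    y i = 0 := by
  classical
  by_contra hne
  -- For the largest `j` with `y j ≠ 0` the top coefficient is `y j` times `weakLead`, and `|y j| ≥
  -- 1`. Interpolation then gives `2 n² a_0 B ≤ (j + 1) · 2 a_0 B ≤ 2 n a_0 B`, which is absurd.
  obtain ⟨j, hj, hmax⟩ := Finset.exists_max_image (Finset.univ.filter fun j => y j ≠ 0) id
    ⟨i, by simpa using hne⟩
  have hij : i ≤ j := hmax i (by simpa using hne)
  have hj2 : 2 ≤ (j : ℕ) := hi.trans hij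
  have hjn : (j : ℕ) < f.natDegree := j.2.trans_eq (natDegree_translate f l)
  have hz : ∀ i, j < i → (y i : ℂ) = 0 := fun i hi' => by
    by_contra H
    exact absurd (hmax i (by simpa using H)) (not_le.2 hi')
  have h1 := (hf.separated_translate l).norm_coeff_mul_pow_le (translate_ne_zero hf.ne_zero l)
    hf.σ_pos (natDegree_sum_weakPoly_le m (fun i => (y i : ℂ)) j hz) j.2 hy
  have hn4 := hf.four_le
  rw [coeff_sum_weakPoly (by rw [natDegree_translate]; omega) m _ j hz, norm_mul,
    Complex.norm_real, Real.norm_of_nonneg (hf.weakLead_pos l j).le,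
    Complex.norm_intCast] at h1
  have hyj : (1 : ℝ) ≤ |(y j : ℝ)| := by
    have : y j ≠ 0 := (Finset.mem_filter.1 hj).2
    exact_mod_cast Int.one_le_abs this
  have h2 := hf.lead_mul_le l hj2 hjn
  have ha : (0 : ℝ) < f.coeff f.natDegree := by exact_mod_cast hf.lead_pos
  have hB := hf.B_pos
  have h3 : weakLead (translate f l) m j * σ ^ (j : ℕ) ≤
      |(y j : ℝ)| * weakLead (translate f l) m j * σ ^ (j : ℕ) := by
    rw [mul_assoc]
    exact le_mul_of_one_le_left
      (mul_pos (hf.weakLead_pos l j) (pow_pos hf.σ_pos _)).le hyj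
  have h4 : ((j : ℕ) + 1 : ℝ) ≤ f.natDegree := by exact_mod_cast hjn
  have hn : (4 : ℝ) ≤ f.natDegree := by exact_mod_cast hn4
  have h5 := (h2.trans h3).trans h1
  have h6 : ((j : ℕ) + 1 : ℝ) * (2 * f.coeff f.natDegree * B) ≤
      f.natDegree * (2 * f.coeff f.natDegree * B) := by gcongr
  have h7 : 0 < (f.coeff f.natDegree : ℝ) * B * f.natDegree := by positivity
  nlinarith

/-- Linear independence of the canonical basis, over `ℂ` and after evaluation at the roots. -/
lemma WellShaped.coord_eq_zero_of_eval (hf : WellShaped f m B σ) {l : ℤ}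
    {y : Fin (translate f l).natDegree → ℂ}
    (hy : ∀ z, aeval z (translate f l) = 0 →
      (∑ i, C (y i) * weakPoly (translate f l) m i).eval z = 0) : y = 0 := by
  classical
  by_contra hne
  obtain ⟨i, hi⟩ := Function.ne_iff.1 hne
  obtain ⟨j, hj, hmax⟩ := Finset.exists_max_image (Finset.univ.filter fun j => y j ≠ 0) id
    ⟨i, by simpa using hi⟩
  have hz : ∀ i, j < i → y i = 0 := fun i hi' => by
    by_contra H
    exact absurd (hmax i (by simpa using H)) (not_le.2 hi')
  -- With the bound `M = 0` the top coefficient vanishes outright; neither integrality nor `gap`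
  -- enters.
  have h1 := (hf.separated_translate l).norm_coeff_mul_pow_le (translate_ne_zero hf.ne_zero l)
    hf.σ_pos (natDegree_sum_weakPoly_le m y j hz) j.2 (M := 0) (fun z hz' => by simp [hy z hz'])
  have hn4 := hf.four_le
  rw [coeff_sum_weakPoly (by rw [natDegree_translate]; omega) m _ j hz, mul_zero] at h1
  have h2 : 0 < ‖y j * weakLead (translate f l) m j‖ * σ ^ (j : ℕ) :=
    mul_pos (norm_pos_iff.2 (mul_ne_zero (Finset.mem_filter.1 hj).2
      (by exact_mod_cast (hf.weakLead_pos l j).ne'))) (pow_pos hf.σ_pos _)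
  exact absurd h1 (not_le.2 h2)

/-- The complex root of `h`, as an element of `Roots h`. -/
def toRoot {h : ℤ[X]} (h0 : h ≠ 0) {z : ℂ} (hz : aeval z h = 0) : Roots h :=
  ⟨z, (mem_roots_iff h0).2 hz⟩

lemma WellShaped.linearIndependent (hf : WellShaped f m B σ) (l : ℤ) :
    LinearIndependent ℤ fun i : Fin (translate f l).natDegree => weakBasis (translate f l) m i := by
  rw [Fintype.linearIndependent_iff]
  intro y hy i
  have h1 : (fun i => (y i : ℂ)) = 0 := hf.coord_eq_zero_of_eval (l := l) fun z hz => by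
    have := evalRoot_sum (translate f l) m (toRoot (translate_ne_zero hf.ne_zero l) hz) y
    rw [hy, map_zero] at this
    exact this.symm
  simpa using congrFun h1 i

end

/-! ### Homomorphisms from `R'_(f_l,m)` to `ℂ` -/

section hom

variable {f : ℤ[X]} {m : ℕ} {l : ℤ} (hd : 2 ≤ f.natDegree) (hm : 0 < m)
  (hw : WeaklyDivisibleAt f m l)

/-- `horner h k` as an element of the ring. -/
noncomputable def hornerElt {k : ℕ} (hk : k ≤ f.natDegree) : weakRing f m l hd hm hw :=
  ⟨horner (translate f l) k, horner_mem (by rwa [natDegree_translate]) hm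
    (by rwa [natDegree_translate])⟩

/-- `a_0 θ`, where `θ = δ + l` is the image of `X` under `ℚ[X] / (f) ≃ ℚ[X] / (f_l)`. -/
noncomputable def thetaElt : weakRing f m l hd hm hw :=
  hornerElt hd hm hw (k := 1) (by omega) -
    ((translate f l).coeff (f.natDegree - 1) - f.coeff f.natDegree * l : ℤ)

lemma coe_thetaElt : (thetaElt hd hm hw : FormAlgebra (translate f l)) =
    (f.coeff f.natDegree : FormAlgebra (translate f l)) * (delta (translate f l) + l) := by
  rw [thetaElt]
  simp only [hornerElt, AddSubgroupClass.coe_sub, SubringClass.coe_intCast]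
  rw [horner_succ, horner_zero, natDegree_translate, coeff_translate_natDegree]
  push_cast
  ring

lemma coe_hornerElt_one : (hornerElt hd hm hw (k := 1) (by omega) : weakRing f m l hd hm hw) =
    thetaElt hd hm hw + ((translate f l).coeff (f.natDegree - 1) - f.coeff f.natDegree * l : ℤ) := by
  rw [thetaElt, sub_add_cancel]

/-- Every homomorphism `R'_(f_l,m) → ℂ` is the evaluation at a root. -/
lemma exists_root_of_hom (ha : f.coeff f.natDegree ≠ 0) (τ : weakRing f m l hd hm hw →+* ℂ) :
    ∃ w : ℂ, aeval w (translate f l) = 0 ∧ τ (thetaElt hd hm hw) = f.coeff f.natDegree * (w + l) ∧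
      ∀ k (hk : k ≤ f.natDegree),
        τ (hornerElt hd hm hw hk) = (hornerPoly (translate f l) k).eval w := by
  have ha' : (f.coeff f.natDegree : ℂ) ≠ 0 := by exact_mod_cast ha
  -- The element `δ` need not lie in the ring, but `a_0 (δ + l)` does; dividing its image by `a_0`
  -- in `ℂ` yields the candidate root.
  set w : ℂ := τ (thetaElt hd hm hw) / f.coeff f.natDegree - l with hw_def
  have hτ : τ (thetaElt hd hm hw) = f.coeff f.natDegree * (w + l) := by
    rw [hw_def]
    field_simp
    ring
  have key : ∀ k (hk : k ≤ f.natDegree),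
      τ (hornerElt hd hm hw hk) = (hornerPoly (translate f l) k).eval w := by
    intro k
    induction k with
    | zero =>
      intro hk
      have e : hornerElt hd hm hw hk = ((f.coeff f.natDegree : ℤ) : weakRing f m l hd hm hw) := by
        apply Subtype.ext
        simp only [hornerElt, SubringClass.coe_intCast]
        rw [horner_zero, natDegree_translate, coeff_translate_natDegree]
      rw [e, map_intCast, hornerPoly, eval_C, natDegree_translate, coeff_translate_natDegree]
    | succ k ih =>
      intro hk
      -- Horner's recursion multiplied by `a_0`, so that every factor lies in the ring and `τ` can
      -- be applied.
      have e : ((f.coeff f.natDegree : ℤ) : weakRing f m l hd hm hw) * hornerElt hd hm hw hk =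
          (thetaElt hd hm hw - (f.coeff f.natDegree * l : ℤ)) *
              hornerElt hd hm hw (k := k) (by omega) +
            ((f.coeff f.natDegree * (translate f l).coeff (f.natDegree - (k + 1)) : ℤ) :
              weakRing f m l hd hm hw) := by
        apply Subtype.ext
        simp only [MulMemClass.coe_mul, AddMemClass.coe_add, AddSubgroupClass.coe_sub,
          SubringClass.coe_intCast, coe_thetaElt, hornerElt]
        rw [horner_succ, natDegree_translate]
        push_cast
        ring
      have e' := congrArg τ e
      rw [map_mul, map_intCast, map_add, map_mul, map_sub, map_intCast, map_intCast, hτ,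
        ih (by omega)] at e'
      apply mul_left_cancel₀ ha'
      rw [e', hornerPoly, eval_add, eval_mul, eval_X, eval_C, natDegree_translate]
      push_cast
      ring
  refine ⟨w, ?_, hτ, key⟩
  have h1 := key f.natDegree le_rfl
  have e : hornerElt hd hm hw (le_refl f.natDegree) = 0 := by
    apply Subtype.ext
    simp only [hornerElt, ZeroMemClass.coe_zero]
    rw [← natDegree_translate f l, horner_natDegree]
  rw [e, map_zero, ← natDegree_translate f l, hornerPoly_natDegree, eval_map_algebraMap] at h1
  exact h1.symm

end hom

/-! ### Shifting a polynomial by a rational number -/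

/-- Clearing denominators in the low-degree part of `f(u)` or `f'(u)`, so that only the two top
terms matter modulo `u.den`. -/
lemma exists_int_den_pow_mul_sum (u : ℚ) (e : ℕ → ℤ) (N : ℕ) :
    ∃ T : ℤ, (u.den : ℚ) ^ N * ∑ i ∈ Finset.range (N + 1), (e i : ℚ) * u ^ i = T := by
  have hq : (u.den : ℚ) ≠ 0 := by exact_mod_cast u.den_nz
  have hu : (u.den : ℚ) * u = u.num := by rw [mul_comm]; exact Rat.mul_den_eq_num u
  induction N with
  | zero => exact ⟨e 0, by simp⟩
  | succ N ih =>
    obtain ⟨T, hT⟩ := ih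
    refine ⟨u.den * T + e (N + 1) * u.num ^ (N + 1), ?_⟩
    rw [Finset.sum_range_succ, mul_add, pow_succ', mul_assoc, hT]
    push_cast
    rw [← hu]
    ring

/-- If `f(u)` and `f'(u)` are integers and the two leading coefficients are coprime, then a
rational `u` with `a_0 u ∈ ℤ` is an integer. -/
lemma den_eq_one_of_eval_int {f : ℤ[X]} (hn : 3 ≤ f.natDegree)
    (hcop : IsCoprime (f.coeff f.natDegree) (f.coeff (f.natDegree - 1))) {u : ℚ} {c b₀ b₁ : ℤ}
    (hc : (f.coeff f.natDegree : ℚ) * u = c) (h0 : aeval u f = b₀)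
    (h1 : aeval u (derivative f) = b₁) : u.den = 1 := by
  obtain ⟨N, hN⟩ : ∃ N, f.natDegree = N + 3 := ⟨f.natDegree - 3, by omega⟩
  rw [hN] at hcop hc
  rw [show N + 3 - 1 = N + 2 by omega] at hcop
  have hq : (u.den : ℚ) ≠ 0 := by exact_mod_cast u.den_nz
  have hu : (u.den : ℚ) * u = u.num := by rw [mul_comm]; exact Rat.mul_den_eq_num u
  have hqp : IsCoprime (u.den : ℤ) u.num := by
    rw [Int.isCoprime_iff_gcd_eq_one, Int.gcd_comm]
    exact u.reduced
  set a := f.coeff (N + 3)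
  set a' := f.coeff (N + 2)
  -- Since `a u = c`, the two top terms of `f(u)` merge into `(c + a') u^(N+2)`. Multiplying by
  -- `u.den^(N+2)` leaves `u.num^(N+2) (c + a')` modulo `u.den`.
  have d1 : (u.den : ℤ) ∣ c + a' := by
    obtain ⟨T, hT⟩ := exists_int_den_pow_mul_sum u f.coeff (N + 1)
    refine (hqp.pow_right (n := N + 2)).dvd_of_dvd_mul_left
      ⟨u.den ^ (N + 1) * b₀ - T, ?_⟩
    rw [aeval_eq_sum_range, hN, Finset.sum_range_succ, Finset.sum_range_succ] at h0
    simp only [zsmul_eq_mul] at h0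
    have : ((u.num ^ (N + 2) * (c + a') : ℤ) : ℚ) =
        ((u.den * (u.den ^ (N + 1) * b₀ - T) : ℤ) : ℚ) := by
      push_cast
      rw [← h0, ← hT, ← hc, ← hu]
      ring
    exact_mod_cast this
  -- The same for `f'(u)`, whose two top terms merge at `u^(N+1)`.
  have d2 : (u.den : ℤ) ∣ (N + 3) * c + (N + 2) * a' := by
    obtain ⟨T, hT⟩ := exists_int_den_pow_mul_sum u (fun i => f.coeff (i + 1) * (i + 1)) N
    refine (hqp.pow_right (n := N + 1)).dvd_of_dvd_mul_left ⟨u.den ^ N * b₁ - T, ?_⟩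
    have hdeg : (derivative f).natDegree < N + 3 := by
      have := natDegree_derivative_lt (p := f) (by omega)
      omega
    rw [aeval_eq_sum_range' hdeg, Finset.sum_range_succ, Finset.sum_range_succ] at h1
    simp only [zsmul_eq_mul, coeff_derivative] at h1
    have : ((u.num ^ (N + 1) * ((N + 3) * c + (N + 2) * a') : ℤ) : ℚ) =
        ((u.den * (u.den ^ N * b₁ - T) : ℤ) : ℚ) := by
      push_cast at h1 hT ⊢
      rw [← h1, ← hT, ← hc, ← hu]
      ring
    exact_mod_cast this
  -- Eliminate `c`: `(N + 3)(c + a') - ((N + 3) c + (N + 2) a') = a'`.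
  have d3 : (u.den : ℤ) ∣ a' := by
    have := dvd_sub (d1.mul_left ((N : ℤ) + 3)) d2
    ring_nf at this
    exact this
  have d4 : (u.den : ℤ) ∣ a := by
    refine hqp.dvd_of_dvd_mul_right ⟨c, ?_⟩
    have : ((a * u.num : ℤ) : ℚ) = ((u.den * c : ℤ) : ℚ) := by
      push_cast
      rw [← hc, ← hu]
      ring
    exact_mod_cast this
  have := hcop.isUnit_of_dvd' d4 d3
  rw [Int.isUnit_iff] at this
  have := u.den_pos
  omega

/-! ### Isomorphisms between the rings of well-shaped polynomials -/

section iso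

variable {f g : ℤ[X]} {m : ℕ} {B σ : ℝ} {l l' : ℤ} {hdf : 2 ≤ f.natDegree}
  {hdg : 2 ≤ g.natDegree} {hm : 0 < m} {hwf : WeaklyDivisibleAt f m l}
  {hwg : WeaklyDivisibleAt g m l'}

lemma evalRoot_thetaElt (z : Roots (translate f l)) :
    evalRoot _ z (thetaElt hdf hm hwf : FormAlgebra (translate f l)) =
      f.coeff f.natDegree * ((z : ℂ) + l) := by
  rw [coe_thetaElt, map_mul, map_intCast, map_add, evalRoot_delta, map_intCast]

lemma weakBasis_zero {h : ℤ[X]} (hd : 2 ≤ h.natDegree) (m : ℕ) : weakBasis h m 0 = 1 := by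
  rw [weakBasis, if_neg (by omega), binaryBasis, if_pos rfl]

lemma weakBasis_of_lt {h : ℤ[X]} (m : ℕ) {k : ℕ} (hk0 : k ≠ 0) (hk : k + 1 < h.natDegree) :
    weakBasis h m k = horner h k := by
  rw [weakBasis, if_neg (by omega), binaryBasis, if_neg hk0]

/-- An isomorphism maps `a_0 θ` to `ℤ + ℤ a_0' θ'`. -/
lemma exists_int_of_ringEquiv (hf : WellShaped f m B σ) (hg : WellShaped g m B σ)
    (hlead : f.coeff f.natDegree ≤ 2 * g.coeff g.natDegree)
    (φ : weakRing f m l hdf hm hwf ≃+* weakRing g m l' hdg hm hwg) :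
    ∃ c k : ℤ, φ (thetaElt hdf hm hwf) = c + k * thetaElt hdg hm hwg := by
  have hg0 := translate_ne_zero hg.ne_zero l'
  have hn := natDegree_translate g l'
  have h4 := hg.four_le
  obtain ⟨y, hy⟩ := mem_weakLattice_iff.1 (φ (thetaElt hdf hm hwf)).2
  -- Every conjugate of the image is `a_0` times a root of `f`, hence at most `a_0 B ≤ 2 a_0' B`;
  -- this leaves only the coordinates at `B_0` and `B_1`.
  have hbd := hg.coord_eq_zero (l := l') (y := y) fun z hz => by
    have h1 := evalRoot_sum (translate g l') m (toRoot hg0 hz) y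
    obtain ⟨w, hw, hτ, -⟩ := exists_root_of_hom hdf hm hwf hf.lead_pos.ne'
      (((evalRoot (translate g l') (toRoot hg0 hz)).comp
        (weakRing g m l' hdg hm hwg).subtype).comp φ.toRingHom)
    have hτ' : evalRoot (translate g l') (toRoot hg0 hz) (φ (thetaElt hdf hm hwf)).1 =
        f.coeff f.natDegree * (w + l) := hτ
    rw [hy, hτ'] at h1
    rw [aeval_translate] at hw
    have e : ((toRoot hg0 hz : Roots _) : ℂ) = z := rfl
    rw [e] at h1
    have ha : (0 : ℝ) < f.coeff f.natDegree := by exact_mod_cast hf.lead_pos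
    rw [← h1, norm_mul, Complex.norm_intCast, abs_of_pos ha]
    have hl : (f.coeff f.natDegree : ℝ) ≤ 2 * g.coeff g.natDegree := by exact_mod_cast hlead
    exact mul_le_mul hl (hf.bound _ hw) (norm_nonneg _) (ha.le.trans hl)
  set i0 : Fin (translate g l').natDegree := ⟨0, by omega⟩
  set i1 : Fin (translate g l').natDegree := ⟨1, by omega⟩
  have hsum : ∑ i, y i • weakBasis (translate g l') m i =
      y i0 • weakBasis (translate g l') m i0 + y i1 • weakBasis (translate g l') m i1 := by
    refine Fintype.sum_eq_add i0 i1 (by simp [i0, i1]) fun i hi => ?_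
    rw [hbd i, zero_smul]
    have h0 : (i : ℕ) ≠ 0 := fun H => hi.1 (Fin.ext H)
    have h1 : (i : ℕ) ≠ 1 := fun H => hi.2 (Fin.ext H)
    omega
  have e0 : weakBasis (translate g l') m i0 = 1 := weakBasis_zero (by omega) m
  have e1 : weakBasis (translate g l') m i1 =
      (hornerElt hdg hm hwg (k := 1) (by omega) : weakRing g m l' hdg hm hwg) :=
    weakBasis_of_lt m one_ne_zero (by change 1 + 1 < _; omega)
  refine ⟨y i0 + y i1 * ((translate g l').coeff (g.natDegree - 1) - g.coeff g.natDegree * l'),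
    y i1, Subtype.ext ?_⟩
  rw [← hy, hsum, e0, e1, coe_hornerElt_one]
  simp only [MulMemClass.coe_mul, AddMemClass.coe_add, SubringClass.coe_intCast, zsmul_eq_mul]
  push_cast
  ring

lemma WellShaped.exists_two_roots (hf : WellShaped f m B σ) :
    ∃ z w : ℂ, aeval z f = 0 ∧ aeval w f = 0 ∧ z ≠ w := by
  have h1 : 1 < (f.aroots ℂ).toFinset.card := by
    rw [hf.separated.card_eq]
    have := hf.four_le
    omega
  obtain ⟨z, hz, w, hw, hne⟩ := Finset.one_lt_card.1 h1
  exact ⟨z, w, (mem_toFinset_aroots hf.ne_zero).1 hz, (mem_toFinset_aroots hf.ne_zero).1 hw, hne⟩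

/-- Composing the two maps gives `a_0 θ = c + k (c' + k' a_0 θ)`. Subtracting this relation at two
distinct roots leaves `k k' = 1` in `ℤ`. -/
lemma sq_eq_one_of_ringEquiv (hf : WellShaped f m B σ)
    (φ : weakRing f m l hdf hm hwf ≃+* weakRing g m l' hdg hm hwg) {c k c' k' : ℤ}
    (h1 : φ (thetaElt hdf hm hwf) = c + k * thetaElt hdg hm hwg)
    (h2 : φ.symm (thetaElt hdg hm hwg) = c' + k' * thetaElt hdf hm hwf) : k ^ 2 = 1 := by
  have h3 : thetaElt hdf hm hwf = c + k * (c' + k' * thetaElt hdf hm hwf) := by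
    rw [← h2, ← φ.symm_apply_apply (thetaElt hdf hm hwf), h1, map_add, map_mul, map_intCast,
      map_intCast]
  have h4 : ∀ z : ℂ, aeval z f = 0 → f.coeff f.natDegree * z =
      c + k * (c' + k' * (f.coeff f.natDegree * z)) := by
    intro z hz
    have hz' : aeval (z - l) (translate f l) = 0 := by rwa [aeval_translate, sub_add_cancel]
    have h5 := congrArg (fun x : weakRing f m l hdf hm hwf =>
      evalRoot _ (toRoot (translate_ne_zero hf.ne_zero l) hz') (x : FormAlgebra (translate f l))) h3
    simp only [MulMemClass.coe_mul, AddMemClass.coe_add, SubringClass.coe_intCast,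
      evalRoot_thetaElt, map_add, map_mul, map_intCast] at h5
    have e : ((toRoot (translate_ne_zero hf.ne_zero l) hz' : Roots _) : ℂ) = z - l := rfl
    rwa [e, sub_add_cancel] at h5
  obtain ⟨z, w, hz, hw, hne⟩ := hf.exists_two_roots
  have ha : (f.coeff f.natDegree : ℂ) ≠ 0 := by exact_mod_cast hf.lead_pos.ne'
  have h5 : (f.coeff f.natDegree : ℂ) * (z - w) * (1 - k * k') = 0 := by
    linear_combination h4 z hz - h4 w hw
  rcases mul_eq_zero.1 h5 with h5 | h5
  · exact absurd h5 (mul_ne_zero ha (sub_ne_zero.2 hne))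
  · have h6 : k * k' = 1 := by
      have : (k * k' : ℂ) = 1 := (sub_eq_zero.1 h5).symm
      exact_mod_cast this
    rcases Int.eq_one_or_neg_one_of_mul_eq_one h6 with rfl | rfl <;> norm_num

/-- Multiplying `B_2` by `a_0` turns it into a monic quadratic in `a_0 θ`. This ties the leading
coefficient to the multiplication of the ring. -/
lemma exists_mul_hornerElt_two (hd : 2 ≤ f.natDegree) (hm : 0 < m)
    (hw : WeaklyDivisibleAt f m l) : ∃ A A' : ℤ,
    ((f.coeff f.natDegree : ℤ) : weakRing f m l hd hm hw) * hornerElt hd hm hw (k := 2) hd =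
      thetaElt hd hm hw ^ 2 + A * thetaElt hd hm hw + A' := by
  set a := f.coeff f.natDegree with ha
  set b := (translate f l).coeff (f.natDegree - 1) with hb
  refine ⟨b - 2 * a * l, a * (translate f l).coeff (f.natDegree - 2) - a * l * b + a ^ 2 * l ^ 2,
    Subtype.ext ?_⟩
  simp only [MulMemClass.coe_mul, AddMemClass.coe_add, SubmonoidClass.coe_pow,
    SubringClass.coe_intCast, coe_thetaElt, hornerElt]
  rw [horner_succ, horner_succ, horner_zero, natDegree_translate, coeff_translate_natDegree, ← ha,
    zero_add, one_add_one_eq_two, ← hb]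
  push_cast
  ring

/-- The leading coefficient is the content of `(a_0 θ)²` modulo `ℤ⟨B_0, B_1⟩`. -/
lemma lead_dvd_of_ringEquiv (hg : WellShaped g m B σ)
    (φ : weakRing f m l hdf hm hwf ≃+* weakRing g m l' hdg hm hwg) {c k : ℤ}
    (h1 : φ (thetaElt hdf hm hwf) = c + k * thetaElt hdg hm hwg) (hk : k ^ 2 = 1) :
    f.coeff f.natDegree ∣ g.coeff g.natDegree := by
  have hn := natDegree_translate g l'
  have h4 := hg.four_le
  obtain ⟨A, A', hA⟩ := exists_mul_hornerElt_two hdf hm hwf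
  obtain ⟨D, D', hD⟩ := exists_mul_hornerElt_two hdg hm hwg
  have hA' := congrArg φ hA
  rw [map_mul, map_add, map_add, map_pow, map_mul, map_intCast, map_intCast, map_intCast, h1] at hA'
  have hk' : (k : weakRing g m l' hdg hm hwg) ^ 2 = 1 := by exact_mod_cast congrArg _ hk
  set a := f.coeff f.natDegree
  set a' := g.coeff g.natDegree
  set e : ℤ := (translate g l').coeff (g.natDegree - 1) - a' * l' with he
  have hH := coe_hornerElt_one hdg hm hwg
  rw [← he] at hH
  set P : ℤ := 2 * c * k + A * k - D with hP
  have hP' : (P : weakRing g m l' hdg hm hwg) = 2 * c * k + A * k - D := by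
    rw [hP]
    push_cast
    rfl
  -- Because `k ^ 2 = 1`, the square of `a_0' θ'` appears with coefficient exactly one and can be
  -- replaced by `a_0' B_2'` plus terms in `B_0'` and `B_1'`.
  have h5 : (a : weakRing g m l' hdg hm hwg) * φ (hornerElt hdf hm hwf (k := 2) hdf) =
      a' * hornerElt hdg hm hwg (k := 2) hdg + P * hornerElt hdg hm hwg (k := 1) (by omega) +
        ((c ^ 2 + A * c + A' - D' - P * e : ℤ) : weakRing g m l' hdg hm hwg) := by
    rw [hA', hD, hH]
    push_cast
    linear_combination (thetaElt hdg hm hwg) ^ 2 * hk' - thetaElt hdg hm hwg * hP'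
  set Q := c ^ 2 + A * c + A' - D' - P * e
  set i0 : Fin (translate g l').natDegree := ⟨0, by omega⟩ with hi0
  set i1 : Fin (translate g l').natDegree := ⟨1, by omega⟩ with hi1
  set i2 : Fin (translate g l').natDegree := ⟨2, by omega⟩ with hi2
  have e0 : weakBasis (translate g l') m i0 = 1 := weakBasis_zero (by omega) m
  have e1 : weakBasis (translate g l') m i1 = horner (translate g l') 1 :=
    weakBasis_of_lt m one_ne_zero (by change 1 + 1 < _; omega)
  -- Here `n ≥ 4` matters: `B_2` is not the vector that is divided by `m`.
  have e2 : weakBasis (translate g l') m i2 = horner (translate g l') 2 :=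
    weakBasis_of_lt m two_ne_zero (by change 2 + 1 < _; omega)
  obtain ⟨y, hy⟩ := mem_weakLattice_iff.1 (φ (hornerElt hdf hm hwf (k := 2) hdf)).2
  have h6 := congrArg Subtype.val h5
  simp only [MulMemClass.coe_mul, AddMemClass.coe_add, SubringClass.coe_intCast] at h6
  rw [← hy] at h6
  simp only [hornerElt] at h6
  have h7 : ∑ i, (a * y i - (Pi.single i2 a' + Pi.single i1 P + Pi.single i0 Q :
      Fin (translate g l').natDegree → ℤ) i) • weakBasis (translate g l') m i = 0 := by
    simp only [sub_smul, add_smul, Pi.add_apply, Finset.sum_sub_distrib, Finset.sum_add_distrib,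
      mul_smul, ← Finset.smul_sum, Pi.single_apply, ite_smul, zero_smul, Finset.sum_ite_eq',
      Finset.mem_univ, if_true]
    rw [e0, e1, e2]
    simp only [zsmul_eq_mul] at h6 ⊢
    rw [h6]
    ring
  -- Comparing coordinates at `B_2'` gives `a * y i2 = a'`.
  have h8 := Fintype.linearIndependent_iff.1 (hg.linearIndependent l') _ h7 i2
  rw [Pi.add_apply, Pi.add_apply, Pi.single_eq_same, Pi.single_eq_of_ne (by simp [hi1, hi2]),
    Pi.single_eq_of_ne (by simp [hi0, hi2])] at h8
  exact ⟨y i2, by linarith⟩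

/-- If an isomorphism maps `a_0 θ` to `c + k a_0 θ'` then `k θ' + c / a_0` is a root of `f`. -/
lemma aeval_eq_zero_of_ringEquiv (hf : WellShaped f m B σ) (hg : WellShaped g m B σ)
    (φ : weakRing f m l hdf hm hwf ≃+* weakRing g m l' hdg hm hwg) {c k : ℤ}
    (h1 : φ (thetaElt hdf hm hwf) = c + k * thetaElt hdg hm hwg)
    (hlead : f.coeff f.natDegree = g.coeff g.natDegree) {z : ℂ} (hz : aeval z g = 0) :
    aeval (k * z + (c / f.coeff f.natDegree : ℂ)) f = 0 := by
  have hz' : aeval (z - l') (translate g l') = 0 := by rwa [aeval_translate, sub_add_cancel]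
  have hg0 := translate_ne_zero hg.ne_zero l'
  obtain ⟨w, hw, hτ, -⟩ := exists_root_of_hom hdf hm hwf hf.lead_pos.ne'
    (((evalRoot (translate g l') (toRoot hg0 hz')).comp
      (weakRing g m l' hdg hm hwg).subtype).comp φ.toRingHom)
  have hτ' : evalRoot (translate g l') (toRoot hg0 hz') (φ (thetaElt hdf hm hwf)).1 =
      f.coeff f.natDegree * (w + l) := hτ
  rw [h1] at hτ'
  simp only [MulMemClass.coe_mul, AddMemClass.coe_add, SubringClass.coe_intCast,
    evalRoot_thetaElt, map_add, map_mul, map_intCast] at hτ'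
  have e : ((toRoot hg0 hz' : Roots _) : ℂ) = z - l' := rfl
  rw [e, sub_add_cancel, ← hlead] at hτ'
  have ha : (f.coeff f.natDegree : ℂ) ≠ 0 := by exact_mod_cast hf.lead_pos.ne'
  rw [aeval_translate] at hw
  have e2 : k * z + (c / f.coeff f.natDegree : ℂ) = w + l := by
    field_simp
    linear_combination hτ'
  rwa [e2]

end iso

/-! ### Non-isomorphic rings -/

/-- If `f(k z + u)` vanishes at all roots `z` of `g`, where `k = ± 1`, then
`f(k x + u) = k ^ n g(x)`. -/
lemma coeff_taylor_eq_of_roots {f g : ℤ[X]} {m : ℕ} {B σ : ℝ} (hg : WellShaped g m B σ)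
    (hdeg : f.natDegree = g.natDegree) (hlead : f.coeff f.natDegree = g.coeff g.natDegree)
    {k : ℤ} {u : ℂ} (H : ∀ z, aeval z g = 0 → aeval (k * z + u) f = 0) (i : ℕ) :
    (taylor u (f.map (algebraMap ℤ ℂ))).coeff i * (k : ℂ) ^ i =
      (k : ℂ) ^ g.natDegree * g.coeff i := by
  set F := f.map (algebraMap ℤ ℂ) with hF
  have hFn : F.natDegree = f.natDegree := natDegree_map_eq_of_injective Int.cast_injective f
  set P := (taylor u F).comp (C (k : ℂ) * X) with hP
  set Q := C ((k : ℂ) ^ g.natDegree) * g.map (algebraMap ℤ ℂ) with hQ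
  have hPc : ∀ i, P.coeff i = (taylor u F).coeff i * (k : ℂ) ^ i := fun i => by
    rw [hP, comp_C_mul_X_coeff]
  have hQc : ∀ i, Q.coeff i = (k : ℂ) ^ g.natDegree * g.coeff i := fun i => by
    rw [hQ, coeff_C_mul, coeff_map]
    rfl
  -- Both sides have the same coefficient of `X ^ n`, so their difference has degree below `n` and
  -- vanishes at the `n` distinct roots of `g`.
  have hPQ : P = Q := by
    refine hg.separated.eq_of_eval_eq hg.ne_zero ?_ fun z hz => ?_
    · have h4 := hg.four_le
      refine Nat.lt_of_le_pred (by omega) (natDegree_le_iff_coeff_eq_zero.2 fun i hi => ?_)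
      rw [coeff_sub, hPc, hQc]
      rcases (Nat.le_of_pred_lt hi).eq_or_lt with rfl | hlt
      · rw [coeff_taylor_top (by rw [hFn, hdeg]), hF, coeff_map, ← hlead, hdeg, mul_comm]
        exact sub_self _
      · rw [coeff_eq_zero_of_natDegree_lt (by rw [natDegree_taylor, hFn, hdeg]; exact hlt),
          coeff_eq_zero_of_natDegree_lt (p := g) hlt]
        simp
    · have h1 : P.eval z = 0 := by
        rw [hP, eval_comp, taylor_eval, hF, eval_map_algebraMap]
        simpa using H z hz
      have h2 : Q.eval z = 0 := by
        rw [hQ, eval_mul, eval_map_algebraMap, hz, mul_zero]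
      rw [h1, h2]
  rw [← hPc, ← hQc, hPQ]

section iso

variable {f g : ℤ[X]} {m : ℕ} {B σ : ℝ} {l l' : ℤ} {hdf : 2 ≤ f.natDegree}
  {hdg : 2 ≤ g.natDegree} {hm : 0 < m} {hwf : WeaklyDivisibleAt f m l}
  {hwg : WeaklyDivisibleAt g m l'}

/-- The polynomial `f` is determined by the isomorphism class of `R'_(f_l,m)`. -/
lemma eq_of_ringEquiv_theta (hf : WellShaped f m B σ) (hg : WellShaped g m B σ)
    (hdeg : f.natDegree = g.natDegree)
    (hcop : IsCoprime (f.coeff f.natDegree) (f.coeff (f.natDegree - 1)))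
    (hf0 : 0 < f.coeff (f.natDegree - 1)) (hf1 : f.coeff (f.natDegree - 1) ≤ f.coeff f.natDegree)
    (hg0 : 0 < g.coeff (g.natDegree - 1)) (hg1 : g.coeff (g.natDegree - 1) ≤ g.coeff g.natDegree)
    (φ : weakRing f m l hdf hm hwf ≃+* weakRing g m l' hdg hm hwg) {c k : ℤ}
    (h1 : φ (thetaElt hdf hm hwf) = c + k * thetaElt hdg hm hwg)
    (hlead : f.coeff f.natDegree = g.coeff g.natDegree) (hk : k ^ 2 = 1) :
    f = g ∧ k = 1 ∧ c = 0 := by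
  set n := f.natDegree with hn
  have h4 := hf.four_le
  have hap := hf.lead_pos
  rw [← hn] at h4 hap
  rw [← hdeg] at hg0 hg1 hlead
  set a := f.coeff n with ha
  have haq : (a : ℚ) ≠ 0 := by exact_mod_cast hap.ne'
  have hac : (a : ℂ) ≠ 0 := by exact_mod_cast hap.ne'
  set u : ℚ := c / a with hu
  have huc : ((u : ℚ) : ℂ) = c / a := by rw [hu]; push_cast; rfl
  have key := coeff_taylor_eq_of_roots (f := f) hg hdeg (by rw [← hdeg]; exact hlead)
    (k := k) (u := (u : ℂ)) fun z hz => by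
      rw [huc]
      exact aeval_eq_zero_of_ringEquiv hf hg φ h1 (by rw [← hdeg]; exact hlead) hz
  rw [← hdeg] at key
  have hkc : (k : ℂ) ^ 2 = 1 := by exact_mod_cast hk
  -- The coefficients of `1` and `x` in `f(k x + u) = k^n g(x)` show that `f(u)` and `f'(u)` are
  -- integers, as needed to make `u` an integer.
  have e0 : aeval u f = ((k ^ n * g.coeff 0 : ℤ) : ℚ) := by
    have h := key 0
    rw [taylor_coeff_zero, eval_map_algebraMap, pow_zero, mul_one] at h
    have h' : aeval (algebraMap ℚ ℂ u) f = ((k ^ n * g.coeff 0 : ℤ) : ℂ) := by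
      push_cast
      exact h
    rw [aeval_algebraMap_apply] at h'
    have h'' : ((aeval u f : ℚ) : ℂ) = (((k ^ n * g.coeff 0 : ℤ) : ℚ) : ℂ) := by
      rw [Rat.cast_intCast]
      exact h'
    exact_mod_cast h''
  have e1 : aeval u (derivative f) = ((k ^ n * k * g.coeff 1 : ℤ) : ℚ) := by
    have h := key 1
    rw [taylor_coeff_one, derivative_map, eval_map_algebraMap, pow_one] at h
    have h' : aeval (algebraMap ℚ ℂ u) (derivative f) = ((k ^ n * k * g.coeff 1 : ℤ) : ℂ) := by
      push_cast
      change aeval (u : ℂ) (derivative f) = _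
      linear_combination (k : ℂ) * h - aeval (u : ℂ) (derivative f) * hkc
    rw [aeval_algebraMap_apply] at h'
    have h'' : ((aeval u (derivative f) : ℚ) : ℂ) = (((k ^ n * k * g.coeff 1 : ℤ) : ℚ) : ℂ) := by
      rw [Rat.cast_intCast]
      exact h'
    exact_mod_cast h''
  have hden := den_eq_one_of_eval_int (f := f) (u := u) (c := c) (by omega) hcop
    (by rw [← hn, ← ha, hu]; field_simp) e0 e1
  obtain ⟨v, hv⟩ : ∃ v : ℤ, u = v := ⟨u.num, ((Rat.den_eq_one_iff u).1 hden).symm⟩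
  have hcv : c = a * v := by
    have : (c : ℚ) = a * v := by rw [← hv, hu]; field_simp
    exact_mod_cast this
  obtain ⟨N, hN⟩ : ∃ N, n = N + 1 := ⟨n - 1, by omega⟩
  -- The coefficient of `x^(n-1)`, after cancelling `k^(n-1)`.
  have e2 : f.coeff (n - 1) + n * v * a = k * g.coeff (n - 1) := by
    have h := key N
    have hFn : (f.map (algebraMap ℤ ℂ)).natDegree ≤ N + 1 := natDegree_map_le.trans (by omega)
    rw [coeff_taylor_of_natDegree_le hFn, coeff_map, coeff_map, hN] at h
    have hkN : (k : ℂ) ^ N ≠ 0 := by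
      refine pow_ne_zero _ fun H => ?_
      rw [H] at hkc
      simp at hkc
    rw [hv, Rat.cast_intCast, eq_intCast, eq_intCast] at h
    have h'' : ((f.coeff N + (N + 1) * v * f.coeff (N + 1) : ℤ) : ℂ) = ((k * g.coeff N : ℤ) : ℂ) := by
      refine mul_right_cancel₀ hkN ?_
      push_cast
      linear_combination h
    have h3 : f.coeff N + (N + 1) * v * f.coeff (N + 1) = k * g.coeff N := by exact_mod_cast h''
    rw [ha, hN, Nat.add_sub_cancel]
    push_cast
    exact h3
  have hn4 : (4 : ℤ) ≤ n := by exact_mod_cast h4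
  rw [← hlead] at hg1
  have hk' : k = 1 ∨ k = -1 := by
    have : (k - 1) * (k + 1) = 0 := by linear_combination hk
    rcases mul_eq_zero.1 this with h | h
    · left; linarith
    · right; linarith
  -- Both subleading coefficients lie in `(0, a]`, so `|n v a| ≤ 2 a`, while `v ≠ 0` would give `|n
  -- v a| ≥ 4 a`.
  have hv0 : v = 0 := by
    by_contra hne
    rcases hk' with rfl | rfl <;> rcases lt_or_gt_of_ne hne with hlt | hgt
    · have : 4 * a ≤ n * (-v) * a := by gcongr; nlinarith
      linarith
    · have : 4 * a ≤ n * v * a := by gcongr; nlinarith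
      linarith
    · have : 4 * a ≤ n * (-v) * a := by gcongr; nlinarith
      linarith
    · have : 4 * a ≤ n * v * a := by gcongr; nlinarith
      linarith
  -- With `v = 0`, the value `k = -1` would make the two positive subleading coefficients opposite.
  have hk1 : k = 1 := by
    rcases hk' with rfl | rfl
    · rfl
    · rw [hv0] at e2
      linarith
  refine ⟨?_, hk1, by rw [hcv, hv0, mul_zero]⟩
  ext i
  have h := key i
  rw [hv, hv0, hk1] at h
  simp only [Int.cast_zero, Rat.cast_zero, taylor_zero, coeff_map, Int.cast_one, one_pow, mul_one,
    one_mul] at h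
  exact Int.cast_injective h

/-- The residue class of `l` is determined by the isomorphism class of `R'_(f_l,m)`. -/
lemma shift_eq_of_ringEquiv_theta {hwf' : WeaklyDivisibleAt f m l'} (hf : WellShaped f m B σ)
    (φ : weakRing f m l hdf hm hwf ≃+* weakRing f m l' hdf hm hwf')
    (h1 : φ (thetaElt hdf hm hwf) = thetaElt hdf hm hwf') : (m : ℤ) ∣ l - l' := by
  have hf0 := translate_ne_zero hf.ne_zero l'
  have h4 := hf.four_le
  have hmc : (m : ℂ) ≠ 0 := by exact_mod_cast hm.ne'
  obtain ⟨N, hN⟩ : ∃ N, f.natDegree = N + 2 := ⟨f.natDegree - 2, by omega⟩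
  set h := translate f l with hh
  set h' := translate f l' with hh'
  have hn : h.natDegree = N + 2 := (natDegree_translate f l).trans hN
  have hn' : h'.natDegree = N + 2 := (natDegree_translate f l').trans hN
  set a := f.coeff f.natDegree with ha
  have hac : (a : ℂ) ≠ 0 := by exact_mod_cast hf.lead_pos.ne'
  let b : weakRing f m l hdf hm hwf := ⟨(m : ℚ)⁻¹ • horner h (h.natDegree - 1),
    last_mem (by rw [hn]; omega)⟩
  have hb : (m : weakRing f m l hdf hm hwf) * b =
      hornerElt hdf hm hwf (k := N + 1) (by omega) := by
    apply Subtype.ext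
    simp only [MulMemClass.coe_mul, hornerElt, b]
    have := cast_mul_smul hm (horner h (h.natDegree - 1))
    rw [show N + 1 = h.natDegree - 1 by omega]
    refine Eq.trans ?_ this
    congr 1
  obtain ⟨y, hy⟩ := mem_weakLattice_iff.1 (φ b).2
  -- `P` is `B_(n-1)` of `f_l` rewritten in the variable of `f_l'`, and `Q` is `m` times the
  -- expansion of the image of `B_(n-1) / m`. They agree at all roots and have degree below `n`, so
  -- they are equal.
  set P := taylor ((l' - l : ℤ) : ℂ) (hornerPoly h (N + 1)) with hP
  set Q := ∑ i, C ((m * y i : ℤ) : ℂ) * weakPoly h' m i with hQ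
  have hhd : (hornerPoly h (N + 1)).natDegree ≤ N + 1 := natDegree_hornerPoly_le h (by omega)
  have hQd : Q.natDegree ≤ N + 1 := by
    refine natDegree_sum_le_of_forall_le _ _ fun i _ => (natDegree_C_mul_le _ _).trans
      ((natDegree_weakPoly_le h' m i.2).trans ?_)
    have : (i : ℕ) < h'.natDegree := i.2
    omega
  have hPQ : P = Q := by
    refine (hf.separated_translate l').eq_of_eval_eq hf0 ?_ fun z hz => ?_
    · rw [← hh', hn']
      refine (natDegree_sub_le _ _).trans_lt ?_
      rw [hP, natDegree_taylor]
      exact (max_le hhd hQd).trans_lt (Nat.lt_succ_self _)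
    obtain ⟨w, -, hτ, hH⟩ := exists_root_of_hom hdf hm hwf hf.lead_pos.ne'
      (((evalRoot h' (toRoot hf0 hz)).comp (weakRing f m l' hdf hm hwf').subtype).comp φ.toRingHom)
    have hτ' : evalRoot h' (toRoot hf0 hz) (φ (thetaElt hdf hm hwf)).1 = a * (w + l) := hτ
    have hz' : ((toRoot hf0 hz : Roots _) : ℂ) = z := rfl
    rw [h1, evalRoot_thetaElt, hz', ← ha] at hτ'
    have hwz : w = z + (l' - l : ℤ) := by
      have := mul_left_cancel₀ hac hτ'
      push_cast
      linear_combination -this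
    have h2 := hH (N + 1) (by omega)
    rw [← hb, map_mul, map_natCast] at h2
    have h3 : (m : ℂ) * evalRoot h' (toRoot hf0 hz) (φ b).1 = (hornerPoly h (N + 1)).eval w := h2
    rw [← hy, evalRoot_sum, hz', hwz] at h3
    rw [hP, taylor_eval, add_comm, add_comm _ z, ← h3, hQ, eval_finsetSum, eval_finsetSum,
      Finset.mul_sum]
    refine Finset.sum_congr rfl fun i _ => ?_
    rw [eval_mul, eval_mul, eval_C, eval_C]
    push_cast
    ring
  set i0 : Fin h'.natDegree := ⟨N, by omega⟩
  set i1 : Fin h'.natDegree := ⟨N + 1, by omega⟩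
  have hcoef : ∀ (f : ℤ[X]) (l : ℤ), f.natDegree = N + 2 →
      (translate f l).coeff (N + 2) = f.coeff (N + 2) ∧
      (translate f l).coeff (N + 1) = f.coeff (N + 1) + (N + 2) * l * f.coeff (N + 2) := by
    intro f l hf
    refine ⟨coeff_taylor_top hf.le l, ?_⟩
    rw [translate_eq_taylor, coeff_taylor_of_natDegree_le hf.le]
    push_cast
    ring
  obtain ⟨t0, t1⟩ := hcoef f l hN
  obtain ⟨t0', t1'⟩ := hcoef f l' hN
  rw [← hN, ← ha, ← hh] at t0
  rw [← hN, ← ha, ← hh'] at t0'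
  rw [← hN, ← ha, ← hh] at t1
  rw [← hN, ← ha, ← hh'] at t1'
  have hw1 : weakPoly h' m i1 = C ((m : ℂ)⁻¹) * hornerPoly h' (N + 1) := by
    rw [weakPoly, if_pos (by change N + 1 + 1 = _; omega), if_neg (by change N + 1 ≠ 0; omega)]
  have hw0 : weakPoly h' m i0 = hornerPoly h' N := by
    rw [weakPoly, if_neg (by change N + 1 ≠ _; omega), if_neg (by change N ≠ 0; omega)]
  have c1 : P.coeff (N + 1) = a := by
    rw [hP, coeff_taylor_top hhd, coeff_hornerPoly h (by omega), ← t0, hN]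
    congr 2
    omega
  have c0 : P.coeff N = h.coeff (N + 1) + (N + 1) * (l' - l) * a := by
    rw [hP, coeff_taylor_of_natDegree_le hhd, coeff_hornerPoly h (by omega),
      coeff_hornerPoly h (by omega), ← t0, hN, hn, show N + 2 - (N + 1) + N = N + 1 by omega,
      show N + 2 - (N + 1) + (N + 1) = N + 2 by omega]
    push_cast
    ring
  have d1 : Q.coeff (N + 1) = y i1 * a := by
    rw [hQ, finsetSum_coeff, Fintype.sum_eq_single i1, hw1, coeff_C_mul, coeff_C_mul,
      coeff_hornerPoly h' (by omega), hn', show N + 2 - (N + 1) + (N + 1) = N + 2 by omega, ← hN,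
      t0']
    · push_cast
      field_simp
    · intro i hi
      rw [coeff_C_mul, coeff_eq_zero_of_natDegree_lt, mul_zero]
      refine (natDegree_weakPoly_le h' m i.2).trans_lt ?_
      have h5 : (i : ℕ) < h'.natDegree := i.2
      have h6 : (i : ℕ) ≠ N + 1 := fun H => hi (Fin.ext H)
      omega
  have d0 : Q.coeff N = y i1 * h'.coeff (N + 1) + m * y i0 * a := by
    rw [hQ, finsetSum_coeff, Fintype.sum_eq_add i1 i0 (by simp [i0, i1]), hw1, hw0, coeff_C_mul,
      coeff_C_mul, coeff_C_mul, coeff_hornerPoly h' (by omega), coeff_hornerPoly h' (by omega), hn',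
      show N + 2 - (N + 1) + N = N + 1 by omega, show N + 2 - N + N = N + 2 by omega, ← hN, t0']
    · push_cast
      field_simp
    · intro i hi
      rw [coeff_C_mul, coeff_eq_zero_of_natDegree_lt, mul_zero]
      refine (natDegree_weakPoly_le h' m i.2).trans_lt ?_
      have h5 : (i : ℕ) < h'.natDegree := i.2
      have h6 : (i : ℕ) ≠ N + 1 := fun H => hi.1 (Fin.ext H)
      have h7 : (i : ℕ) ≠ N := fun H => hi.2 (Fin.ext H)
      omega
  -- The coefficients of `X^(n-1)` agree.
  have y1 : (y i1 : ℂ) = 1 := by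
    refine mul_right_cancel₀ hac ?_
    rw [← d1, ← hPQ, c1, one_mul]
  have e0 := c0
  rw [hPQ, d0, y1, t1, t1'] at e0
  push_cast at e0
  -- In the coefficients of `X^(n-2)`, translating `f` contributes `n a (l - l')` and translating
  -- `B_(n-1)` contributes `-(n - 1) a (l - l')`; exactly one copy of `a (l - l')` survives.
  have e2 : (a : ℂ) * (l - l' : ℤ) = a * (m * y i0 : ℤ) := by
    push_cast
    linear_combination -e0
  exact ⟨y i0, by exact_mod_cast mul_left_cancel₀ hac e2⟩

/-- Well-shaped polynomials with coprime and small leading coefficients have pairwise non-isomorphic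
weakly divisible rings. -/
theorem eq_of_ringEquiv (hf : WellShaped f m B σ) (hg : WellShaped g m B σ)
    (hdeg : f.natDegree = g.natDegree)
    (hfg : f.coeff f.natDegree ≤ 2 * g.coeff g.natDegree)
    (hgf : g.coeff g.natDegree ≤ 2 * f.coeff f.natDegree)
    (hcop : IsCoprime (f.coeff f.natDegree) (f.coeff (f.natDegree - 1)))
    (hf0 : 0 < f.coeff (f.natDegree - 1)) (hf1 : f.coeff (f.natDegree - 1) ≤ f.coeff f.natDegree)
    (hg0 : 0 < g.coeff (g.natDegree - 1)) (hg1 : g.coeff (g.natDegree - 1) ≤ g.coeff g.natDegree)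
    (hl : 0 ≤ l) (hlm : l < m) (hl' : 0 ≤ l') (hlm' : l' < m)
    (φ : weakRing f m l hdf hm hwf ≃+* weakRing g m l' hdg hm hwg) : f = g ∧ l = l' := by
  obtain ⟨c, k, h1⟩ := exists_int_of_ringEquiv hf hg hfg φ
  obtain ⟨c', k', h2⟩ := exists_int_of_ringEquiv hg hf hgf φ.symm
  have hk := sq_eq_one_of_ringEquiv hf φ h1 h2
  have hk' := sq_eq_one_of_ringEquiv hg φ.symm h2 (by rw [RingEquiv.symm_symm]; exact h1)
  have hlead : f.coeff f.natDegree = g.coeff g.natDegree :=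
    Int.dvd_antisymm hf.lead_pos.le hg.lead_pos.le (lead_dvd_of_ringEquiv hg φ h1 hk)
      (lead_dvd_of_ringEquiv hf φ.symm h2 hk')
  obtain ⟨rfl, rfl, rfl⟩ :=
    eq_of_ringEquiv_theta hf hg hdeg hcop hf0 hf1 hg0 hg1 φ h1 hlead hk
  refine ⟨rfl, ?_⟩
  have h3 := shift_eq_of_ringEquiv_theta hf φ (by rw [h1]; simp)
  have h4 := Int.eq_zero_of_abs_lt_dvd h3 (by rw [abs_lt]; constructor <;> linarith)
  linarith

end iso

section

variable {f : ℤ[X]} {m : ℕ} {B σ : ℝ}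

/-! ### Well-shaped polynomials are reduced -/

lemma WellShaped.card_roots (hf : WellShaped f m B σ) (l : ℤ) :
    Fintype.card (Roots (translate f l)) = (translate f l).natDegree := by
  rw [← (hf.separated_translate l).card_eq]
  refine Fintype.card_of_subtype _ fun z => ?_
  rw [mem_toFinset_aroots (translate_ne_zero hf.ne_zero l),
    mem_roots_iff (translate_ne_zero hf.ne_zero l)]

/-- The Gram–Schmidt correction to the `k`-th vector is a value vector of a polynomial of degree
below `k`, so it does not disturb the coefficient of `X ^ k`. -/
lemma exists_polynomial_of_mem_span {h : ℤ[X]} {m k : ℕ} (hk : k ≤ h.natDegree)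
    {x : EuclideanSpace ℂ (Roots h)}
    (hx : x ∈ Submodule.span ℝ
      ((fun k => canonicalEmbedding h (weakBasis h m k)) '' Set.Iio k)) :
    ∃ p : ℂ[X], p.degree < k ∧ ∀ z : Roots h, x z = p.eval (z : ℂ) := by
  refine Submodule.span_induction (p := fun x _ => ∃ p : ℂ[X], p.degree < k ∧
    ∀ z : Roots h, x z = p.eval (z : ℂ)) ?_ ?_ ?_ ?_ hx
  · rintro _ ⟨i, hi, rfl⟩
    refine ⟨weakPoly h m i, ?_, fun z => ?_⟩
    · exact (degree_le_of_natDegree_le (natDegree_weakPoly_le h m (lt_of_lt_of_le hi hk))).trans_lt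
        (by exact_mod_cast hi)
    · rw [← evalRoot_weakBasis]
      rfl
  · exact ⟨0, by rw [degree_zero]; exact WithBot.bot_lt_coe k, fun z => by simp⟩
  · rintro x y _ _ ⟨p, hp, hp'⟩ ⟨q, hq, hq'⟩
    refine ⟨p + q, (degree_add_le p q).trans_lt (max_lt hp hq), fun z => ?_⟩
    rw [PiLp.add_apply, hp', hq', eval_add]
  · rintro c x _ ⟨p, hp, hp'⟩
    refine ⟨C (c : ℂ) * p, ?_, fun z => ?_⟩
    · rw [← smul_eq_C_mul]
      exact (degree_smul_le _ _).trans_lt hp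
    · rw [PiLp.smul_apply, hp', eval_mul, eval_C]
      rfl

lemma gramSchmidt_sub_mem {E : Type*} [NormedAddCommGroup E] [InnerProductSpace ℝ E] (v : ℕ → E)
    (k : ℕ) : InnerProductSpace.gramSchmidt ℝ v k - v k ∈ Submodule.span ℝ (v '' Set.Iio k) := by
  rw [← InnerProductSpace.span_gramSchmidt_Iio ℝ v k]
  have h := InnerProductSpace.gramSchmidt_def'' ℝ v k
  rw [← neg_mem_iff, neg_sub, sub_eq_of_eq_add' h]
  exact Submodule.sum_mem _ fun i hi => Submodule.smul_mem _ _
    (Submodule.subset_span (Set.mem_image_of_mem _ (Finset.mem_Iio.1 hi)))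

/-- The orthogonalized vector is the shortest element of `v 1 + ℝ v 0`. This permits replacing `B_1`
by `a_0 θ`, whose size does not depend on `l`. -/
lemma norm_gramSchmidt_one_le {E : Type*} [NormedAddCommGroup E] [InnerProductSpace ℝ E]
    (v : ℕ → E) (c : ℝ) : ‖InnerProductSpace.gramSchmidt ℝ v 1‖ ≤ ‖v 1 - c • v 0‖ := by
  set g := InnerProductSpace.gramSchmidt ℝ v 1 with hg
  have h0 : InnerProductSpace.gramSchmidt ℝ v 0 = v 0 := InnerProductSpace.gramSchmidt_bot ℝ v
  have horth : inner ℝ g (v 0) = 0 := by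
    rw [← h0]
    exact InnerProductSpace.gramSchmidt_orthogonal ℝ v one_ne_zero
  have h1 := gramSchmidt_sub_mem v 1
  have e : v '' Set.Iio 1 = {v 0} := by
    have : Set.Iio (1 : ℕ) = {0} := by ext; simp
    rw [this, Set.image_singleton]
  rw [e, Submodule.mem_span_singleton] at h1
  obtain ⟨r, hr⟩ := h1
  have h2 : v 1 - c • v 0 = g - (r + c) • v 0 := by
    rw [add_smul, hr]
    abel
  have h3 : inner ℝ g (v 1 - c • v 0) = ‖g‖ ^ 2 := by
    rw [h2, inner_sub_right, inner_smul_right, horth, mul_zero, sub_zero, real_inner_self_eq_norm_sq]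
  have h4 := real_inner_le_norm g (v 1 - c • v 0)
  rw [h3, sq] at h4
  rcases (norm_nonneg g).eq_or_lt with h5 | h5
  · rw [← h5]
    exact norm_nonneg _
  · exact le_of_mul_le_mul_left h4 h5

lemma euclidean_norm_le {ι : Type*} [Fintype ι] {x : EuclideanSpace ℂ ι} {M : ℝ} (hM : 0 ≤ M)
    (hx : ∀ i, ‖x i‖ ≤ M) : ‖x‖ ≤ √(Fintype.card ι) * M := by
  rw [EuclideanSpace.norm_eq, ← Real.sqrt_sq hM, ← Real.sqrt_mul (by positivity)]
  refine Real.sqrt_le_sqrt ?_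
  calc ∑ i, ‖x i‖ ^ 2 ≤ ∑ _i : ι, M ^ 2 :=
        Finset.sum_le_sum fun i _ => pow_le_pow_left₀ (norm_nonneg _) (hx i) 2
    _ = _ := by rw [Finset.sum_const, Finset.card_univ, nsmul_eq_mul]

/-- The orthogonalized vector is the value vector of a polynomial of degree at most `k` whose
coefficient of `X ^ k` is still `weakLead`; each value is at most the norm, and interpolation
applies. -/
lemma WellShaped.weakLead_mul_pow_le_gramSchmidt (hf : WellShaped f m B σ) (l : ℤ) {k : ℕ}
    (hk : k < f.natDegree) :
    weakLead (translate f l) m k * σ ^ k ≤ (k + 1) * ‖InnerProductSpace.gramSchmidt ℝ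
      (fun k => canonicalEmbedding (translate f l) (weakBasis (translate f l) m k)) k‖ := by
  set h := translate f l with hh
  set v := fun k => canonicalEmbedding h (weakBasis h m k) with hv
  have hn : h.natDegree = f.natDegree := natDegree_translate f l
  have h4 := hf.four_le
  have h0 : h ≠ 0 := translate_ne_zero hf.ne_zero l
  obtain ⟨p, hp, hpe⟩ := exists_polynomial_of_mem_span (h := h) (m := m) (by omega)
    (gramSchmidt_sub_mem v k)
  have hd : (weakPoly h m k + p).natDegree ≤ k := by
    refine natDegree_add_le_of_degree_le (natDegree_weakPoly_le h m (by omega)) ?_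
    exact natDegree_le_of_degree_le hp.le
  have h1 := (hf.separated_translate l).norm_coeff_mul_pow_le h0 hf.σ_pos hd (hk.trans_eq hn.symm)
    (M := ‖InnerProductSpace.gramSchmidt ℝ v k‖) fun z hz => by
      have h2 := hpe (toRoot h0 hz)
      rw [PiLp.sub_apply] at h2
      have h3 : v k (toRoot h0 hz) = (weakPoly h m k).eval z :=
        evalRoot_weakBasis h m (toRoot h0 hz) k
      rw [h3] at h2
      have e : ((toRoot h0 hz : Roots _) : ℂ) = z := rfl
      rw [e] at h2
      rw [eval_add, ← h2, add_sub_cancel]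
      exact PiLp.norm_apply_le _ _
  rw [coeff_add, coeff_weakPoly_self (by omega) m (by omega), coeff_eq_zero_of_degree_lt hp, add_zero,
    Complex.norm_real, Real.norm_of_nonneg (hf.weakLead_pos l k).le] at h1
  exact h1

/-- The first two lengths are at most `√n` and `√n a_0 B`. The interpolation bounds give at least
`a_0 σ / 2` for the second length and `2 n a_0 B` for all later ones; `gap_one` and `gap` are made
to fit these. -/
theorem WellShaped.isReducedPoly (hf : WellShaped f m B σ) (l : ℤ) : IsReducedPoly f m l := by
  have h4 := hf.four_le
  have hn : (translate f l).natDegree = f.natDegree := natDegree_translate f l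
  have h0 : translate f l ≠ 0 := translate_ne_zero hf.ne_zero l
  have hgs := fun k hk => hf.weakLead_mul_pow_le_gramSchmidt l (k := k) hk
  have hcard := hf.card_roots l
  have hlead := coeff_translate_natDegree f l
  rw [IsReducedPoly, ← hn]
  set h := translate f l with hh
  set v := fun k => canonicalEmbedding h (weakBasis h m k) with hv
  have hn4 : (4 : ℝ) ≤ f.natDegree := by exact_mod_cast h4
  have hap : (0 : ℝ) < f.coeff f.natDegree := by exact_mod_cast hf.lead_pos
  have hsq : √(f.natDegree : ℝ) ≤ f.natDegree := by
    rw [Real.sqrt_le_left (by linarith)]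
    nlinarith
  have hg0 : ‖InnerProductSpace.gramSchmidt ℝ v 0‖ ≤ √(f.natDegree : ℝ) := by
    have e : InnerProductSpace.gramSchmidt ℝ v 0 = v 0 := InnerProductSpace.gramSchmidt_bot ℝ v
    rw [e, ← hn, ← hcard, ← mul_one (√_)]
    refine euclidean_norm_le zero_le_one fun z => ?_
    have : v 0 z = evalRoot h z (weakBasis h m 0) := rfl
    rw [this, weakBasis_zero (by omega), map_one, norm_one]
  have hg1 : ‖InnerProductSpace.gramSchmidt ℝ v 1‖ ≤
      √(f.natDegree : ℝ) * (f.coeff f.natDegree * B) := by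
    -- The multiple of `B_0` is the one for which `B_1` minus it equals `a_0 (δ + l)`.
    refine (norm_gramSchmidt_one_le v
      (h.coeff (f.natDegree - 1) - f.coeff f.natDegree * l : ℤ)).trans ?_
    rw [← hn, ← hcard]
    refine euclidean_norm_le (mul_pos (by rw [hcard, hn]; exact hap) hf.B_pos).le fun z => ?_
    have hp1 : hornerPoly h 1 = X * C (h.coeff h.natDegree : ℂ) +
      C (h.coeff (h.natDegree - 1) : ℂ) := rfl
    have e1 : v 1 z = evalRoot h z (weakBasis h m 1) := rfl
    have e0 : v 0 z = evalRoot h z (weakBasis h m 0) := rfl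
    rw [PiLp.sub_apply, PiLp.smul_apply, e0, e1, weakBasis_zero (by omega), map_one,
      weakBasis_of_lt m one_ne_zero (by omega), evalRoot_horner, hp1, eval_add,
      eval_mul, eval_X, eval_C, eval_C, hcard, hn, hlead]
    have hz : aeval ((z : ℂ) + l) f = 0 :=
      (aeval_translate f l z).symm.trans (Roots.aeval_eq_zero h0 z)
    have hb := hf.bound _ hz
    have e2 : (z : ℂ) * (f.coeff f.natDegree : ℂ) + (h.coeff (f.natDegree - 1) : ℂ) -
        ((h.coeff (f.natDegree - 1) - f.coeff f.natDegree * l : ℤ) : ℝ) • (1 : ℂ) =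
        f.coeff f.natDegree * (z + l) := by
      rw [Complex.real_smul]
      push_cast
      ring
    rw [e2, norm_mul, Complex.norm_intCast, abs_of_pos hap]
    gcongr
  refine ⟨?_, ?_, ?_⟩
  · rw [Fintype.linearIndependent_iff]
    intro c hc i
    have h1 : (fun i => (c i : ℂ)) = 0 := hf.coord_eq_zero_of_eval (l := l) fun z hz => by
      have h2 := congrArg (fun x : EuclideanSpace ℂ (Roots h) => x (toRoot h0 hz)) hc
      simp only [WithLp.ofLp_sum, Finset.sum_apply, PiLp.smul_apply, PiLp.zero_apply] at h2
      rw [eval_finsetSum, ← h2]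
      refine Finset.sum_congr rfl fun j _ => ?_
      have h3 : v j (toRoot h0 hz) = (weakPoly h m j).eval z :=
        evalRoot_weakBasis h m (toRoot h0 hz) j
      rw [h3, eval_mul, eval_C]
      rfl
    simpa using congrFun h1 i
  · have h1 := hgs 1 (by omega)
    rw [weakLead, if_neg one_ne_zero, if_neg (by omega), hn, hlead] at h1
    have h2 := hf.gap_one
    push_cast at h1
    linarith
  · intro k hk hkn
    rw [hn] at hkn
    have h1 := (hf.lead_mul_le l hk hkn).trans (hgs k hkn)
    have h2 : (k + 1 : ℝ) ≤ f.natDegree := by exact_mod_cast hkn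
    have h3 : (k + 1 : ℝ) * ‖InnerProductSpace.gramSchmidt ℝ v k‖ ≤
        f.natDegree * ‖InnerProductSpace.gramSchmidt ℝ v k‖ := by gcongr
    have h5 : (f.natDegree : ℝ) * (2 * (f.natDegree * (f.coeff f.natDegree * B))) ≤
        f.natDegree * ‖InnerProductSpace.gramSchmidt ℝ v k‖ := by
      refine le_trans (le_of_eq ?_) (h1.trans h3)
      ring
    have h6 := le_of_mul_le_mul_left h5 (by linarith)
    refine le_trans ?_ h6
    refine mul_le_mul_of_nonneg_left (hg1.trans ?_) (by norm_num)
    exact mul_le_mul_of_nonneg_right hsq (mul_pos hap hf.B_pos).le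

end

/-! ### The discriminant -/

section

variable {f : ℤ[X]} {m : ℕ} {B σ : ℝ}

/-- The canonical basis as a `ℤ`-basis of `R'_(f_l,m)`. -/
noncomputable def WellShaped.basis (hf : WellShaped f m B σ) {l : ℤ} (hd : 2 ≤ f.natDegree)
    (hm : 0 < m) (hw : WeaklyDivisibleAt f m l) :
    Module.Basis (Fin (translate f l).natDegree) ℤ (weakRing f m l hd hm hw) :=
  Module.Basis.mk (v := fun i => (⟨weakBasis (translate f l) m i, weakBasis_mem i.2⟩ :
      weakRing f m l hd hm hw))
    (by
      rw [Fintype.linearIndependent_iff]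
      intro y hy
      refine Fintype.linearIndependent_iff.1 (hf.linearIndependent l) y ?_
      have h1 := congrArg (weakRing f m l hd hm hw).subtype hy
      rw [map_sum, map_zero] at h1
      rw [← h1]
      refine Finset.sum_congr rfl fun i _ => ?_
      rw [map_zsmul]
      rfl)
    (by
      rintro ⟨x, hx⟩ -
      obtain ⟨y, rfl⟩ := mem_weakLattice_iff.1 hx
      rw [Submodule.mem_span_range_iff_exists_fun]
      refine ⟨y, Subtype.ext ?_⟩
      have h1 := map_sum (weakRing f m l hd hm hw).subtype
        (fun i => y i • (⟨weakBasis (translate f l) m i, weakBasis_mem i.2⟩ :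
          weakRing f m l hd hm hw)) Finset.univ
      refine h1.trans (Finset.sum_congr rfl fun i _ => ?_)
      rw [map_zsmul]
      rfl)

lemma WellShaped.coe_basis (hf : WellShaped f m B σ) {l : ℤ} (hd : 2 ≤ f.natDegree)
    (hm : 0 < m) (hw : WeaklyDivisibleAt f m l) (i : Fin (translate f l).natDegree) :
    (hf.basis hd hm hw i : FormAlgebra (translate f l)) = weakBasis (translate f l) m i := by
  rw [WellShaped.basis, Module.Basis.mk_apply]

lemma ringDisc_eq_discr {R : Type} [CommRing R] [Module.Free ℤ R] [Module.Finite ℤ R] {ι : Type*}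
    [Fintype ι] [DecidableEq ι] (b : Module.Basis ι ℤ R) : ringDisc R = Algebra.discr ℤ b := by
  classical
  have e := (Module.Free.chooseBasis ℤ R).indexEquiv b
  rw [ringDisc, ← Algebra.discr_reindex ℤ (Module.Free.chooseBasis ℤ R) e]
  have h1 := Algebra.discr_eq_discr R ((Module.Free.chooseBasis ℤ R).reindex e) b
  rw [← h1, Module.Basis.coe_reindex]

/-- If homomorphisms `σ_i : R → ℂ` separate a `ℤ`-basis then its discriminant is the square of
`det σ_i(b_j)`. -/
lemma discr_eq_det_sq {R : Type*} [CommRing R] {ι : Type*} [Fintype ι] [DecidableEq ι]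
    (b : Module.Basis ι ℤ R) (τ : ι → R →+* ℂ)
    (hV : (Matrix.of fun i j => τ i (b j)).det ≠ 0) :
    ((Algebra.discr ℤ b : ℤ) : ℂ) = (Matrix.of fun i j => τ i (b j)).det ^ 2 := by
  set V := Matrix.of fun i j => τ i (b j) with hVdef
  have hu : IsUnit V.det := isUnit_iff_ne_zero.2 hV
  have htr : ∀ x : R, ((Algebra.trace ℤ R x : ℤ) : ℂ) = ∑ i, τ i x := by
    intro x
    set M : Matrix ι ι ℂ := (Algebra.leftMulMatrix b x).map (Int.castRingHom ℂ) with hM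
    -- The matrix `V` diagonalizes multiplication by `x`, with eigenvalues `τ i x`; hence the trace
    -- is their sum.
    have h1 : V * M = Matrix.diagonal (fun i => τ i x) * V := by
      ext i j
      rw [Matrix.mul_apply, Matrix.diagonal_mul]
      have h2 : x * b j = ∑ k, Algebra.leftMulMatrix b x k j • b k := by
        rw [← b.sum_repr (x * b j)]
        simp_rw [Algebra.leftMulMatrix_eq_repr_mul]
      simp only [hVdef, Matrix.of_apply]
      rw [← map_mul, h2, map_sum]
      refine Finset.sum_congr rfl fun k _ => ?_
      rw [zsmul_eq_mul, map_mul, map_intCast, hM, Matrix.map_apply, mul_comm]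
      rfl
    have h3 : M = V⁻¹ * (Matrix.diagonal (fun i => τ i x) * V) := by
      rw [← h1, ← mul_assoc, Matrix.nonsing_inv_mul V hu, one_mul]
    have h4 : M.trace = ∑ i, τ i x := by
      rw [h3, Matrix.trace_mul_comm, mul_assoc, Matrix.mul_nonsing_inv V hu, mul_one,
        Matrix.trace_diagonal]
    rw [← h4, Algebra.trace_eq_matrix_trace b, hM, Matrix.trace, Matrix.trace]
    simp
  have h5 : (Algebra.traceMatrix ℤ b).map (Int.castRingHom ℂ) = V.transpose * V := by
    ext i j
    rw [Matrix.map_apply, Algebra.traceMatrix_apply, Algebra.traceForm_apply, Matrix.mul_apply]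
    refine (htr _).trans (Finset.sum_congr rfl fun k _ => ?_)
    rw [map_mul]
    rfl
  have h6 : ((Algebra.discr ℤ b : ℤ) : ℂ) = (Int.castRingHom ℂ) (Algebra.traceMatrix ℤ b).det := rfl
  rw [h6, RingHom.map_det, RingHom.mapMatrix_apply, h5, Matrix.det_mul, Matrix.det_transpose, sq]

/-- This is the determinant of the triangular change of basis from `1, δ, …, δ^(n-1)`: one entry
`1`, `n - 2` entries `a_0` and one entry `a_0 / m`. -/
lemma WellShaped.prod_weakLead (hf : WellShaped f m B σ) (l : ℤ) :
    ∏ i : Fin (translate f l).natDegree, weakLead (translate f l) m i =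
      (f.coeff f.natDegree : ℝ) ^ (f.natDegree - 1) / m := by
  have h4 := hf.four_le
  have hlead := coeff_translate_natDegree f l
  obtain ⟨N, hN⟩ : ∃ N, f.natDegree = N + 2 := ⟨f.natDegree - 2, by omega⟩
  have hn : (translate f l).natDegree = N + 2 := (natDegree_translate f l).trans hN
  rw [Fin.prod_univ_eq_prod_range (fun i => weakLead (translate f l) m i), hn,
    Finset.prod_range_succ, Finset.prod_range_succ', hN, show N + 2 - 1 = N + 1 by omega]
  rw [hN] at hlead
  have e0 : weakLead (translate f l) m 0 = 1 := by rw [weakLead, if_pos rfl]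
  have e1 : weakLead (translate f l) m (N + 1) = f.coeff (N + 2) / m := by
    rw [weakLead, if_neg (by omega), if_pos hn.symm, hn, hlead]
  have e2 : ∀ i ∈ Finset.range N, weakLead (translate f l) m (i + 1) = f.coeff (N + 2) := by
    intro i hi
    have := Finset.mem_range.1 hi
    rw [weakLead, if_neg (by omega), if_neg (by omega), hn, hlead, div_one]
  rw [e0, e1, Finset.prod_congr rfl e2, Finset.prod_const, Finset.card_range]
  ring

lemma norm_det_vandermonde_le {n : ℕ} {v : Fin n → ℂ} {D : ℝ}
    (hv : ∀ i j, ‖v i - v j‖ ≤ D) :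
    ‖(Matrix.vandermonde v).det‖ ≤ D ^ (n * (n - 1) / 2) := by
  rw [Matrix.det_vandermonde, norm_prod]
  calc ∏ i, ‖∏ j ∈ Finset.Ioi i, (v j - v i)‖ ≤ ∏ i : Fin n, D ^ (n - 1 - (i : ℕ)) := by
        refine Finset.prod_le_prod (fun _ _ => norm_nonneg _) fun i _ => ?_
        rw [norm_prod]
        refine (Finset.prod_le_prod (fun _ _ => norm_nonneg _) fun j _ => hv j i).trans ?_
        rw [Finset.prod_const, Fin.card_Ioi]
    _ = D ^ (n * (n - 1) / 2) := by
        rw [Finset.prod_pow_eq_pow_sum, Fin.sum_univ_eq_sum_range (fun i => n - 1 - i),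
          Finset.sum_range_reflect (fun i => i), Finset.sum_range_id]

/-- `|disc(R'_(f_l,m))| ≤ a_0^(2n-2) (2B)^(n(n-1)) / m²`. -/
theorem WellShaped.abs_ringDisc_le (hf : WellShaped f m B σ) {l : ℤ} (hd : 2 ≤ f.natDegree)
    (hm : 0 < m) (hw : WeaklyDivisibleAt f m l) :
    |(ringDisc (weakRing f m l hd hm hw) : ℝ)| ≤
      ((f.coeff f.natDegree : ℝ) ^ (f.natDegree - 1) / m) ^ 2 *
        (2 * B) ^ (f.natDegree * (f.natDegree - 1)) := by
  have hn : (translate f l).natDegree = f.natDegree := natDegree_translate f l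
  have h0 := translate_ne_zero hf.ne_zero l
  have hprod := hf.prod_weakLead l
  have h4 := hf.four_le
  let z : Fin (translate f l).natDegree ≃ Roots (translate f l) :=
    (Fintype.equivFinOfCardEq (hf.card_roots l)).symm
  have hap : (0 : ℝ) < f.coeff f.natDegree := by exact_mod_cast hf.lead_pos
  have hmp : (0 : ℝ) < m := by exact_mod_cast hm
  set b := hf.basis hd hm hw with hb
  let τ : Fin (translate f l).natDegree → weakRing f m l hd hm hw →+* ℂ := fun i =>
    (evalRoot _ (z i)).comp (weakRing f m l hd hm hw).subtype
  have hV : (Matrix.of fun i j => τ i (b j)) =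
      Matrix.of fun i j : Fin (translate f l).natDegree =>
        (weakPoly (translate f l) m j).eval (z i : ℂ) := by
    ext i j
    have : τ i (b j) = evalRoot _ (z i) (b j : FormAlgebra (translate f l)) := rfl
    rw [Matrix.of_apply, Matrix.of_apply, this, hb, hf.coe_basis, evalRoot_weakBasis]
  -- The evaluation matrix is a Vandermonde matrix times the upper triangular matrix of coefficients
  -- of the basis polynomials.
  have hdet : (Matrix.of fun i j => τ i (b j)).det =
      (Matrix.vandermonde fun i => (z i : ℂ)).det *
        (((f.coeff f.natDegree : ℝ) ^ (f.natDegree - 1) / m : ℝ) : ℂ) := by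
    rw [hV, Matrix.eval_matrixOfPolynomials_eq_vandermonde_mul_matrixOfPolynomials
      (fun i => (z i : ℂ)) (fun j => weakPoly (translate f l) m j)
      (fun j => natDegree_weakPoly_le _ m j.2), Matrix.det_mul]
    congr 1
    rw [Matrix.det_of_isUpperTriangular]
    · rw [← hprod]
      push_cast
      refine Finset.prod_congr rfl fun i _ => ?_
      rw [Matrix.of_apply, coeff_weakPoly_self (by omega) m i.2]
    · intro i j hij
      rw [Matrix.of_apply]
      exact coeff_eq_zero_of_natDegree_lt ((natDegree_weakPoly_le _ m j.2).trans_lt hij)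
  have hvan : (Matrix.vandermonde fun i => (z i : ℂ)).det ≠ 0 :=
    Matrix.det_vandermonde_ne_zero_iff.2 (Subtype.val_injective.comp z.injective)
  have hne : (Matrix.of fun i j => τ i (b j)).det ≠ 0 := by
    rw [hdet]
    refine mul_ne_zero hvan ?_
    exact_mod_cast (by positivity : (0 : ℝ) < (f.coeff f.natDegree : ℝ) ^ (f.natDegree - 1) / m).ne'
  have h1 := discr_eq_det_sq b τ hne
  rw [← ringDisc_eq_discr b, hdet] at h1
  have h2 : |(ringDisc (weakRing f m l hd hm hw) : ℝ)| =
      ‖((ringDisc (weakRing f m l hd hm hw) : ℤ) : ℂ)‖ := (Complex.norm_intCast _).symm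
  rw [h2, h1, norm_pow, norm_mul, Complex.norm_real, Real.norm_of_nonneg (by positivity), mul_pow,
    mul_comm]
  refine mul_le_mul_of_nonneg_left ?_ (by positivity)
  -- Differences of roots are unchanged by the translation by `l`, so the bound on the roots of `f`
  -- suffices.
  have h3 := norm_det_vandermonde_le (v := fun i => (z i : ℂ)) (D := 2 * B) fun i j => by
    have hz : ∀ i, ‖(z i : ℂ) + l‖ ≤ B := fun i =>
      hf.bound _ ((aeval_translate f l _).symm.trans (Roots.aeval_eq_zero h0 (z i)))
    calc ‖(z i : ℂ) - z j‖ = ‖((z i : ℂ) + l) - (z j + l)‖ := by congr 1; ring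
      _ ≤ _ := norm_sub_le _ _
      _ ≤ 2 * B := by linarith [hz i, hz j]
  refine (pow_le_pow_left₀ (norm_nonneg _) h3 2).trans (le_of_eq ?_)
  rw [← pow_mul, Nat.div_mul_cancel (Nat.even_mul_pred_self _).two_dvd, hn]

end

/-! ### A box of well-shaped polynomials -/

/-- The relative size of the middle coefficients. -/
noncomputable def boxEta (n : ℕ) : ℝ := 1 / (8 * n * (2 * n) ^ n)

/-- The relative root separation. -/
noncomputable def boxRho (n : ℕ) : ℝ := 1 / (2 * n * (4 * n) ^ (n - 2))

/-- The box of polynomials of degree `n` with dominating extreme coefficients. -/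
structure InBox (n : ℕ) (s t : ℝ) (f : ℤ[X]) : Prop where
  natDegree_eq : f.natDegree = n
  le_lead : s / 2 ≤ f.coeff n
  lead_le : (f.coeff n : ℝ) ≤ s
  middle : ∀ j, 1 ≤ j → j < n → |(f.coeff j : ℝ)| ≤ boxEta n * (s * t ^ (n - j))
  le_const : s * t ^ n / 2 ≤ f.coeff 0
  const_le : (f.coeff 0 : ℝ) ≤ s * t ^ n

lemma boxEta_pos {n : ℕ} (hn : 0 < n) : 0 < boxEta n := by
  have : (0 : ℝ) < n := by exact_mod_cast hn
  rw [boxEta]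
  positivity

lemma boxEta_le_one {n : ℕ} (hn : 0 < n) : boxEta n ≤ 1 := by
  have h1 : (1 : ℝ) ≤ n := by exact_mod_cast hn
  have h2 : (1 : ℝ) ≤ (2 * n) ^ n := one_le_pow₀ (by linarith)
  rw [boxEta]
  refine (div_le_one (by positivity)).2 ?_
  nlinarith

lemma boxRho_pos {n : ℕ} (hn : 0 < n) : 0 < boxRho n := by
  have : (0 : ℝ) < n := by exact_mod_cast hn
  rw [boxRho]
  positivity

lemma boxRho_le_one {n : ℕ} (hn : 0 < n) : boxRho n ≤ 1 := by
  have h1 : (1 : ℝ) ≤ n := by exact_mod_cast hn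
  have h2 : (1 : ℝ) ≤ (4 * n) ^ (n - 2) := one_le_pow₀ (by linarith)
  rw [boxRho]
  refine (div_le_one (by positivity)).2 ?_
  nlinarith

section

variable {n : ℕ} {s t : ℝ} {f : ℤ[X]}

lemma InBox.abs_coeff_le (hf : InBox n s t f) (hs : 0 < s) (ht : 0 < t) {j : ℕ} (hj : j < n) :
    |(f.coeff j : ℝ)| ≤ s * t ^ (n - j) := by
  rcases Nat.eq_zero_or_pos j with rfl | hj0
  · rw [abs_of_nonneg (le_trans (by positivity) hf.le_const)]
    exact hf.const_le
  · exact (hf.middle j hj0 hj).trans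
      (mul_le_of_le_one_left (by positivity) (boxEta_le_one (by omega)))

/-- A Cauchy-type bound: beyond `2 n t` the leading term, at least `(s / 2) |z|^n`, exceeds the `n`
other terms, each at most `s t |z|^(n-1)`. -/
lemma InBox.norm_root_le (hf : InBox n s t f) (hn : 0 < n) (hs : 0 < s) (ht : 0 < t) {z : ℂ}
    (hz : aeval z f = 0) : ‖z‖ ≤ 2 * n * t := by
  by_contra! hlt
  have hn' : (0 : ℝ) < n := by exact_mod_cast hn
  have hz0 : 0 < ‖z‖ := lt_of_le_of_lt (by positivity) hlt
  rw [aeval_eq_sum_range, hf.natDegree_eq, Finset.sum_range_succ] at hz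
  simp only [zsmul_eq_mul] at hz
  have h1 : ‖(f.coeff n : ℂ) * z ^ n‖ ≤ ∑ j ∈ Finset.range n, ‖(f.coeff j : ℂ) * z ^ j‖ := by
    rw [eq_neg_of_add_eq_zero_right hz, norm_neg]
    exact norm_sum_le _ _
  have h2 : ∀ j ∈ Finset.range n, ‖(f.coeff j : ℂ) * z ^ j‖ ≤ s * (t * ‖z‖ ^ (n - 1)) := by
    intro j hj
    have hj' := Finset.mem_range.1 hj
    have hle : t ≤ ‖z‖ := by
      refine le_trans ?_ hlt.le
      have : (1 : ℝ) ≤ n := by exact_mod_cast hn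
      nlinarith
    rw [norm_mul, norm_pow, Complex.norm_intCast]
    calc |(f.coeff j : ℝ)| * ‖z‖ ^ j ≤ s * t ^ (n - j) * ‖z‖ ^ j := by
          gcongr
          exact hf.abs_coeff_le hs ht hj'
      _ = s * (t * (t ^ (n - 1 - j) * ‖z‖ ^ j)) := by
          rw [show n - j = (n - 1 - j) + 1 by omega, pow_succ]
          ring
      _ ≤ s * (t * (‖z‖ ^ (n - 1 - j) * ‖z‖ ^ j)) := by gcongr
      _ = s * (t * ‖z‖ ^ (n - 1)) := by
          rw [← pow_add]
          congr 3
          omega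
  have h3 := h1.trans (Finset.sum_le_sum h2)
  rw [Finset.sum_const, Finset.card_range, nsmul_eq_mul, norm_mul, norm_pow,
    Complex.norm_intCast] at h3
  have h4 : s / 2 * ‖z‖ ^ n ≤ |(f.coeff n : ℝ)| * ‖z‖ ^ n := by
    gcongr
    exact hf.le_lead.trans (le_abs_self _)
  have h5 : (n : ℝ) * (s * (t * ‖z‖ ^ (n - 1))) < s / 2 * ‖z‖ ^ n := by
    have e : ‖z‖ ^ n = ‖z‖ ^ (n - 1) * ‖z‖ := by
      rw [← pow_succ]
      congr 1
      omega
    rw [e]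
    have := mul_lt_mul_of_pos_left hlt (by positivity : 0 < s / 2 * ‖z‖ ^ (n - 1))
    linarith
  linarith

/-- At a root, `z f'(z) = z f'(z) - n f(z)` has no term of degree `n`, and its constant term `-n
f(0)`, of size at least `n s t^n / 2`, dominates the rest. Dividing by `|z| ≤ 2 n t` gives the
bound. -/
lemma InBox.norm_derivative_ge (hf : InBox n s t f) (hn : 4 ≤ n) (hs : 0 < s) (ht : 0 < t) {z : ℂ}
    (hz : aeval z f = 0) : s * t ^ n ≤ 2 * n * t * ‖aeval z (derivative f)‖ := by
  have hb := hf.norm_root_le (by omega) hs ht hz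
  have hn' : (4 : ℝ) ≤ n := by exact_mod_cast hn
  have h1 : z * aeval z (derivative f) =
      - ∑ j ∈ Finset.range n, ((n - j : ℕ) : ℂ) * (f.coeff j * z ^ j) := by
    have hd : (derivative f).natDegree < n := by
      have := natDegree_derivative_lt (p := f) (by have := hf.natDegree_eq; omega)
      rwa [hf.natDegree_eq] at this
    have e1 : z * aeval z (derivative f) =
        ∑ j ∈ Finset.range (n + 1), (j : ℂ) * (f.coeff j * z ^ j) := by
      rw [aeval_eq_sum_range' hd, Finset.mul_sum, Finset.sum_range_succ']
      simp only [zsmul_eq_mul, coeff_derivative]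
      rw [Nat.cast_zero, zero_mul, add_zero]
      refine Finset.sum_congr rfl fun j _ => ?_
      push_cast
      ring
    have e2 : ∑ j ∈ Finset.range (n + 1), (n : ℂ) * (f.coeff j * z ^ j) = 0 := by
      rw [← Finset.mul_sum]
      rw [aeval_eq_sum_range, hf.natDegree_eq] at hz
      simp only [zsmul_eq_mul] at hz
      rw [hz, mul_zero]
    rw [e1, ← sub_zero (∑ j ∈ Finset.range (n + 1), _), ← e2, ← Finset.sum_sub_distrib,
      Finset.sum_range_succ, ← Finset.sum_neg_distrib, sub_self, add_zero]
    refine Finset.sum_congr rfl fun j hj => ?_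
    rw [Nat.cast_sub (Finset.mem_range.1 hj).le]
    ring
  obtain ⟨N, rfl⟩ : ∃ N, n = N + 1 := ⟨n - 1, by omega⟩
  rw [Finset.sum_range_succ'] at h1
  -- The value of `boxEta` is chosen so that each middle term is at most an eighth of `s t^n`.
  have h2 : ∀ j ∈ Finset.range N,
      ‖((N + 1 - (j + 1) : ℕ) : ℂ) * (f.coeff (j + 1) * z ^ (j + 1))‖ ≤ s * t ^ (N + 1) / 8 := by
    intro j hj
    have hj' := Finset.mem_range.1 hj
    rw [norm_mul, norm_mul, norm_pow, Complex.norm_intCast, Complex.norm_natCast]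
    have e1 : ((N + 1 - (j + 1) : ℕ) : ℝ) ≤ ((N + 1 : ℕ) : ℝ) := by exact_mod_cast Nat.sub_le _ _
    have e2 := hf.middle (j + 1) (by omega) (by omega)
    have hη := boxEta_pos (n := N + 1) (by omega)
    have e3 : ‖z‖ ^ (j + 1) ≤ (2 * (N + 1 : ℕ)) ^ (N + 1) * t ^ (j + 1) := by
      refine (pow_le_pow_left₀ (norm_nonneg _) hb _).trans ?_
      rw [mul_pow]
      gcongr
      · linarith
    calc ((N + 1 - (j + 1) : ℕ) : ℝ) * (|(f.coeff (j + 1) : ℝ)| * ‖z‖ ^ (j + 1))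
        ≤ ((N + 1 : ℕ) : ℝ) * ((boxEta (N + 1) * (s * t ^ (N + 1 - (j + 1)))) *
          ((2 * (N + 1 : ℕ)) ^ (N + 1) * t ^ (j + 1))) := by gcongr
      _ = ((N + 1 : ℕ) : ℝ) * boxEta (N + 1) * (2 * (N + 1 : ℕ)) ^ (N + 1) *
          (s * (t ^ (N + 1 - (j + 1)) * t ^ (j + 1))) := by ring
      _ = s * t ^ (N + 1) / 8 := by
          rw [← pow_add, show N + 1 - (j + 1) + (j + 1) = N + 1 by omega, boxEta]
          have : (0 : ℝ) < (N + 1 : ℕ) := by positivity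
          field_simp
  have h3 : ‖∑ j ∈ Finset.range N, ((N + 1 - (j + 1) : ℕ) : ℂ) * (f.coeff (j + 1) * z ^ (j + 1))‖ ≤
      N * (s * t ^ (N + 1) / 8) := by
    refine (norm_sum_le _ _).trans ((Finset.sum_le_sum h2).trans ?_)
    rw [Finset.sum_const, Finset.card_range, nsmul_eq_mul]
  have h4 : ‖((N + 1 - 0 : ℕ) : ℂ) * (f.coeff 0 * z ^ 0)‖ ≥ (N + 1) * (s * t ^ (N + 1) / 2) := by
    rw [pow_zero, mul_one, norm_mul, Complex.norm_natCast, Complex.norm_intCast, Nat.sub_zero]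
    push_cast
    gcongr
    exact hf.le_const.trans (le_abs_self _)
  have h5 : ‖z‖ * ‖aeval z (derivative f)‖ ≥
      (N + 1) * (s * t ^ (N + 1) / 2) - N * (s * t ^ (N + 1) / 8) := by
    rw [← norm_mul, h1, norm_neg, add_comm]
    have := norm_sub_le_norm_add (((N + 1 - 0 : ℕ) : ℂ) * (f.coeff 0 * z ^ 0))
      (∑ j ∈ Finset.range N, ((N + 1 - (j + 1) : ℕ) : ℂ) * (f.coeff (j + 1) * z ^ (j + 1)))
    linarith
  have h6 : ‖z‖ * ‖aeval z (derivative f)‖ ≤ 2 * (N + 1 : ℕ) * t * ‖aeval z (derivative f)‖ := by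
    gcongr
  have h7 : 0 < s * t ^ (N + 1) := by positivity
  push_cast at hn'
  nlinarith

/-- The roots are simple because `f'` does not vanish at them. For `z ≠ w`, write `f'(z)` as `a_0 (z
- w)` times `n - 2` further differences, each at most `4 n t`; the lower bound on `|f'(z)|` then
gives `|z - w| ≥ ρ t`, which explains `boxRho`. -/
lemma InBox.separatedRoots (hf : InBox n s t f) (hn : 4 ≤ n) (hs : 0 < s) (ht : 0 < t) :
    SeparatedRoots f (boxRho n * t) := by
  classical
  have hn' : (4 : ℝ) ≤ n := by exact_mod_cast hn
  have hf0 : f ≠ 0 := by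
    rintro rfl
    have := hf.natDegree_eq
    simp at this
    omega
  set F := f.map (algebraMap ℤ ℂ) with hF
  have hF0 : F ≠ 0 := (Polynomial.map_ne_zero_iff Int.cast_injective).2 hf0
  have hFn : F.natDegree = n := (natDegree_map_eq_of_injective Int.cast_injective f).trans
    hf.natDegree_eq
  have hspl : F.Splits := IsAlgClosed.splits F
  have hder : ∀ z : ℂ, aeval z f = 0 → aeval z (derivative f) ≠ 0 := by
    intro z hz H
    have := hf.norm_derivative_ge hn hs ht hz
    rw [H, norm_zero, mul_zero] at this
    have : 0 < s * t ^ n := by positivity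
    linarith
  have hcard : (f.aroots ℂ).card = n := by
    rw [← hFn]
    exact hspl.natDegree_eq_card_roots.symm
  constructor
  · rw [Multiset.toFinset_card_of_nodup, hcard, hf.natDegree_eq]
    rw [Multiset.nodup_iff_count_le_one]
    intro z
    rw [aroots, count_roots]
    by_contra! hlt
    obtain ⟨h1, h2⟩ := (one_lt_rootMultiplicity_iff_isRoot hF0).1 hlt
    rw [IsRoot.def, hF, eval_map_algebraMap] at h1
    rw [IsRoot.def, hF, derivative_map, eval_map_algebraMap] at h2
    exact hder z h1 h2
  · intro z w hz hw hzw
    have hzr : z ∈ F.roots := mem_aroots.2 ⟨hf0, hz⟩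
    obtain ⟨R₁, hR₁⟩ := Multiset.exists_cons_of_mem hzr
    have hwr : w ∈ R₁ := by
      have : w ∈ F.roots := mem_aroots.2 ⟨hf0, hw⟩
      rw [hR₁, Multiset.mem_cons] at this
      exact this.resolve_left hzw.symm
    obtain ⟨R, hR⟩ := Multiset.exists_cons_of_mem hwr
    have hroots : F.roots = z ::ₘ w ::ₘ R := by rw [hR₁, hR]
    have hRc : R.card = n - 2 := by
      have : F.roots.card = n := hcard
      rw [hroots, Multiset.card_cons, Multiset.card_cons] at this
      omega
    have hFe : F = (X - C z) * (C F.leadingCoeff * ((X - C w) *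
        (R.map fun a => X - C a).prod)) := by
      conv_lhs => rw [hspl.eq_prod_roots, hroots, Multiset.map_cons, Multiset.map_cons,
        Multiset.prod_cons, Multiset.prod_cons]
      ring
    have hd : aeval z (derivative f) =
        F.leadingCoeff * ((z - w) * (R.map fun a => z - a).prod) := by
      rw [← eval_map_algebraMap, ← derivative_map, ← hF]
      conv_lhs => rw [hFe]
      rw [derivative_mul, derivative_X_sub_C, one_mul, eval_add, eval_mul (p := X - C z), eval_sub,
        eval_X, eval_C, sub_self, zero_mul, add_zero, eval_mul, eval_mul, eval_C, eval_sub, eval_X,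
        eval_C, eval_multiset_prod, Multiset.map_map]
      simp
    have hl : ‖F.leadingCoeff‖ ≤ s := by
      rw [leadingCoeff, hFn, hF, coeff_map, eq_intCast, Complex.norm_intCast,
        abs_of_nonneg (le_trans (by positivity) hf.le_lead)]
      exact hf.lead_le
    have hprod : ‖(R.map fun a => z - a).prod‖ ≤ (4 * n * t) ^ (n - 2) := by
      have h1 : ∀ a ∈ R, ‖z - a‖ ≤ 4 * n * t := by
        intro a ha
        have har : a ∈ F.roots := by
          rw [hroots]
          exact Multiset.mem_cons_of_mem (Multiset.mem_cons_of_mem ha)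
        have h2 := hf.norm_root_le (by omega) hs ht (mem_aroots.1 har).2
        have h3 := hf.norm_root_le (by omega) hs ht hz
        have := norm_sub_le z a
        linarith
      rw [← hRc]
      clear hRc hroots hR hFe hd
      induction R using Multiset.induction_on with
      | empty => simp
      | cons a R ih =>
        rw [Multiset.map_cons, Multiset.prod_cons, norm_mul, Multiset.card_cons, pow_succ']
        exact mul_le_mul (h1 a (Multiset.mem_cons_self a R))
          (ih fun b hb => h1 b (Multiset.mem_cons_of_mem hb)) (norm_nonneg _) (by positivity)
    have h1 := hf.norm_derivative_ge hn hs ht hz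
    rw [hd, norm_mul, norm_mul] at h1
    have h2 : s * t ^ n ≤ 2 * n * t * (s * (‖z - w‖ * (4 * n * t) ^ (n - 2))) := by
      refine h1.trans ?_
      gcongr
    rw [mul_pow, show t ^ n = t * t * t ^ (n - 2) by
      rw [← pow_two, ← pow_add]; congr 1; omega] at h2
    have hpos : 0 < s * t * t ^ (n - 2) := by positivity
    have h3 : s * t * t ^ (n - 2) * t ≤ s * t * t ^ (n - 2) *
        (2 * n * (4 * n) ^ (n - 2) * ‖z - w‖) := by
      refine le_trans (le_of_eq ?_) (h2.trans (le_of_eq ?_)) <;> ring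
    have h4 := le_of_mul_le_mul_left h3 hpos
    rw [boxRho, one_div, inv_mul_le_iff₀ (by positivity)]
    exact h4

theorem InBox.wellShaped (hf : InBox n s t f) (hn : 4 ≤ n) {m : ℕ} (hm : 0 < m) (hs : 2 ≤ s) {T : ℝ}
    (hT : 4 * (n : ℝ) ^ 3 ≤ T * boxRho n ^ (n - 1)) (hT1 : 1 ≤ T) (ht : T ≤ t)
    (htm : T * m ≤ t ^ (n - 2)) : WellShaped f m (2 * n * t) (boxRho n * t) := by
  have hn' : (4 : ℝ) ≤ n := by exact_mod_cast hn
  have hs0 : 0 < s := by linarith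
  have ht1 : 1 ≤ t := hT1.trans ht
  have ht0 : 0 < t := by linarith
  have hρ := boxRho_pos (n := n) (by omega)
  have hρ1 := boxRho_le_one (n := n) (by omega)
  have hlead : (1 : ℝ) ≤ f.coeff n := by linarith [hf.le_lead]
  refine ⟨by rw [hf.natDegree_eq]; exact hn, ?_, hm, by positivity, by positivity,
    hf.separatedRoots hn hs0 ht0, fun z hz => hf.norm_root_le (by omega) hs0 ht0 hz, ?_, ?_⟩
  · rw [hf.natDegree_eq]
    exact_mod_cast (by linarith : (0 : ℝ) < f.coeff n)
  · intro k hk hkn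
    rw [hf.natDegree_eq] at hkn ⊢
    -- The last index uses `T m ≤ t^(n-2)`; for the other `k ≥ 2` the bound `T ≤ t` is enough.
    have h1 : t * (T * (if k + 1 = n then (m : ℝ) else 1)) ≤ t ^ k := by
      split_ifs with hk1
      · calc t * (T * m) ≤ t * t ^ (n - 2) := by gcongr
          _ = t ^ k := by rw [← pow_succ']; congr 1; omega
      · calc t * (T * 1) ≤ t * t := by rw [mul_one]; gcongr
          _ = t ^ 2 := by ring
          _ ≤ t ^ k := pow_le_pow_right₀ ht1 hk
    have h2 : boxRho n ^ (n - 1) ≤ boxRho n ^ k := pow_le_pow_of_le_one hρ.le hρ1 (by omega)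
    have hμ : (0 : ℝ) ≤ (if k + 1 = n then (m : ℝ) else 1) := by split_ifs <;> positivity
    set μ := (if k + 1 = n then (m : ℝ) else 1)
    calc 2 * (n : ℝ) ^ 2 * (2 * n * t) * μ = 4 * (n : ℝ) ^ 3 * (t * μ) := by ring
      _ ≤ T * boxRho n ^ (n - 1) * (t * μ) := by gcongr
      _ = boxRho n ^ (n - 1) * (t * (T * μ)) := by ring
      _ ≤ boxRho n ^ k * t ^ k := by gcongr
      _ = (boxRho n * t) ^ k := (mul_pow _ _ _).symm
  · rw [hf.natDegree_eq]
    have h1 : √(n : ℝ) ≤ (n : ℝ) ^ 3 := by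
      rw [Real.sqrt_le_left (by positivity)]
      nlinarith [one_le_pow₀ (n := 5) (by linarith : (1 : ℝ) ≤ n)]
    have h2 : boxRho n ^ (n - 1) ≤ boxRho n := by
      calc boxRho n ^ (n - 1) ≤ boxRho n ^ 1 := pow_le_pow_of_le_one hρ.le hρ1 (by omega)
        _ = boxRho n := pow_one _
    calc 4 * √(n : ℝ) ≤ 4 * (n : ℝ) ^ 3 := by gcongr
      _ ≤ T * boxRho n ^ (n - 1) := hT
      _ ≤ t * boxRho n := by gcongr
      _ = 1 * (boxRho n * t) := by ring
      _ ≤ f.coeff n * (boxRho n * t) := by gcongr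

end

/-! ### Counting coprime pairs -/

lemma card_filter_coprime_Ico (a n k : ℕ) :
    ((Finset.Ico n (n + k * a)).filter a.Coprime).card = k * a.totient := by
  induction k with
  | zero => simp
  | succ k ih =>
    have e : Finset.Ico n (n + (k + 1) * a) =
        Finset.Ico n (n + k * a) ∪ Finset.Ico (n + k * a) (n + k * a + a) := by
      rw [Finset.Ico_union_Ico_eq_Ico (by omega) (by omega), add_mul, one_mul, add_assoc]
    rw [e, Finset.filter_union, Finset.card_union_of_disjoint, ih,
      Nat.filter_coprime_Ico_eq_totient, add_mul, one_mul]
    exact Finset.disjoint_filter_filter (Finset.Ico_disjoint_Ico_consecutive _ _ _)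

/-- Exchange the order of summation in `∑_k ∑_(b ∣ k) φ(b)`, whose inner sum is `k`. -/
lemma sum_totient_mul_div (N : ℕ) :
    ∑ b ∈ Finset.Ioc 0 N, N / b * b.totient = ∑ k ∈ Finset.Ioc 0 N, k := by
  calc ∑ b ∈ Finset.Ioc 0 N, N / b * b.totient
      = ∑ b ∈ Finset.Ioc 0 N, ∑ k ∈ Finset.Ioc 0 N, if b ∣ k then b.totient else 0 := by
        refine Finset.sum_congr rfl fun b _ => ?_
        rw [← Finset.sum_filter, Finset.sum_const, Nat.Ioc_filter_dvd_card_eq_div, smul_eq_mul]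
    _ = ∑ k ∈ Finset.Ioc 0 N, ∑ b ∈ Finset.Ioc 0 N, if b ∣ k then b.totient else 0 :=
        Finset.sum_comm
    _ = ∑ k ∈ Finset.Ioc 0 N, k := by
        refine Finset.sum_congr rfl fun k hk => ?_
        conv_rhs => rw [← Nat.sum_totient k]
        rw [← Finset.sum_filter]
        refine Finset.sum_congr ?_ fun _ _ => rfl
        ext b
        simp only [Finset.mem_filter, Finset.mem_Ioc, Nat.mem_divisors] at hk ⊢
        constructor
        · exact fun H => ⟨H.2, by omega⟩
        · intro H
          have h1 := Nat.le_of_dvd hk.1 H.1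
          have h2 := Nat.pos_of_dvd_of_pos H.1 hk.1
          exact ⟨⟨h2, by omega⟩, H.1⟩

/-- The coprime pairs `(a, b)` with `N < a ≤ 2N` and `0 < b ≤ N`. -/
def coprimePairs (N : ℕ) : Finset (ℕ × ℕ) :=
  (Finset.Ioc N (2 * N) ×ˢ Finset.Ioc 0 N).filter fun p => p.1.Coprime p.2

/-- For each `b`, the interval `(N, 2N]` contains `⌊N / b⌋` full periods modulo `b`, each with
`φ(b)` values prime to `b`. This already yields a positive proportion of pairs, without any
asymptotics. -/
lemma sum_le_card_coprimePairs (N : ℕ) :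
    ∑ k ∈ Finset.Ioc 0 N, k ≤ (coprimePairs N).card := by
  rw [← sum_totient_mul_div, coprimePairs, Finset.card_filter, Finset.sum_product_right]
  refine Finset.sum_le_sum fun b hb => ?_
  rw [← Finset.card_filter, ← card_filter_coprime_Ico b (N + 1) (N / b)]
  refine Finset.card_le_card fun a ha => ?_
  rw [Finset.mem_filter, Finset.mem_Ico] at ha
  have := Nat.div_mul_le_self N b
  rw [Finset.mem_filter, Finset.mem_Ioc]
  exact ⟨by omega, ha.2.symm⟩

/-! ### Arithmetic progressions -/

/-- The `j`-th element from `L` on of the residue class of `r` modulo `q`. -/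
def residueElt (L q r : ℤ) (j : ℕ) : ℤ := L + (r - L) % q + q * j

lemma dvd_residueElt_sub (L q r : ℤ) (j : ℕ) : q ∣ residueElt L q r j - r := by
  refine ⟨j - (r - L) / q, ?_⟩
  have := Int.emod_add_mul_ediv (r - L) q
  rw [residueElt]
  linarith

lemma le_residueElt {L q r : ℤ} (hq : 0 < q) (j : ℕ) : L ≤ residueElt L q r j := by
  have h1 := Int.emod_nonneg (r - L) hq.ne'
  have h2 : 0 ≤ q * j := by positivity
  rw [residueElt]
  linarith

lemma residueElt_lt {L q r : ℤ} (hq : 0 < q) {j N : ℕ} (hj : j < N) :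
    residueElt L q r j < L + q * N := by
  have h1 := Int.emod_lt_of_pos (r - L) hq
  have h2 : q * (j + 1 : ℤ) ≤ q * N := mul_le_mul_of_nonneg_left (by exact_mod_cast hj) hq.le
  rw [residueElt]
  linarith

lemma residueElt_injective {L q r : ℤ} (hq : 0 < q) : Function.Injective (residueElt L q r) := by
  intro j j' H
  rw [residueElt, residueElt] at H
  have := mul_left_cancel₀ hq.ne' (add_left_cancel H)
  exact_mod_cast this

/-! ### A family of weakly divisible polynomials -/

/-- The data from which a weakly divisible polynomial is built: the two leading coefficients, the
middle coefficients, the residue `l`, and the positions of the last two coefficients in their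
residue classes. -/
abbrev FamilyIndex (r : ℕ) : Type := (ℕ × ℕ) × (Fin r → ℤ) × ℕ × ℕ × ℕ

/-- The coefficients of `X ^ i` for `i ≥ 2`. -/
def upperCoeff {r : ℕ} (x : FamilyIndex r) (i : ℕ) : ℤ :=
  if i = r + 3 then x.1.1 else if i = r + 2 then x.1.2 else
    if h : 2 ≤ i ∧ i < r + 2 then x.2.1 ⟨i - 2, by omega⟩ else 0

/-- The part of degree at least two. -/
noncomputable def upperPoly {r : ℕ} (x : FamilyIndex r) : ℤ[X] :=
  ∑ i ∈ Finset.range (r + 4), C (upperCoeff x i) * X ^ i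

/-- The coefficient of `X`. -/
noncomputable def linCoeff {r : ℕ} (m : ℕ) (L₁ : ℤ) (x : FamilyIndex r) : ℤ :=
  residueElt L₁ m (-(derivative (upperPoly x)).eval (x.2.2.1 : ℤ)) x.2.2.2.1

/-- The constant coefficient. -/
noncomputable def constCoeff {r : ℕ} (m : ℕ) (L₀ L₁ : ℤ) (x : FamilyIndex r) : ℤ :=
  residueElt L₀ ((m : ℤ) ^ 2)
    (-((upperPoly x).eval (x.2.2.1 : ℤ) + linCoeff m L₁ x * (x.2.2.1 : ℤ))) x.2.2.2.2

/-- The polynomial with the given data that is weakly divisible by `m` at `l`. -/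
noncomputable def familyPoly {r : ℕ} (m : ℕ) (L₀ L₁ : ℤ) (x : FamilyIndex r) : ℤ[X] :=
  upperPoly x + C (linCoeff m L₁ x) * X + C (constCoeff m L₀ L₁ x)

/-- The index set of the family. -/
noncomputable def familyIndices (r m N N₀ N₁ : ℕ) (M : ℕ → ℕ) : Finset (FamilyIndex r) :=
  coprimePairs N ×ˢ Fintype.piFinset (fun j : Fin r => Finset.Icc (-(M (j + 2) : ℤ)) (M (j + 2))) ×ˢ
    Finset.range m ×ˢ Finset.range N₁ ×ˢ Finset.range N₀

lemma card_familyIndices (r m N N₀ N₁ : ℕ) (M : ℕ → ℕ) :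
    (familyIndices r m N N₀ N₁ M).card =
      (coprimePairs N).card * ((∏ j ∈ Finset.range r, (2 * M (j + 2) + 1)) * (m * (N₁ * N₀))) := by
  rw [familyIndices, Finset.card_product, Finset.card_product, Finset.card_product,
    Finset.card_product, Fintype.card_piFinset, Finset.card_range, Finset.card_range,
    Finset.card_range, ← Fin.prod_univ_eq_prod_range (fun j => 2 * M (j + 2) + 1) r]
  have h : ∀ j : Fin r, (Finset.Icc (-(M (j + 2) : ℤ)) (M (j + 2))).card = 2 * M (j + 2) + 1 := by
    intro j
    rw [Int.card_Icc]
    omega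
  rw [Finset.prod_congr rfl fun j _ => h j]

section family

variable {r m : ℕ} {L₀ L₁ : ℤ}

lemma coeff_upperPoly (x : FamilyIndex r) (i : ℕ) : (upperPoly x).coeff i = upperCoeff x i := by
  rw [upperPoly, finsetSum_coeff]
  simp only [coeff_C_mul, coeff_X_pow, mul_ite, mul_one, mul_zero, Finset.sum_ite_eq,
    Finset.mem_range]
  split_ifs with h
  · rfl
  · rw [upperCoeff, if_neg (by omega), if_neg (by omega), dif_neg (by omega)]

lemma coeff_familyPoly_zero (x : FamilyIndex r) :
    (familyPoly m L₀ L₁ x).coeff 0 = constCoeff m L₀ L₁ x := by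
  rw [familyPoly, coeff_add, coeff_add, coeff_upperPoly, upperCoeff, if_neg (by omega),
    if_neg (by omega), dif_neg (by omega)]
  simp

lemma coeff_familyPoly_one (x : FamilyIndex r) :
    (familyPoly m L₀ L₁ x).coeff 1 = linCoeff m L₁ x := by
  rw [familyPoly, coeff_add, coeff_add, coeff_upperPoly, upperCoeff, if_neg (by omega)]
  by_cases hr : r + 2 = 1
  · omega
  · rw [if_neg (by omega), dif_neg (by omega), coeff_C_mul, coeff_X_one, coeff_C]
    simp

lemma coeff_familyPoly_of_two_le (x : FamilyIndex r) {i : ℕ} (hi : 2 ≤ i) :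
    (familyPoly m L₀ L₁ x).coeff i = upperCoeff x i := by
  rw [familyPoly, coeff_add, coeff_add, coeff_upperPoly, coeff_C_mul, coeff_X, coeff_C,
    if_neg (by omega), if_neg (by omega)]
  simp

lemma coeff_familyPoly_top (x : FamilyIndex r) :
    (familyPoly m L₀ L₁ x).coeff (r + 3) = x.1.1 := by
  rw [coeff_familyPoly_of_two_le x (by omega), upperCoeff, if_pos rfl]

lemma coeff_familyPoly_pred (x : FamilyIndex r) :
    (familyPoly m L₀ L₁ x).coeff (r + 2) = x.1.2 := by
  rw [coeff_familyPoly_of_two_le x (by omega), upperCoeff, if_neg (by omega), if_pos rfl]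

lemma coeff_familyPoly_mid (x : FamilyIndex r) (j : Fin r) :
    (familyPoly m L₀ L₁ x).coeff (j + 2) = x.2.1 j := by
  have := j.2
  rw [coeff_familyPoly_of_two_le x (by omega), upperCoeff, if_neg (by omega), if_neg (by omega),
    dif_pos ⟨by omega, by omega⟩]
  rfl

lemma natDegree_familyPoly {x : FamilyIndex r} (hx : x.1.1 ≠ 0) :
    (familyPoly m L₀ L₁ x).natDegree = r + 3 := by
  refine le_antisymm (natDegree_le_iff_coeff_eq_zero.2 fun i hi => ?_)
    (le_natDegree_of_ne_zero ?_)
  · rw [coeff_familyPoly_of_two_le x (by omega), upperCoeff, if_neg (by omega), if_neg (by omega),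
      dif_neg (by omega)]
  · rw [coeff_familyPoly_top]
    exact_mod_cast hx

/-- The derivative does not see the constant term, so the linear coefficient is fixed modulo `m`
first, and the constant one modulo `m²` afterwards. -/
lemma weaklyDivisibleAt_familyPoly (x : FamilyIndex r) :
    WeaklyDivisibleAt (familyPoly m L₀ L₁ x) m (x.2.2.1 : ℤ) := by
  constructor
  · have h := dvd_residueElt_sub L₀ ((m : ℤ) ^ 2)
      (-((upperPoly x).eval (x.2.2.1 : ℤ) + linCoeff m L₁ x * (x.2.2.1 : ℤ))) x.2.2.2.2
    rw [← constCoeff, sub_neg_eq_add] at h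
    rw [familyPoly, eval_add, eval_add, eval_mul, eval_C, eval_C, eval_X, add_comm]
    exact h
  · have h := dvd_residueElt_sub L₁ m (-(derivative (upperPoly x)).eval (x.2.2.1 : ℤ)) x.2.2.2.1
    rw [← linCoeff, sub_neg_eq_add] at h
    rw [familyPoly, derivative_add, derivative_add, derivative_C_mul, derivative_X, derivative_C,
      mul_one, add_zero, eval_add, eval_C, add_comm]
    exact h

/-- The coefficients of degree at least two and `l` determine the residue class of the linear
coefficient, and then that of the constant one; the positions within the classes follow in this
order. -/
lemma familyPoly_injective (hm : 0 < m) :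
    Function.Injective fun x : FamilyIndex r => (familyPoly m L₀ L₁ x, (x.2.2.1 : ℤ)) := by
  have hm' : (0 : ℤ) < m := by exact_mod_cast hm
  intro x y H
  rw [Prod.mk.injEq] at H
  obtain ⟨H, hl⟩ := H
  have hc : ∀ i, (familyPoly m L₀ L₁ x).coeff i = (familyPoly m L₀ L₁ y).coeff i :=
    fun i => by rw [H]
  have h1 : x.1 = y.1 := by
    have e1 := hc (r + 3)
    have e2 := hc (r + 2)
    rw [coeff_familyPoly_top, coeff_familyPoly_top] at e1
    rw [coeff_familyPoly_pred, coeff_familyPoly_pred] at e2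
    exact Prod.ext (by exact_mod_cast e1) (by exact_mod_cast e2)
  have h2 : x.2.1 = y.2.1 := by
    funext j
    have e := hc (j + 2)
    rwa [coeff_familyPoly_mid, coeff_familyPoly_mid] at e
  have h3 : x.2.2.1 = y.2.2.1 := by exact_mod_cast hl
  have hu : upperPoly x = upperPoly y := by
    ext i
    rw [coeff_upperPoly, coeff_upperPoly, upperCoeff, upperCoeff, h1, h2]
  have hlin := hc 1
  rw [coeff_familyPoly_one, coeff_familyPoly_one] at hlin
  have h4 : x.2.2.2.1 = y.2.2.2.1 := by
    have e := hlin
    rw [linCoeff, linCoeff, hu, h3] at e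
    exact residueElt_injective hm' e
  have hcon := hc 0
  rw [coeff_familyPoly_zero, coeff_familyPoly_zero] at hcon
  have h5 : x.2.2.2.2 = y.2.2.2.2 := by
    have e := hcon
    rw [constCoeff, constCoeff, hu, h3, hlin] at e
    exact residueElt_injective (by positivity) e
  exact Prod.ext h1 (Prod.ext h2 (Prod.ext h3 (Prod.ext h4 h5)))

end family

/-! ### Finiteness -/

/-- Needed because `ringCount` is a `Nat.card`, which is zero on infinite types and would make lower
bounds fail. -/
lemma finite_W (n : ℕ) {s t : ℝ} (hs : 0 < s) (ht : 0 < t) : (W n s t).Finite := by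
  -- The extra `s` covers the two leading coefficients, which are bounded in terms of `s` alone.
  set c : Fin (n + 1) → ℤ := fun j => ⌈s * t ^ (n - (j : ℕ)) + s⌉ with hc
  refine Set.Finite.of_finite_image (f := fun f : ℤ[X] => fun j : Fin (n + 1) => f.coeff j)
    ((Set.finite_Icc (-c) c).subset ?_) ?_
  · rintro _ ⟨f, ⟨hd, h1, h1', h0, h0', hi⟩, rfl⟩
    have key : ∀ j : Fin (n + 1), |f.coeff j| ≤ c j := by
      intro j
      have hj : (j : ℕ) ≤ n := Nat.lt_succ_iff.1 j.2
      have hp : 0 < s * t ^ (n - (j : ℕ)) := by positivity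
      have h2 : |(f.coeff j : ℝ)| ≤ s * t ^ (n - (j : ℕ)) + s := by
        rcases Nat.lt_or_ge (n - j) 2 with h | h
        · rcases Nat.eq_zero_or_pos (n - j) with h' | h'
          · rw [show (j : ℕ) = n by omega] at hp ⊢
            rw [abs_of_nonneg (by linarith)]
            linarith
          · rw [show (j : ℕ) = n - 1 by omega] at hp ⊢
            rw [abs_of_nonneg h1]
            linarith
        · have := hi (n - j) h (by omega)
          rw [show n - (n - (j : ℕ)) = j by omega] at this
          linarith
      have h3 : ((|f.coeff j| : ℤ) : ℝ) ≤ (c j : ℝ) := by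
        push_cast
        exact h2.trans (Int.le_ceil _)
      exact_mod_cast h3
    exact ⟨fun j => (abs_le.1 (key j)).1, fun j => (abs_le.1 (key j)).2⟩
  · rintro f ⟨hd, -⟩ g ⟨hd', -⟩ H
    ext i
    rcases Nat.lt_or_ge i (n + 1) with h | h
    · exact congrFun H ⟨i, h⟩
    · rw [coeff_eq_zero_of_natDegree_lt (by omega), coeff_eq_zero_of_natDegree_lt (by omega)]

lemma finite_WmRed (n : ℕ) {s t : ℝ} (hs : 0 < s) (ht : 0 < t) (m : ℕ) : (WmRed n s t m).Finite :=
  ((finite_W n hs ht).prod (Set.finite_Ico (0 : ℤ) m)).subset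
    fun _ hp => ⟨hp.1.1, hp.1.2.1, hp.1.2.2.1⟩

/-! ### The family inside the box -/

/-- The bound for the coefficient of `X ^ j`. -/
noncomputable def boxM (n : ℕ) (s t : ℝ) (j : ℕ) : ℕ := ⌊boxEta n * (s * t ^ (n - j))⌋₊

/-- The number of admissible coefficients of `X` in one residue class modulo `m`. -/
noncomputable def boxN₁ (n : ℕ) (s t : ℝ) (m : ℕ) : ℕ := (2 * boxM n s t 1 + 1) / m

/-- The number of admissible constant coefficients in one residue class modulo `m²`. -/
noncomputable def boxN₀ (n : ℕ) (s t : ℝ) (m : ℕ) : ℕ :=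
  (⌊s * t ^ n⌋ - ⌈s * t ^ n / 2⌉ + 1).toNat / m ^ 2

/-- The indices of the family of weakly divisible polynomials in the box. -/
noncomputable def boxIndices (r : ℕ) (s t : ℝ) (m : ℕ) : Finset (FamilyIndex r) :=
  familyIndices r m ⌊s / 2⌋₊ (boxN₀ (r + 3) s t m) (boxN₁ (r + 3) s t m) (boxM (r + 3) s t)

/-- The family of weakly divisible polynomials in the box. -/
noncomputable def boxPoly {r : ℕ} (s t : ℝ) (m : ℕ) (x : FamilyIndex r) : ℤ[X] :=
  familyPoly m ⌈s * t ^ (r + 3) / 2⌉ (-(boxM (r + 3) s t 1 : ℤ)) x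

/-- The parameters are large in terms of the constant `T`. -/
structure LargeParams (n : ℕ) (T s t : ℝ) (m : ℕ) : Prop where
  four_le : 4 ≤ n
  m_pos : 0 < m
  hT : 4 ≤ T
  hρ : 4 * (n : ℝ) ^ 3 ≤ T * boxRho n ^ (n - 1)
  hη : 1 ≤ T * boxEta n
  hs : T ≤ s
  ht : T ≤ t
  htm : T * m ≤ t ^ (n - 2)
  hstm : T * m ^ 2 ≤ s * t ^ n

section

variable {r m : ℕ} {s t T : ℝ} {x : FamilyIndex r}

lemma mem_boxIndices : x ∈ boxIndices r s t m ↔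
    (x.1.1 ∈ Finset.Ioc ⌊s / 2⌋₊ (2 * ⌊s / 2⌋₊) ∧ x.1.2 ∈ Finset.Ioc 0 ⌊s / 2⌋₊) ∧
      x.1.1.Coprime x.1.2 ∧
      (∀ j : Fin r, -(boxM (r + 3) s t (j + 2) : ℤ) ≤ x.2.1 j ∧
        x.2.1 j ≤ boxM (r + 3) s t (j + 2)) ∧
      x.2.2.1 < m ∧ x.2.2.2.1 < boxN₁ (r + 3) s t m ∧ x.2.2.2.2 < boxN₀ (r + 3) s t m := by
  rw [boxIndices, familyIndices, coprimePairs]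
  simp only [Finset.mem_product, Finset.mem_filter, Fintype.mem_piFinset, Finset.mem_Icc,
    Finset.mem_range, and_assoc]

lemma LargeParams.s_pos (h : LargeParams (r + 3) T s t m) : 0 < s := by
  linarith [h.hT, h.hs]

lemma LargeParams.t_pos (h : LargeParams (r + 3) T s t m) : 0 < t := by
  linarith [h.hT, h.ht]

/-- The coefficient of `x^(n-1)` ranges up to `s / 2`; this lets it obey the bound imposed on the
middle coefficients of the box. -/
lemma LargeParams.le_eta_mul (h : LargeParams (r + 3) T s t m) : s / 2 ≤ boxEta (r + 3) * (s * t) := by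
  have h1 : 1 ≤ t * boxEta (r + 3) :=
    h.hη.trans (mul_le_mul_of_nonneg_right h.ht (boxEta_pos (by omega)).le)
  have := mul_le_mul_of_nonneg_left h1 h.s_pos.le
  linarith [h.s_pos]

lemma LargeParams.inBox (h : LargeParams (r + 3) T s t m) (hx : x ∈ boxIndices r s t m) :
    InBox (r + 3) s t (boxPoly s t m x) := by
  obtain ⟨⟨ha, hb⟩, -, he, hl, hj₁, hj₀⟩ := mem_boxIndices.1 hx
  rw [Finset.mem_Ioc] at ha hb
  have hs := h.s_pos
  have ht := h.t_pos
  have hη := boxEta_pos (n := r + 3) (by omega)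
  have hm : (0 : ℤ) < m := by exact_mod_cast h.m_pos
  have hN : (⌊s / 2⌋₊ : ℝ) ≤ s / 2 := Nat.floor_le (by positivity)
  have hM : ∀ j, (boxM (r + 3) s t j : ℝ) ≤ boxEta (r + 3) * (s * t ^ (r + 3 - j)) := fun j =>
    Nat.floor_le (by positivity)
  refine ⟨natDegree_familyPoly (by omega), ?_, ?_, ?_, ?_, ?_⟩
  · rw [boxPoly, coeff_familyPoly_top, Int.cast_natCast]
    exact (Nat.lt_of_floor_lt ha.1).le
  · rw [boxPoly, coeff_familyPoly_top, Int.cast_natCast]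
    have : (x.1.1 : ℝ) ≤ 2 * ⌊s / 2⌋₊ := by exact_mod_cast ha.2
    linarith
  · intro j hj hjn
    rcases eq_or_ne j 1 with rfl | hj1
    · refine le_trans ?_ (hM 1)
      rw [boxPoly, coeff_familyPoly_one, linCoeff]
      have h1 := le_residueElt (L := -(boxM (r + 3) s t 1 : ℤ))
        (r := -(derivative (upperPoly x)).eval (x.2.2.1 : ℤ)) hm x.2.2.2.1
      have h2 := residueElt_lt (L := -(boxM (r + 3) s t 1 : ℤ))
        (r := -(derivative (upperPoly x)).eval (x.2.2.1 : ℤ)) hm hj₁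
      have h3 : (m : ℤ) * boxN₁ (r + 3) s t m ≤ 2 * boxM (r + 3) s t 1 + 1 := by
        exact_mod_cast Nat.mul_div_le (2 * boxM (r + 3) s t 1 + 1) m
      have h4 := abs_le.2 ⟨h1, by linarith⟩
      exact_mod_cast h4
    rcases eq_or_ne j (r + 2) with rfl | hj2
    · rw [boxPoly, coeff_familyPoly_pred, Int.cast_natCast, abs_of_nonneg (by positivity),
        show r + 3 - (r + 2) = 1 by omega, pow_one]
      have : (x.1.2 : ℝ) ≤ ⌊s / 2⌋₊ := by exact_mod_cast hb.2
      linarith [h.le_eta_mul]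
    · obtain ⟨i, rfl⟩ : ∃ i, j = i + 2 := ⟨j - 2, by omega⟩
      refine le_trans ?_ (hM (i + 2))
      have e := coeff_familyPoly_mid (m := m) (L₀ := ⌈s * t ^ (r + 3) / 2⌉)
        (L₁ := -(boxM (r + 3) s t 1 : ℤ)) x ⟨i, by omega⟩
      simp only at e
      rw [boxPoly, e]
      exact_mod_cast abs_le.2 (he ⟨i, by omega⟩)
  · rw [boxPoly, coeff_familyPoly_zero, constCoeff]
    refine (Int.le_ceil _).trans ?_
    exact_mod_cast le_residueElt (pow_pos hm 2) _
  · rw [boxPoly, coeff_familyPoly_zero, constCoeff]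
    refine le_trans ?_ (Int.floor_le _)
    have h2 := residueElt_lt (L := ⌈s * t ^ (r + 3) / 2⌉) (q := (m : ℤ) ^ 2)
      (r := -((upperPoly x).eval (x.2.2.1 : ℤ) +
        linCoeff m (-(boxM (r + 3) s t 1 : ℤ)) x * (x.2.2.1 : ℤ))) (by positivity) hj₀
    have h3 : (m : ℤ) ^ 2 * boxN₀ (r + 3) s t m ≤
        ((⌊s * t ^ (r + 3)⌋ - ⌈s * t ^ (r + 3) / 2⌉ + 1).toNat : ℤ) := by
      exact_mod_cast Nat.mul_div_le _ (m ^ 2)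
    -- If `toNat` had truncated to zero there would be no admissible position, contrary to `hj₀`.
    have h4 : (⌊s * t ^ (r + 3)⌋ - ⌈s * t ^ (r + 3) / 2⌉ + 1).toNat ≠ 0 := by
      intro H
      rw [boxN₀, H, Nat.zero_div] at hj₀
      omega
    have h5 : ((⌊s * t ^ (r + 3)⌋ - ⌈s * t ^ (r + 3) / 2⌉ + 1).toNat : ℤ) =
        ⌊s * t ^ (r + 3)⌋ - ⌈s * t ^ (r + 3) / 2⌉ + 1 := by omega
    rw [h5] at h3
    exact_mod_cast (by linarith : residueElt ⌈s * t ^ (r + 3) / 2⌉ ((m : ℤ) ^ 2)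
      (-((upperPoly x).eval (x.2.2.1 : ℤ) +
        linCoeff m (-(boxM (r + 3) s t 1 : ℤ)) x * (x.2.2.1 : ℤ))) x.2.2.2.2 <
          ⌊s * t ^ (r + 3)⌋ + 1) |> Int.lt_add_one_iff.1

lemma LargeParams.wellShaped (h : LargeParams (r + 3) T s t m) (hx : x ∈ boxIndices r s t m) :
    WellShaped (boxPoly s t m x) m (2 * (r + 3 : ℕ) * t) (boxRho (r + 3) * t) :=
  (h.inBox hx).wellShaped h.four_le h.m_pos (by linarith [h.hT, h.hs]) h.hρ (by linarith [h.hT]) h.ht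
    h.htm

lemma LargeParams.mem_WmRed (h : LargeParams (r + 3) T s t m) (hx : x ∈ boxIndices r s t m) :
    (boxPoly s t m x, (x.2.2.1 : ℤ)) ∈ WmRed (r + 3) s t m := by
  have hbox := h.inBox hx
  have hs := h.s_pos
  have ht := h.t_pos
  obtain ⟨⟨ha, hb⟩, -, -, hl, -, -⟩ := mem_boxIndices.1 hx
  rw [Finset.mem_Ioc] at ha hb
  refine ⟨⟨⟨hbox.natDegree_eq, ?_, ?_, hbox.le_lead, hbox.lead_le, ?_⟩, by positivity, ?_,
    weaklyDivisibleAt_familyPoly x⟩, (h.wellShaped hx).isReducedPoly _⟩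
  · change (0 : ℝ) ≤ ((boxPoly s t m x).coeff (r + 2) : ℝ)
    rw [boxPoly, coeff_familyPoly_pred]
    positivity
  · change ((boxPoly s t m x).coeff (r + 2) : ℝ) ≤ s / 2
    rw [boxPoly, coeff_familyPoly_pred, Int.cast_natCast]
    exact le_trans (by exact_mod_cast hb.2) (Nat.floor_le (by positivity))
  · intro i hi hin
    have := hbox.abs_coeff_le hs ht (j := r + 3 - i) (by omega)
    rwa [show r + 3 - (r + 3 - i) = i by omega] at this
  · change (x.2.2.1 : ℤ) < m
    exact_mod_cast hl

lemma LargeParams.abs_ringDisc_le (h : LargeParams (r + 3) T s t m) (hn : 2 ≤ r + 3)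
    (hx : x ∈ boxIndices r s t m) :
    |(ringDisc (ringOf hn ⟨_, h.mem_WmRed hx⟩) : ℝ)| ≤
      (4 * (r + 3 : ℕ)) ^ ((r + 3) * (r + 2)) *
        (s ^ (2 * (r + 2)) * t ^ ((r + 3) * (r + 2)) / m ^ 2) := by
  have hbox := h.inBox hx
  have hs := h.s_pos
  have ht := h.t_pos
  refine ((h.wellShaped hx).abs_ringDisc_le _ h.m_pos _).trans ?_
  rw [hbox.natDegree_eq, show r + 3 - 1 = r + 2 by omega, div_pow, ← pow_mul]
  have h1 : (0 : ℝ) ≤ (boxPoly s t m x).coeff (r + 3) := le_trans (by positivity) hbox.le_lead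
  calc ((boxPoly s t m x).coeff (r + 3) : ℝ) ^ ((r + 2) * 2) / m ^ 2 *
        (2 * (2 * (r + 3 : ℕ) * t)) ^ ((r + 3) * (r + 2))
      ≤ s ^ ((r + 2) * 2) / m ^ 2 * (2 * (2 * (r + 3 : ℕ) * t)) ^ ((r + 3) * (r + 2)) := by
        gcongr
        exact hbox.lead_le
    _ = _ := by
        rw [show 2 * (2 * ((r + 3 : ℕ) : ℝ) * t) = 4 * (r + 3 : ℕ) * t by ring, mul_pow, mul_comm 2]
        ring

/-- The classes of distinct family members are distinct by `eq_of_ringEquiv`, and the discriminant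
bound puts them all in the counted set. -/
lemma LargeParams.card_le_ringCount (h : LargeParams (r + 3) T s t m) (hn : 2 ≤ r + 3) {D : ℝ}
    (hD : (4 * (r + 3 : ℕ) : ℝ) ^ ((r + 3) * (r + 2)) *
        (s ^ (2 * (r + 2)) * t ^ ((r + 3) * (r + 2)) / m ^ 2) ≤ D) :
    (boxIndices r s t m).card ≤ ringCount hn s t m D := by
  have hfin : Finite (WmRed (r + 3) s t m) := (finite_WmRed (r + 3) h.s_pos h.t_pos m).to_subtype
  let F : boxIndices r s t m → Quotient (isoSetoid hn s t m D) := fun x =>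
    Quotient.mk _ ⟨⟨_, h.mem_WmRed x.2⟩, (h.abs_ringDisc_le hn x.2).trans hD⟩
  have hF : Function.Injective F := by
    intro x y hxy
    obtain ⟨φ⟩ := Quotient.exact hxy
    have hbx := h.inBox x.2
    have hby := h.inBox y.2
    obtain ⟨⟨hax, hbx'⟩, hcx, -, hlx, -, -⟩ := mem_boxIndices.1 x.2
    obtain ⟨⟨hay, hby'⟩, -, -, hly, -, -⟩ := mem_boxIndices.1 y.2
    rw [Finset.mem_Ioc] at hax hbx' hay hby'
    have top : ∀ x : FamilyIndex r, (boxPoly s t m x).coeff (r + 3) = x.1.1 := fun x =>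
      coeff_familyPoly_top x
    have pred : ∀ x : FamilyIndex r, (boxPoly s t m x).coeff (r + 3 - 1) = x.1.2 := fun x =>
      coeff_familyPoly_pred x
    have key := eq_of_ringEquiv (h.wellShaped x.2) (h.wellShaped y.2)
      (hbx.natDegree_eq.trans hby.natDegree_eq.symm)
      -- Both leading coefficients lie in `(N, 2N]` with `N = ⌊s / 2⌋₊`, so each is at most twice
      -- the other.
      (by rw [hbx.natDegree_eq, hby.natDegree_eq, top, top]; omega)
      (by rw [hbx.natDegree_eq, hby.natDegree_eq, top, top]; omega)
      (by
        rw [hbx.natDegree_eq, top, pred]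
        exact Nat.isCoprime_iff_coprime.2 hcx)
      (by rw [hbx.natDegree_eq, pred]; omega)
      (by rw [hbx.natDegree_eq, top, pred]; omega)
      (by rw [hby.natDegree_eq, pred]; omega)
      (by rw [hby.natDegree_eq, top, pred]; omega)
      (Int.natCast_nonneg _) (Int.ofNat_lt.2 hlx) (Int.natCast_nonneg _) (Int.ofNat_lt.2 hly) φ
    exact Subtype.ext (familyPoly_injective h.m_pos (Prod.ext key.1 key.2))
  have := Nat.card_le_card_of_injective F hF
  rwa [Nat.card_eq_fintype_card, Fintype.card_coe] at this

/-! ### The size of the family -/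

/-- A quotient that is at least one loses at most half of its value to rounding. -/
lemma half_div_le_natDiv {k q : ℕ} {y : ℝ} (hq : 0 < q) (hy : q ≤ y) (hk : y ≤ k) :
    y / (2 * q) ≤ ((k / q : ℕ) : ℝ) := by
  have hq' : (0 : ℝ) < q := by exact_mod_cast hq
  have h1 : (1 : ℝ) ≤ ((k / q : ℕ) : ℝ) := by
    have : q ≤ k := by exact_mod_cast hy.trans hk
    exact_mod_cast (Nat.one_le_div_iff hq).2 this
  have h2 : (k : ℝ) < (((k / q : ℕ) : ℝ) + 1) * q := by
    exact_mod_cast Nat.lt_mul_of_div_lt (Nat.lt_succ_self (k / q)) hq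
  rw [div_le_iff₀ (by positivity)]
  nlinarith

lemma sum_Ioc_id_mul_two (N : ℕ) : (∑ k ∈ Finset.Ioc 0 N, k) * 2 = (N + 1) * N := by
  induction N with
  | zero => simp
  | succ N ih =>
    rw [Finset.sum_Ioc_succ_top (Nat.zero_le N), add_mul, ih]
    ring

/-- The weights add up to `2 + 3 + ⋯ + n = (n - 1)(n + 2) / 2`, with `n = r + 3`. -/
lemma prod_range_mul_pow (a t : ℝ) (r : ℕ) :
    (∏ j ∈ Finset.range r, (a * t ^ (r + 1 - j))) * (t ^ (r + 2) * t ^ (r + 3)) =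
      a ^ r * t ^ ((r + 2) * (r + 5) / 2) := by
  have h1 : ∑ j ∈ Finset.range r, (r + 1 - j) = ∑ i ∈ Finset.range r, (i + 2) := by
    rw [← Finset.sum_range_reflect (fun i => i + 2)]
    refine Finset.sum_congr rfl fun j hj => ?_
    have := Finset.mem_range.1 hj
    omega
  have h2 : (∑ i ∈ Finset.range r, (i + 2)) * 2 = r * (r + 3) := by
    clear h1
    induction r with
    | zero => simp
    | succ r ih =>
      rw [Finset.sum_range_succ, add_mul, ih]
      ring
  have h3 : (∑ i ∈ Finset.range r, (i + 2)) + (r + 2 + (r + 3)) = (r + 2) * (r + 5) / 2 := by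
    symm
    refine Nat.div_eq_of_eq_mul_left (by norm_num) ?_
    nlinarith [h2]
  rw [Finset.prod_mul_distrib, Finset.prod_const, Finset.card_range, Finset.prod_pow_eq_pow_sum, h1,
    mul_assoc, ← pow_add, ← pow_add, h3]

/-- The factor `256 = 16 · 2 · 8` collects the losses from the coprime pairs, the linear and the
constant coefficient; the power of `boxEta` comes from the `r` middle coefficients and the linear
one. -/
lemma LargeParams.le_card_boxIndices (h : LargeParams (r + 3) T s t m) :
    boxEta (r + 3) ^ (r + 1) / 256 *
        (s ^ (r + 4) * t ^ ((r + 2) * (r + 5) / 2) / m ^ 2) ≤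
      ((boxIndices r s t m).card : ℝ) := by
  have hs := h.s_pos
  have ht := h.t_pos
  have hη := boxEta_pos (n := r + 3) (by omega)
  have hm : (0 : ℝ) < m := by exact_mod_cast h.m_pos
  have hm1 : (1 : ℝ) ≤ m := by exact_mod_cast h.m_pos
  have hs4 : 4 ≤ s := h.hT.trans h.hs
  have ht1 : 1 ≤ t := by linarith [h.hT, h.ht]
  set η := boxEta (r + 3) with hηdef
  have e1 : s ^ 2 / 16 ≤ ((coprimePairs ⌊s / 2⌋₊).card : ℝ) := by
    have h1 := sum_le_card_coprimePairs ⌊s / 2⌋₊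
    have h2 := sum_Ioc_id_mul_two ⌊s / 2⌋₊
    have h4 : s / 2 < ⌊s / 2⌋₊ + 1 := Nat.lt_floor_add_one _
    have h5 : ((⌊s / 2⌋₊ : ℝ) + 1) * ⌊s / 2⌋₊ ≤ (coprimePairs ⌊s / 2⌋₊).card * 2 := by
      exact_mod_cast h2 ▸ Nat.mul_le_mul_right 2 h1
    nlinarith
  have e2 : ∏ j ∈ Finset.range r, (η * s * t ^ (r + 1 - j)) ≤
      ((∏ j ∈ Finset.range r, (2 * boxM (r + 3) s t (j + 2) + 1) : ℕ) : ℝ) := by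
    push_cast
    refine Finset.prod_le_prod (fun j _ => by positivity) fun j _ => ?_
    have := Nat.lt_floor_add_one (η * (s * t ^ (r + 3 - (j + 2))))
    rw [← boxM, show r + 3 - (j + 2) = r + 1 - j by omega] at this
    have h0 : (0 : ℝ) ≤ boxM (r + 3) s t (j + 2) := by positivity
    linarith
  have e3 : η * s * t ^ (r + 2) / (2 * m) ≤ boxN₁ (r + 3) s t m := by
    refine half_div_le_natDiv h.m_pos ?_ ?_
    · have h1 := h.htm
      rw [show r + 3 - 2 = r + 1 by omega] at h1
      have h2 : 1 ≤ T * η := h.hη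
      have h3 : T * m * η ≤ t ^ (r + 1) * η := mul_le_mul_of_nonneg_right h1 hη.le
      have h4 : (1 : ℝ) ≤ s * t := by nlinarith
      have h5 : t ^ (r + 1) * η * 1 ≤ t ^ (r + 1) * η * (s * t) := by gcongr
      calc (m : ℝ) = 1 * m := (one_mul _).symm
        _ ≤ T * η * m := by gcongr
        _ = T * m * η := by ring
        _ ≤ t ^ (r + 1) * η * (s * t) := by linarith
        _ = η * s * t ^ (r + 2) := by ring
    · have := Nat.lt_floor_add_one (η * (s * t ^ (r + 3 - 1)))
      rw [← boxM, show r + 3 - 1 = r + 2 by omega, ← mul_assoc] at this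
      have h0 : (0 : ℝ) ≤ boxM (r + 3) s t 1 := by positivity
      push_cast
      linarith
  -- The interval `[y / 2, y]` contains more than `y / 2 - 1 ≥ y / 4` integers once `y ≥ 4`;
  -- rounding to whole residue systems halves this again.
  have e4 : s * t ^ (r + 3) / (8 * m ^ 2) ≤ boxN₀ (r + 3) s t m := by
    have h1 := h.hstm
    have h2 : 4 * (m : ℝ) ^ 2 ≤ s * t ^ (r + 3) :=
      le_trans (mul_le_mul_of_nonneg_right h.hT (by positivity)) h1
    have h3 : (4 : ℝ) ≤ s * t ^ (r + 3) := by nlinarith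
    have h4 := half_div_le_natDiv (k := (⌊s * t ^ (r + 3)⌋ - ⌈s * t ^ (r + 3) / 2⌉ + 1).toNat)
      (q := m ^ 2) (y := s * t ^ (r + 3) / 4) (by have := h.m_pos; positivity)
      (by push_cast; linarith) (by
        have h5 : ((⌊s * t ^ (r + 3)⌋ - ⌈s * t ^ (r + 3) / 2⌉ + 1 : ℤ) : ℝ) ≤
            (((⌊s * t ^ (r + 3)⌋ - ⌈s * t ^ (r + 3) / 2⌉ + 1).toNat : ℤ) : ℝ) := by
          exact_mod_cast Int.self_le_toNat _
        rw [Int.cast_natCast] at h5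
        refine le_trans ?_ h5
        push_cast
        have h6 := Int.lt_floor_add_one (s * t ^ (r + 3))
        have h7 := Int.ceil_lt_add_one (s * t ^ (r + 3) / 2)
        linarith)
    refine le_trans (le_of_eq ?_) h4
    push_cast
    field_simp
    norm_num
  have e5 := prod_range_mul_pow (η * s) t r
  have e0 : (0 : ℝ) ≤ ∏ j ∈ Finset.range r, (η * s * t ^ (r + 1 - j)) :=
    Finset.prod_nonneg fun j _ => by positivity
  rw [boxIndices, card_familyIndices, Nat.cast_mul, Nat.cast_mul, Nat.cast_mul, Nat.cast_mul]
  calc η ^ (r + 1) / 256 * (s ^ (r + 4) * t ^ ((r + 2) * (r + 5) / 2) / m ^ 2)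
      = s ^ 2 / 16 * ((∏ j ∈ Finset.range r, (η * s * t ^ (r + 1 - j))) *
          (m * ((η * s * t ^ (r + 2) / (2 * m)) * (s * t ^ (r + 3) / (8 * m ^ 2))))) := by
        have e6 : s ^ 2 / 16 * ((∏ j ∈ Finset.range r, (η * s * t ^ (r + 1 - j))) *
            (m * ((η * s * t ^ (r + 2) / (2 * m)) * (s * t ^ (r + 3) / (8 * m ^ 2))))) =
            s ^ 2 / 16 * (η * s * s / (16 * m ^ 2)) *
              ((∏ j ∈ Finset.range r, (η * s * t ^ (r + 1 - j))) *
                (t ^ (r + 2) * t ^ (r + 3))) := by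
          field_simp
          norm_num
        rw [e6, e5, mul_pow]
        field_simp
        ring
    _ ≤ _ := by gcongr

end

/-! ### The parameters -/

lemma tParam_pow {n : ℕ} (hn : 2 ≤ n) {X s : ℝ} (hX : 0 < X) (hs : 0 < s) {m : ℕ} (hm : 0 < m) :
    tParam n X s m ^ (n * (n - 1)) = (m : ℝ) ^ 2 * X / s ^ (2 * n - 2) := by
  have hm' : (0 : ℝ) < m := by exact_mod_cast hm
  have hn' : (2 : ℝ) ≤ n := by exact_mod_cast hn
  rw [tParam, ← Real.rpow_natCast, ← Real.rpow_mul (by positivity), Nat.cast_mul,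
    Nat.cast_sub (by omega), Nat.cast_one, one_div_mul_cancel, Real.rpow_one]
  have : (n : ℝ) - 1 ≠ 0 := by linarith
  positivity

lemma tParam_pos (n : ℕ) {X s : ℝ} (hX : 0 < X) (hs : 0 < s) {m : ℕ} (hm : 0 < m) :
    0 < tParam n X s m := by
  have hm' : (0 : ℝ) < m := by exact_mod_cast hm
  rw [tParam]
  positivity

/-- The second condition reads `t^(n(n-1)) ≥ T^(n(n-1)) m^β`, which yields `t ≥ T` directly and
`t^(n-2) ≥ T m` after raising to the power `n - 2`. The third bounds `(s t^n)^(n-1) = m² X /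
s^(n-1)` from below. -/
lemma largeParams_tParam {n : ℕ} (hn : 4 ≤ n) {T : ℝ} (hT : 4 ≤ T)
    (hρ : 4 * (n : ℝ) ^ 3 ≤ T * boxRho n ^ (n - 1)) (hη : 1 ≤ T * boxEta n) {m : ℕ} {s X : ℝ}
    (hm : 0 < m) (hs : T ^ (n * (n - 1)) ≤ s)
    (h2 : T ^ (n * (n - 1)) *
      (s ^ (2 * n - 2) * (m : ℝ) ^ ((n : ℝ) - 1 + 2 / ((n : ℝ) - 2))) ≤ X)
    (h3 : T ^ (n * (n - 1)) * (s ^ (n - 1) * (m : ℝ) ^ (2 * n - 4)) ≤ X) :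
    LargeParams n T s (tParam n X s m) m := by
  have hT0 : 0 < T := by linarith
  have hT1 : 1 ≤ T := by linarith
  have hs0 : 0 < s := lt_of_lt_of_le (by positivity) hs
  have hm0 : (0 : ℝ) < m := by exact_mod_cast hm
  have hm1 : (1 : ℝ) ≤ m := by exact_mod_cast hm
  have hX : 0 < X := lt_of_lt_of_le (by positivity) h2
  have hn' : (4 : ℝ) ≤ n := by exact_mod_cast hn
  have ht := tParam_pos n hX hs0 hm
  have hpow := tParam_pow (n := n) (by omega) hX hs0 hm
  set t := tParam n X s m
  have hN : n * (n - 1) ≠ 0 := Nat.mul_ne_zero (by omega) (by omega)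
  -- This equals `2` plus the exponent of `m` in the second condition; the `2` comes from the factor
  -- `m²` in the definition of `t`.
  set β : ℝ := n * (n - 1) / (n - 2) with hβ
  have hn2 : (0 : ℝ) < n - 2 := by linarith
  have hβ0 : 0 ≤ β := div_nonneg (mul_nonneg (by linarith) (by linarith)) hn2.le
  have hY : T ^ (n * (n - 1)) * (m : ℝ) ^ β ≤ t ^ (n * (n - 1)) := by
    rw [hpow, le_div_iff₀ (by positivity)]
    have e : (m : ℝ) ^ β = (m : ℝ) ^ 2 * (m : ℝ) ^ ((n : ℝ) - 1 + 2 / ((n : ℝ) - 2)) := by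
      rw [← Real.rpow_natCast, ← Real.rpow_add hm0]
      congr 1
      rw [hβ]
      field_simp
      push_cast
      ring
    rw [e]
    refine le_trans (le_of_eq ?_) (mul_le_mul_of_nonneg_left h2 (sq_nonneg (m : ℝ)))
    ring
  refine ⟨hn, hm, hT, hρ, hη, (le_self_pow₀ hT1 hN).trans hs, ?_, ?_, ?_⟩
  · refine le_of_pow_le_pow_left₀ hN ht.le (le_trans ?_ hY)
    exact le_mul_of_one_le_right (by positivity) (Real.one_le_rpow hm1 hβ0)
  · refine le_of_pow_le_pow_left₀ hN (by positivity) ?_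
    rw [pow_right_comm t]
    have e : ((m : ℝ) ^ β) ^ (n - 2) = (m : ℝ) ^ (n * (n - 1)) := by
      rw [← Real.rpow_natCast, ← Real.rpow_mul hm0.le, ← Real.rpow_natCast]
      congr 1
      rw [hβ, Nat.cast_mul, Nat.cast_sub (by omega), Nat.cast_sub (by omega)]
      push_cast
      field_simp
    calc (T * m) ^ (n * (n - 1)) = T ^ (n * (n - 1)) * (m : ℝ) ^ (n * (n - 1)) := mul_pow _ _ _
      _ ≤ (T ^ (n * (n - 1))) ^ (n - 2) * (m : ℝ) ^ (n * (n - 1)) := by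
          gcongr
          exact le_self_pow₀ (one_le_pow₀ hT1) (by omega)
      _ = (T ^ (n * (n - 1)) * (m : ℝ) ^ β) ^ (n - 2) := by rw [mul_pow, e]
      _ ≤ (t ^ (n * (n - 1))) ^ (n - 2) := by gcongr
  · have hn1 : n - 1 ≠ 0 := by omega
    refine le_of_pow_le_pow_left₀ hn1 (by positivity) ?_
    rw [mul_pow s, ← pow_mul, hpow, show 2 * n - 2 = (n - 1) + (n - 1) by omega, pow_add s]
    have e : s ^ (n - 1) * ((m : ℝ) ^ 2 * X / (s ^ (n - 1) * s ^ (n - 1))) =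
        (m : ℝ) ^ 2 * X / s ^ (n - 1) := by
      field_simp
    rw [e, le_div_iff₀ (by positivity), mul_pow, ← pow_mul]
    have h4 : T ^ (n - 1) ≤ T ^ (n * (n - 1)) :=
      pow_le_pow_right₀ hT1 (Nat.le_mul_of_pos_left _ (by omega))
    calc T ^ (n - 1) * (m : ℝ) ^ (2 * (n - 1)) * s ^ (n - 1)
        ≤ T ^ (n * (n - 1)) * (m : ℝ) ^ (2 * (n - 1)) * s ^ (n - 1) := by gcongr
      _ = (m : ℝ) ^ 2 * (T ^ (n * (n - 1)) * (s ^ (n - 1) * (m : ℝ) ^ (2 * n - 4))) := by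
          rw [show 2 * (n - 1) = 2 + (2 * n - 4) by omega, pow_add]
          ring
      _ ≤ (m : ℝ) ^ 2 * X := by gcongr

/-- The main term in terms of `s`, `t` and `m`. -/
lemma main_term_eq {r m : ℕ} {s t X : ℝ} (hs : 0 < s) (ht : 0 < t) (hm : 0 < m)
    (hX : X = s ^ (2 * (r + 2)) * t ^ ((r + 3) * (r + 2)) / (m : ℝ) ^ 2) :
    X ^ (1 / 2 + 1 / ((r + 3 : ℕ) : ℝ)) * s ^ (2 / ((r + 3 : ℕ) : ℝ)) /
        (m : ℝ) ^ (1 - 2 / ((r + 3 : ℕ) : ℝ)) =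
      s ^ (r + 4) * t ^ ((r + 2) * (r + 5) / 2) / (m : ℝ) ^ 2 := by
  have hm0 : (0 : ℝ) < m := by exact_mod_cast hm
  have hE : (((r + 2) * (r + 5) / 2 : ℕ) : ℝ) = (r + 2) * (r + 5) / 2 := by
    have h2 : 2 ∣ (r + 2) * (r + 5) := by
      rcases Nat.even_or_odd r with h | h
      · exact Dvd.dvd.mul_right (h.add (by norm_num : Even 2)).two_dvd _
      · exact Dvd.dvd.mul_left (h.add_odd (by decide : Odd 5)).two_dvd _
    rw [Nat.cast_div h2 (by norm_num)]
    push_cast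
    ring
  -- Passing to logarithms reduces the identity to one that is linear in `a`, `b`, `d`.
  obtain ⟨a, rfl⟩ : ∃ a, Real.exp a = s := ⟨_, Real.exp_log hs⟩
  obtain ⟨b, rfl⟩ : ∃ b, Real.exp b = t := ⟨_, Real.exp_log ht⟩
  obtain ⟨d, hd⟩ : ∃ d, Real.exp d = m := ⟨_, Real.exp_log hm0⟩
  rw [hX, ← hd]
  simp only [← Real.exp_nat_mul, ← Real.exp_add, ← Real.exp_sub, ← Real.exp_mul]
  congr 1
  rw [hE]
  have hr : (0 : ℝ) < (r : ℝ) + 3 := by positivity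
  push_cast
  field_simp
  ring

end WeaklyDivisible

theorem mainTheorem6 (n : ℕ) (hn : 4 ≤ n) :
    ∃ A : ℝ, 0 < A ∧ ∃ c : ℝ, 0 < c ∧ ∀ ε : ℝ, 0 < ε → ∃ K : ℝ, 0 < K ∧
      ∀ (m : ℕ) (s X : ℝ), 0 < m → K ≤ s →
        K * (s ^ (2 * n - 2) * (m : ℝ) ^ ((n : ℝ) - 1 + 2 / ((n : ℝ) - 2))) ≤ X →
        K * (s ^ (n - 1) * (m : ℝ) ^ (2 * n - 4)) ≤ X →
        c * (1 - ε) * (X ^ (1 / 2 + 1 / (n : ℝ)) * s ^ (2 / (n : ℝ)) /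
            (m : ℝ) ^ (1 - 2 / (n : ℝ)))
          ≤ (WeaklyDivisible.S (le_trans (by norm_num) hn : 2 ≤ n) A X s m : ℝ) := by
  obtain ⟨r, rfl⟩ : ∃ r, n = r + 3 := ⟨n - 3, by omega⟩
  have hρ := WeaklyDivisible.boxRho_pos (n := r + 3) (by omega)
  have hη := WeaklyDivisible.boxEta_pos (n := r + 3) (by omega)
  set ρ := WeaklyDivisible.boxRho (r + 3) with hρdef
  set η := WeaklyDivisible.boxEta (r + 3) with hηdef
  -- One summand for each of the three lower bounds demanded of `T`.
  set T : ℝ := 4 * ((r + 3 : ℕ) : ℝ) ^ 3 / ρ ^ (r + 3 - 1) + 1 / η + 4 with hT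
  have hT1 : 0 ≤ 4 * ((r + 3 : ℕ) : ℝ) ^ 3 / ρ ^ (r + 3 - 1) := by positivity
  have hT2 : 0 ≤ 1 / η := by positivity
  have hT4 : 4 ≤ T := by linarith
  -- `A` is the constant of the discriminant bound, `c` that of the count; the threshold `K` can be
  -- taken independent of `ε`.
  refine ⟨(4 * (r + 3 : ℕ)) ^ ((r + 3) * (r + 2)), by positivity, η ^ (r + 1) / 256, by positivity,
    fun ε hε => ⟨T ^ ((r + 3) * (r + 3 - 1)), by positivity, ?_⟩⟩
  intro m s X hm hs h2 h3
  have hs0 : 0 < s := lt_of_lt_of_le (by positivity) hs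
  have hm0 : (0 : ℝ) < m := by exact_mod_cast hm
  have hX : 0 < X := lt_of_lt_of_le (by positivity) h2
  have hP : WeaklyDivisible.LargeParams (r + 3) T s (WeaklyDivisible.tParam (r + 3) X s m) m := by
    refine WeaklyDivisible.largeParams_tParam hn hT4 ?_ ?_ hm hs h2 h3
    · rw [← div_le_iff₀ (by positivity)]
      linarith
    · rw [← div_le_iff₀ hη]
      linarith
  have hXt : X = s ^ (2 * (r + 2)) * WeaklyDivisible.tParam (r + 3) X s m ^ ((r + 3) * (r + 2)) /
      (m : ℝ) ^ 2 := by
    have := WeaklyDivisible.tParam_pow (n := r + 3) (by omega) hX hs0 hm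
    rw [show r + 3 - 1 = r + 2 by omega, show 2 * (r + 3) - 2 = 2 * (r + 2) by omega] at this
    rw [this]
    field_simp
  have hmain := WeaklyDivisible.main_term_eq hs0 hP.t_pos hm hXt
  have hcard := hP.card_le_ringCount (by omega) (D := (4 * (r + 3 : ℕ)) ^ ((r + 3) * (r + 2)) * X)
    (by rw [← hXt])
  have hle := hP.le_card_boxIndices
  rw [hmain]
  have hpos : 0 < s ^ (r + 4) * WeaklyDivisible.tParam (r + 3) X s m ^ ((r + 2) * (r + 5) / 2) /
      (m : ℝ) ^ 2 := by
    have := hP.t_pos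
    positivity
  have hcast : ((WeaklyDivisible.boxIndices r s (WeaklyDivisible.tParam (r + 3) X s m) m).card : ℝ) ≤
      (WeaklyDivisible.S (le_trans (by norm_num) hn : 2 ≤ r + 3)
        ((4 * (r + 3 : ℕ)) ^ ((r + 3) * (r + 2))) X s m : ℝ) := by
    exact_mod_cast hcard
  refine le_trans ?_ (hle.trans hcast)
  -- The bound is proved with `c` itself, so the factor `1 - ε < 1` only weakens it.
  refine mul_le_mul_of_nonneg_right ?_ hpos.le
  have : 0 < η ^ (r + 1) / 256 := by positivity
  nlinarith
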